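/- Let $n\ge 1$, and let $\mathbb C^n=\mathbb R^{2n}$ carry its standard Euclidean structure and $\Omega=dz^1\wedge\dots\wedge dz^n$. Definitions. A *special Lagrangian (SLag) plane* is an oriented real $n$-dimensional linear subspace of $\mathbb C^n$ calibrated by $\operatorname{Re}\Omega$, i.e. with $\operatorname{Re}\Omega(e_1,\dots,e_n)=1$ for an oriented orthonormal basis. The space of SLag planes has the topology of a subspace of the Grassmannian of oriented $n$-planes of $\mathbb R^{2n}$. Two planes are *transverse* if they span $\mathbb R^{2n}$; $-\xi$ is $\xi$ with the opposite orientation. The *characterizing angles* between oriented $n$-planes $\eta,\xi$ are the numbers $0\le\theta_1\le\dots\le\theta_{n-1}\le\frac\pi2$, $\theta_{n-1}\le\theta_n\le\pi-\theta_{n-1}$ (for $n=1$: $0\le\theta_1\le\pi$) for which there is an orthonormal basis $e_1,\dots,e_{2n}$ of $\mathbb R^{2n}$ with $\eta=e_1\wedge\dots\wedge e_n$ and $\xi=(\cos\theta_1e_1+\sin\theta_1e_{n+1})\wedge\dots\wedge(\cos\theta_ne_n+\sin\theta_ne_{2n})$. The pair $\eta,\xi$ satisfies the *angle criterion* if the characterizing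 angles between $\eta$ and $-\xi$ satisfy $\sum_i\theta_i=\pi$. For $a_1,\dots,a_n>0$ let $p$ be the polynomial with $1+x^2p(x)=\prod_k(1+a_kx^2)$ and put $$\psi_k(y)=\int_{-\infty}^y\frac{a_k\,dx}{(1+a_kx^2)\sqrt{p(x)}},\qquad \theta_k=\psi_k(\infty),\qquad z_k(y)=e^{-i\psi_k(y)}\sqrt{a_k^{-1}+y^2}.$$ If all $\theta_k\in(0,\pi)$ (automatic for $n\ge2$), the set $\{(z_1(y)x_1,\dots,z_n(y)x_n): y\in\mathbb R,\ x\in\mathbb R^n,\ |x|=1\}$ is Lawlor's special Lagrangian submanifold. Its images under $SU(n)$ and dilations are the *Lawlor necks*; they are oriented so that $\operatorname{Re}\Omega>0$ on them. A neck $N$ is *asymptotic in an oriented sense* to $\eta$ and $\xi$ if, outside a compact set, it is the disjoint union of two ends, parametrized by orientation-preserving smooth injective maps $\Phi:\eta\setminus B_R\to N$ and $\Psi:\xi\setminus B_R\to N$ such that the differences of $\Phi$, $\Psi$ from the inclusions of $\eta$, $\xi$ tend to $0$ at infinity together with their first derivatives. Statement. (1) For SLag planes $\eta,\xi$ in $\mathbb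 C^n$, there exists a Lawlor neck asymptotic in an oriented sense to $\eta$ and $\xi$ if and only if $\eta$ and $\xi$ are transverse and satisfy the angle criterion. (2) Each of these two equivalent conditions (existence of such a Lawlor neck; being transverse and satisfying the angle criterion) is open in the space of pairs of SLag planes. (3) If $n\le3$, every pair of SLag planes in $\mathbb C^n$ satisfies the angle criterion. -/

import Mathlib

open scoped BigOperators ContDiff

noncomputable section

namespace SLag

/-- `ℂⁿ`. Its real inner product is the real part of the Hermitian one, so that as a real
inner product space it is the standard `ℝ²ⁿ`. -/
abbrev Cn (n : ℕ) : Type := EuclideanSpace ℂ (Fin n)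

/-! ### Oriented real `n`-planes in `ℂⁿ` -/

/-- An ordered `n`-tuple of vectors of `ℂⁿ` that is orthonormal for the real inner product. -/
abbrev Frame (n : ℕ) : Type := {e : Fin n → Cn n // Orthonormal ℝ e}

/-- The tuple `e · g`, whose `j`-th vector is `∑ i, g i j • e i`. -/
def mulFrame {n : ℕ} (e : Fin n → Cn n) (g : Matrix (Fin n) (Fin n) ℝ) : Fin n → Cn n :=
  fun j => ∑ i, g i j • e i

theorem mulFrame_one {n : ℕ} (e : Fin n → Cn n) : mulFrame e 1 = e := by
  funext j
  simp [mulFrame, Matrix.one_apply]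

theorem mulFrame_mul {n : ℕ} (e : Fin n → Cn n) (g h : Matrix (Fin n) (Fin n) ℝ) :
    mulFrame e (g * h) = mulFrame (mulFrame e g) h := by
  funext j
  simp only [mulFrame, Matrix.mul_apply, Finset.sum_smul, Finset.smul_sum, smul_smul]
  rw [Finset.sum_comm]
  simp only [mul_comm]

theorem mulFrame_transpose {n : ℕ} (e : Fin n → Cn n) {g : Matrix (Fin n) (Fin n) ℝ}
    (hg : g ∈ Matrix.specialOrthogonalGroup (Fin n) ℝ) :
    mulFrame (mulFrame e g) g.transpose = e := by
  rw [← mulFrame_mul, (Matrix.mem_orthogonalGroup_iff _ _).1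
    (Matrix.mem_specialOrthogonalGroup_iff.1 hg).1, mulFrame_one]

theorem transpose_mem_specialOrthogonalGroup {n : ℕ} {g : Matrix (Fin n) (Fin n) ℝ}
    (hg : g ∈ Matrix.specialOrthogonalGroup (Fin n) ℝ) :
    g.transpose ∈ Matrix.specialOrthogonalGroup (Fin n) ℝ := by
  rw [← Matrix.conjTranspose_eq_transpose_of_trivial]
  exact (star (⟨g, hg⟩ : Matrix.specialOrthogonalGroup (Fin n) ℝ)).2

/-- Two orthonormal frames are equivalent if they differ by an element of `SO(n)`, i.e. if they
are oriented orthonormal bases of the same oriented `n`-plane. -/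
instance frameSetoid (n : ℕ) : Setoid (Frame n) where
  r e e' := ∃ g ∈ Matrix.specialOrthogonalGroup (Fin n) ℝ, e'.1 = mulFrame e.1 g
  iseqv :=
    { refl := fun e => ⟨1, one_mem _, (mulFrame_one e.1).symm⟩
      symm := by
        rintro e e' ⟨g, hg, h⟩
        exact ⟨g.transpose, transpose_mem_specialOrthogonalGroup hg, by rw [h, mulFrame_transpose e.1 hg]⟩
      trans := by
        rintro e e' e'' ⟨g, hg, h⟩ ⟨k, hk, h'⟩
        exact ⟨g * k, mul_mem hg hk, by rw [h', h, mulFrame_mul]⟩ }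

/-- The Grassmannian of oriented real `n`-planes in `ℂⁿ = ℝ²ⁿ`, with the quotient topology coming
from orthonormal frames. The class of `e` is the oriented plane `e 0 ∧ ⋯ ∧ e (n-1)`. -/
abbrev OrientedPlane (n : ℕ) : Type := Quotient (frameSetoid n)

/-- The linear subspace underlying an oriented plane. -/
def OrientedPlane.toSubmodule {n : ℕ} (η : OrientedPlane n) : Submodule ℝ (Cn n) :=
  Quotient.lift (fun e : Frame n => Submodule.span ℝ (Set.range e.1))
    (by
      have key : ∀ (e : Fin n → Cn n) (g : Matrix (Fin n) (Fin n) ℝ),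
          Submodule.span ℝ (Set.range (mulFrame e g)) ≤ Submodule.span ℝ (Set.range e) := by
        intro e g
        rw [Submodule.span_le]
        rintro _ ⟨j, rfl⟩
        exact Submodule.sum_mem _ fun i _ =>
          Submodule.smul_mem _ _ (Submodule.subset_span ⟨i, rfl⟩)
      rintro e e' ⟨g, hg, h⟩
      rw [h]
      refine le_antisymm ?_ (key _ _)
      conv_lhs => rw [← mulFrame_transpose e.1 hg]
      exact key _ _) η

/-- The frame with its first vector reversed. -/
def flipFrame {n : ℕ} (e : Frame n) : Frame n :=
  ⟨fun i => (if (i : ℕ) = 0 then (-1 : ℝ) else 1) • e.1 i, by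
    obtain ⟨e, he⟩ := e
    rw [orthonormal_iff_ite] at he ⊢
    intro i j
    have := he i j
    simp only [real_inner_smul_left, real_inner_smul_right, this]
    by_cases hij : i = j
    · subst hij
      by_cases h0 : (i : ℕ) = 0 <;> simp [h0]
    · simp [hij]⟩

/-- The plane `-η`: the same subspace with the opposite orientation (for `n ≥ 1`). -/
def OrientedPlane.neg {n : ℕ} (η : OrientedPlane n) : OrientedPlane n :=
  Quotient.map flipFrame
    (by
      rintro e e' ⟨g, hg, h⟩
      set s : Fin n → ℝ := fun i => if (i : ℕ) = 0 then (-1 : ℝ) else 1 with hs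
      have hs2 : ∀ i, s i * s i = 1 := by
        intro i
        simp only [hs]
        split_ifs <;> norm_num
      have hD : Matrix.diagonal s * Matrix.diagonal s = 1 := by
        rw [Matrix.diagonal_mul_diagonal, ← Matrix.diagonal_one]
        congr 1
        funext i
        exact hs2 i
      have hDs : (Matrix.diagonal s).transpose = Matrix.diagonal s :=
        Matrix.diagonal_transpose s
      have hDd : (Matrix.diagonal s).det * (Matrix.diagonal s).det = 1 := by
        rw [← Matrix.det_mul, hD, Matrix.det_one]
      obtain ⟨hg1, hg2⟩ := Matrix.mem_specialOrthogonalGroup_iff.1 hg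
      rw [Matrix.mem_orthogonalGroup_iff] at hg1
      refine ⟨Matrix.diagonal s * g * Matrix.diagonal s, ?_, ?_⟩
      · rw [Matrix.mem_specialOrthogonalGroup_iff, Matrix.mem_orthogonalGroup_iff]
        refine ⟨?_, ?_⟩
        · rw [Matrix.transpose_mul, Matrix.transpose_mul, hDs]
          calc Matrix.diagonal s * g * Matrix.diagonal s
                * (Matrix.diagonal s * (g.transpose * Matrix.diagonal s))
              = Matrix.diagonal s * g * (Matrix.diagonal s * Matrix.diagonal s) * g.transpose
                * Matrix.diagonal s := by simp only [mul_assoc]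
            _ = Matrix.diagonal s * (g * g.transpose) * Matrix.diagonal s := by
                rw [hD]; simp only [mul_assoc, mul_one]
            _ = 1 := by rw [hg1, mul_one, hD]
        · rw [Matrix.det_mul, Matrix.det_mul, hg2, mul_one, hDd]
      · have e1 : ∀ f : Frame n, (flipFrame f).1 = mulFrame f.1 (Matrix.diagonal s) := by
          intro f
          funext j
          simp [flipFrame, mulFrame, Matrix.diagonal_apply, hs]
        rw [e1, e1, h, ← mulFrame_mul, ← mulFrame_mul, ← mul_assoc, ← mul_assoc, hD, one_mul]) η

/-- Two planes are transverse if together they span `ℂⁿ` over `ℝ`. -/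
def OrientedPlane.Transverse {n : ℕ} (η ξ : OrientedPlane n) : Prop :=
  η.toSubmodule ⊔ ξ.toSubmodule = ⊤

/-! ### Special Lagrangian planes -/

/-- The holomorphic volume form `Ω = dz¹ ∧ ⋯ ∧ dzⁿ`. -/
def Omega {n : ℕ} (v : Fin n → Cn n) : ℂ :=
  Matrix.det (Matrix.of fun i j => v j i)

theorem Omega_mulFrame {n : ℕ} (e : Fin n → Cn n) (g : Matrix (Fin n) (Fin n) ℝ) :
    Omega (mulFrame e g) = Omega e * (g.det : ℂ) := by
  have h : (Matrix.of fun i j => mulFrame e g j i : Matrix (Fin n) (Fin n) ℂ)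
      = (Matrix.of fun i j => e j i) * g.map Complex.ofRealHom := by
    ext i j
    simp [mulFrame, Matrix.mul_apply, mul_comm]
  have h2 : ((g.det : ℝ) : ℂ) = (g.map Complex.ofRealHom).det :=
    RingHom.map_det Complex.ofRealHom g
  rw [Omega, Omega, h, Matrix.det_mul, h2]

/-- An oriented plane is special Lagrangian if it is calibrated by `Re Ω`. -/
def OrientedPlane.IsSpecialLagrangian {n : ℕ} (η : OrientedPlane n) : Prop :=
  Quotient.lift (fun e : Frame n => (Omega e.1).re = 1)
    (by
      rintro e e' ⟨g, hg, h⟩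
      simp [h, Omega_mulFrame, (Matrix.mem_specialOrthogonalGroup_iff.1 hg).2]) η

/-- The space of special Lagrangian planes, a subspace of the oriented Grassmannian. -/
abbrev SLagPlane (n : ℕ) : Type := {η : OrientedPlane n // η.IsSpecialLagrangian}

/-! ### Characterizing angles and the angle criterion -/

/-- `θ` are the characterizing angles between the oriented planes `η` and `ξ`:
`0 ≤ θ₁ ≤ ⋯ ≤ θₙ₋₁ ≤ π/2`, `θₙ₋₁ ≤ θₙ ≤ π - θₙ₋₁` (for `n = 1`: `0 ≤ θ₁ ≤ π`), and there is an
orthonormal basis `e₁, …, eₙ, f₁, …, fₙ` of `ℝ²ⁿ` with `η = e₁ ∧ ⋯ ∧ eₙ` and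
`ξ = (cos θ₁ e₁ + sin θ₁ f₁) ∧ ⋯ ∧ (cos θₙ eₙ + sin θₙ fₙ)`. -/
def IsCharacterizingAngles {n : ℕ} (η ξ : OrientedPlane n) (θ : Fin n → ℝ) : Prop :=
  (∀ i, 0 ≤ θ i ∧ θ i ≤ Real.pi) ∧ Monotone θ ∧
    (∀ i j, i < j → θ i ≤ Real.pi / 2 ∧ θ j ≤ Real.pi - θ i) ∧
    ∃ (e : Frame n) (f : Fin n → Cn n) (e' : Frame n),
      Orthonormal ℝ (Sum.elim e.1 f) ∧
      (∀ j, e'.1 j = Real.cos (θ j) • e.1 j + Real.sin (θ j) • f j) ∧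
      η = ⟦e⟧ ∧ ξ = ⟦e'⟧

/-- The angle criterion: the characterizing angles between `η` and `-ξ` add up to `π`. -/
def AngleCriterion {n : ℕ} (η ξ : OrientedPlane n) : Prop :=
  ∃ θ : Fin n → ℝ, IsCharacterizingAngles η ξ.neg θ ∧ ∑ i, θ i = Real.pi

/-! ### Lawlor necks -/

/-- The polynomial `p` with `1 + x² p(x) = ∏ k, (1 + a k x²)`. -/
def lawlorPoly {n : ℕ} (a : Fin n → ℝ) (x : ℝ) : ℝ :=
  ∑ S ∈ (Finset.univ : Finset (Finset (Fin n))).erase ∅, (∏ k ∈ S, a k) * x ^ (2 * (S.card - 1))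

theorem one_add_sq_mul_lawlorPoly {n : ℕ} (a : Fin n → ℝ) (x : ℝ) :
    1 + x ^ 2 * lawlorPoly a x = ∏ k, (1 + a k * x ^ 2) := by
  rw [Finset.prod_one_add, Finset.powerset_univ,
    ← Finset.add_sum_erase _ _ (Finset.mem_univ (∅ : Finset (Fin n)))]
  rw [Finset.prod_empty, lawlorPoly, Finset.mul_sum]
  congr 1
  refine Finset.sum_congr rfl fun S hS => ?_
  have hS' : S.card ≠ 0 := by
    simpa [Finset.card_eq_zero] using hS
  obtain ⟨m, hm⟩ := Nat.exists_eq_succ_of_ne_zero hS'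
  rw [Finset.prod_mul_distrib, Finset.prod_const, hm, Nat.succ_sub_one, ← pow_mul]
  rw [Nat.succ_eq_add_one]
  ring

/-- The integrand `a k / ((1 + a k x²) √p(x))`. -/
def lawlorIntegrand {n : ℕ} (a : Fin n → ℝ) (k : Fin n) (x : ℝ) : ℝ :=
  a k / ((1 + a k * x ^ 2) * Real.sqrt (lawlorPoly a x))

/-- The function `ψ k`, the integral of `lawlorIntegrand a k` from `-∞` to `y`. -/
def lawlorPhase {n : ℕ} (a : Fin n → ℝ) (k : Fin n) (y : ℝ) : ℝ :=
  ∫ x in Set.Iic y, lawlorIntegrand a k x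

/-- The total angle `θ k`, the integral of `lawlorIntegrand a k` over `ℝ`. -/
def lawlorAngle {n : ℕ} (a : Fin n → ℝ) (k : Fin n) : ℝ :=
  ∫ x, lawlorIntegrand a k x

/-- The profile curve `z k (y) = exp (-i ψ k (y)) √(1 / a k + y²)`. -/
def lawlorCurve {n : ℕ} (a : Fin n → ℝ) (k : Fin n) (y : ℝ) : ℂ :=
  (Real.sqrt (1 / a k + y ^ 2) : ℂ) * Complex.exp (-(lawlorPhase a k y : ℂ) * Complex.I)

/-- Lawlor's special Lagrangian submanifold
`{(z₁(y) x₁, …, zₙ(y) xₙ) : y ∈ ℝ, x ∈ ℝⁿ, |x| = 1}`. It is asymptotic to `P(0, …, 0)` as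
`y → -∞` and to `-P(-θ₁, …, -θₙ)` as `y → ∞`, where `P(φ)` is the oriented plane with the oriented
basis `exp (i φ k) ∂/∂xᵏ` and `θ k = lawlorAngle a k`. -/
def lawlorModel {n : ℕ} (a : Fin n → ℝ) : Set (Cn n) :=
  {w | ∃ (y : ℝ) (x : EuclideanSpace ℝ (Fin n)), ‖x‖ = 1 ∧
    ∀ k, w k = lawlorCurve a k y * (x k : ℂ)}

/-- A Lawlor neck: the image under an element of `SU(n)` and a dilation of one of Lawlor's
submanifolds, whose angles are to lie in `(0, π)` (this is automatic for `n ≥ 2`). -/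
def IsLawlorNeck {n : ℕ} (N : Set (Cn n)) : Prop :=
  ∃ a : Fin n → ℝ, (∀ k, 0 < a k) ∧ (∀ k, lawlorAngle a k ∈ Set.Ioo 0 Real.pi) ∧
    ∃ A ∈ Matrix.specialUnitaryGroup (Fin n) ℂ, ∃ t : ℝ, 0 < t ∧
      N = (fun w : Cn n => t • Matrix.toEuclideanLin A w) '' lawlorModel a

/-! ### Being asymptotic to two planes -/

/-- The parametrization `x ↦ ∑ i, x i • e i` of the plane spanned by `e`. -/
def frameMap {n : ℕ} (e : Fin n → Cn n) : EuclideanSpace ℝ (Fin n) →L[ℝ] Cn n :=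
  ∑ i, (EuclideanSpace.proj i : EuclideanSpace ℝ (Fin n) →L[ℝ] ℝ).smulRight (e i)

/-- The complement of the closed ball of radius `R` in `ℝⁿ`. -/
def exterior (n : ℕ) (R : ℝ) : Set (EuclideanSpace ℝ (Fin n)) := {x | R < ‖x‖}

/-- `Φ` parametrizes an end of `N` that is asymptotic, in the oriented sense, to `η`: with respect
to an oriented orthonormal basis `e` of `η`, which identifies `η` with `ℝⁿ`, `Φ` is an injective map,
smooth up to the boundary, from the complement of a ball of `η` into `N`, both `Φ` minus the inclusion of `η`
and its derivative tend to zero at infinity, and `Φ` preserves orientations, where `N` carries the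
orientation of a special Lagrangian submanifold, the one on which `Re Ω` is positive. -/
def IsOrientedEnd {n : ℕ} (N : Set (Cn n)) (η : OrientedPlane n) (R : ℝ)
    (Φ : EuclideanSpace ℝ (Fin n) → Cn n) : Prop :=
  (∀ x, R ≤ ‖x‖ → ContDiffAt ℝ ∞ Φ x) ∧ Set.InjOn Φ (exterior n R) ∧
    Set.MapsTo Φ (exterior n R) N ∧
    (∀ x ∈ exterior n R,
      0 < (Omega fun j => fderiv ℝ Φ x (EuclideanSpace.single j (1 : ℝ))).re) ∧
    ∃ e : Frame n, η = ⟦e⟧ ∧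
      Filter.Tendsto (fun x => Φ x - frameMap e.1 x) (Bornology.cobounded _) (nhds 0) ∧
      Filter.Tendsto (fun x => fderiv ℝ Φ x - frameMap e.1) (Bornology.cobounded _) (nhds 0)

/-- The special Lagrangian submanifold `N` is asymptotic in the oriented sense to `η` and `ξ`:
outside a compact set it consists of two disjoint ends, one asymptotic to `η` and one to `ξ`. -/
def IsAsymptoticTo {n : ℕ} (N : Set (Cn n)) (η ξ : OrientedPlane n) : Prop :=
  ∃ R : ℝ, 0 < R ∧ ∃ Φ Ψ : EuclideanSpace ℝ (Fin n) → Cn n,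
    IsOrientedEnd N η R Φ ∧ IsOrientedEnd N ξ R Ψ ∧
    Disjoint (Φ '' exterior n R) (Ψ '' exterior n R) ∧
    IsCompact (N \ (Φ '' exterior n R ∪ Ψ '' exterior n R))

end SLag

end

namespace SLag

noncomputable section

/-! ### Oriented planes as matrices: special Lagrangian frames and `SU(n)` -/

section

open Matrix

/-! By the equality case of Hadamard's inequality, a plane calibrated by `Re Ω` is spanned over `ℝ`
by the columns of some `E ∈ SU(n)`. Such an `E` is unique up to `SO(n)`, so the plane is encoded by
the symmetric unitary matrix `E Eᵀ` (`OrientedPlane.symMatrix`). For two such planes the relative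
matrix is again symmetric and unitary, hence diagonalized by a real orthogonal matrix. This yields
the normal form (`exists_normalForm`): a unitary basis `u_k` of `η` and phases `φ_k ∈ [0, π)` such
that the vectors `exp(-iφ_k) u_k` span `ξ`. Determinants show that `∑ φ_k` is a multiple of `π`;
transversality means that no `sin φ_k` vanishes; interchanging the planes replaces `φ_k` by `π -
φ_k`.

Everything is compared with `LawlorPair`: phases in `(0, π)` of sum exactly `π`. If the sum is `π`,
the basis `exp(-iφ_k) u_k` has determinant `-1`, so it orients `-ξ` and the `φ_k` are characterizing
angles of `η` and `-ξ`. Conversely, for a transverse pair with characterizing angles `θ` of sum `π`,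
real Gram matrices give `cos² θ = cos² φ` up to order, and determinants give a sign relation;
together they force `∑ φ_k` to be `π` or `(n - 1)π` (`sum_eq_of_cos_sq_eq`), and the second case is
the first with the planes interchanged. For `n ≤ 3` the only possible sums are `0`, `π` and `(n -
1)π`, and each gives the angle criterion. Since the sums are discrete, failure of the condition is
closed on the compact space of normal forms, which proves openness.

On the side of necks, Lawlor's angles always add up to `π` (`sum_lawlorAngle`), and every positive
tuple with this sum occurs (`exists_lawlorAngle_eq`). The decay of the phases, for `n ≥ 2`, makes
the neck asymptotic to its two planes (`NormalForm.isAsymptoticTo`). Conversely, a neck determines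
its planes from far away: it is at bounded distance from `η ∪ ξ` and from the two planes of the
model, and a plane at bounded distance from a union of two planes lies in one of them. For `n = 1`
both sides are empty, as the single angle would be `π`. -/

/-- The complex matrix whose columns are the vectors of a tuple. -/
def frameMatrix {n : ℕ} (e : Fin n → Cn n) : Matrix (Fin n) (Fin n) ℂ :=
  Matrix.of fun i j => e j i

/-- A real matrix regarded as a complex one. -/
abbrev complexify {n : ℕ} (g : Matrix (Fin n) (Fin n) ℝ) : Matrix (Fin n) (Fin n) ℂ :=
  g.map Complex.ofRealHom

theorem complexify_mul {n : ℕ} (g h : Matrix (Fin n) (Fin n) ℝ) :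
    complexify (g * h) = complexify g * complexify h := Matrix.map_mul

theorem complexify_one {n : ℕ} : complexify (1 : Matrix (Fin n) (Fin n) ℝ) = 1 := by
  simp [complexify]

theorem complexify_transpose {n : ℕ} (g : Matrix (Fin n) (Fin n) ℝ) :
    complexify gᵀ = (complexify g)ᵀ := by
  simp [complexify, Matrix.transpose_map]

theorem complexify_conjTranspose {n : ℕ} (g : Matrix (Fin n) (Fin n) ℝ) :
    (complexify g)ᴴ = complexify gᵀ := by
  ext i j
  simp [complexify, Matrix.conjTranspose_apply]

theorem complexify_injective {n : ℕ} :
    Function.Injective (complexify : Matrix (Fin n) (Fin n) ℝ → _) := fun g h hgh => by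
  ext i j
  have := congrFun (congrFun hgh i) j
  simpa [complexify] using this

theorem det_complexify {n : ℕ} (g : Matrix (Fin n) (Fin n) ℝ) :
    (complexify g).det = (g.det : ℂ) :=
  (RingHom.map_det Complex.ofRealHom g).symm

theorem frameMatrix_mulFrame {n : ℕ} (e : Fin n → Cn n) (g : Matrix (Fin n) (Fin n) ℝ) :
    frameMatrix (mulFrame e g) = frameMatrix e * complexify g := by
  ext i j
  simp [frameMatrix, mulFrame, Matrix.mul_apply, mul_comm]

theorem frameMatrix_injective {n : ℕ} :
    Function.Injective (frameMatrix : (Fin n → Cn n) → _) := fun e e' h => by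
  funext j
  ext i
  exact congrFun (congrFun h i) j

theorem re_conjTranspose_mul_frameMatrix {n : ℕ} (e e' : Fin n → Cn n) (i j : Fin n) :
    (((frameMatrix e)ᴴ * frameMatrix e') i j).re = inner ℝ (e i) (e' j) := by
  rw [Matrix.mul_apply, Complex.re_sum, PiLp.inner_apply]
  refine Finset.sum_congr rfl fun k _ => ?_
  simp [frameMatrix, Complex.inner, Matrix.conjTranspose_apply]
  ring

theorem orthonormal_of_unitary {n : ℕ} {e : Fin n → Cn n}
    (h : frameMatrix e ∈ unitaryGroup (Fin n) ℂ) : Orthonormal ℝ e := by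
  rw [orthonormal_iff_ite]
  intro i j
  rw [← re_conjTranspose_mul_frameMatrix, ← star_eq_conjTranspose, mem_unitaryGroup_iff'.1 h,
    Matrix.one_apply]
  split_ifs <;> simp

/-- The orthonormal frame of the columns of a unitary matrix. -/
def unitaryFrame {n : ℕ} (M : Matrix (Fin n) (Fin n) ℂ) (hM : M ∈ unitaryGroup (Fin n) ℂ) :
    Frame n :=
  ⟨fun j => WithLp.toLp 2 fun i => M i j, orthonormal_of_unitary (show frameMatrix _ ∈ _ from hM)⟩

@[simp] theorem frameMatrix_unitaryFrame {n : ℕ} (M : Matrix (Fin n) (Fin n) ℂ)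
    (hM : M ∈ unitaryGroup (Fin n) ℂ) : frameMatrix (unitaryFrame M hM).1 = M := rfl

open scoped ComplexOrder in
/-- A matrix with unit columns and determinant of modulus at least one is unitary. -/
theorem mem_unitaryGroup_of_one_le_norm_det {n : ℕ} {M : Matrix (Fin n) (Fin n) ℂ}
    (hd : ∀ i, (Mᴴ * M) i i = 1) (hdet : 1 ≤ ‖M.det‖) : M ∈ unitaryGroup (Fin n) ℂ := by
  have hpos : (Mᴴ * M).PosSemidef := posSemidef_conjTranspose_mul_self M
  set H := Mᴴ * M with hH
  have hher := hpos.isHermitian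
  set l := hher.eigenvalues with hl
  have htr : ∑ i, l i = n := by
    have h1 := hher.trace_eq_sum_eigenvalues
    have h2 : H.trace = n := by simp [Matrix.trace, hd]
    rw [h2] at h1
    simp only [RCLike.ofReal_eq_complex_ofReal] at h1
    exact_mod_cast h1.symm
  have hprod : 1 ≤ ∏ i, l i := by
    have h1 := hher.det_eq_prod_eigenvalues
    have h2 : H.det = ((‖M.det‖ ^ 2 : ℝ) : ℂ) := by
      rw [hH, det_mul, det_conjTranspose, Complex.ofReal_pow, ← Complex.conj_mul']
      rfl
    rw [h2] at h1
    simp only [RCLike.ofReal_eq_complex_ofReal] at h1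
    have h3 : ‖M.det‖ ^ 2 = ∏ i, l i := by exact_mod_cast h1
    rw [← h3]
    nlinarith
  have hl0 : ∀ i, 0 ≤ l i := hpos.eigenvalues_nonneg
  have hlpos : ∀ i, 0 < l i := fun i => (hl0 i).lt_of_ne fun h => by
    rw [Finset.prod_eq_zero (Finset.mem_univ i) h.symm] at hprod
    linarith
  have hlog : 0 ≤ ∑ i, Real.log (l i) := by
    rw [← Real.log_prod fun i _ => (hlpos i).ne']
    exact Real.log_nonneg hprod
  -- Equality in the arithmetic-geometric mean inequality: every term is nonnegative, while the sum
  -- is `n - n - log ∏ l i ≤ 0`. So all eigenvalues are `1`.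
  have hz : ∑ i, (l i - 1 - Real.log (l i)) = 0 := by
    apply le_antisymm
    · simp only [Finset.sum_sub_distrib, htr]
      simpa using hlog
    · exact Finset.sum_nonneg fun i _ => by linarith [Real.log_le_sub_one_of_pos (hlpos i)]
  have hone : ∀ i, l i = 1 := fun i => by
    have := (Finset.sum_eq_zero_iff_of_nonneg fun i _ => by
      linarith [Real.log_le_sub_one_of_pos (hlpos i)]).1 hz i (Finset.mem_univ i)
    by_contra hne
    linarith [Real.log_lt_sub_one_of_pos (hlpos i) hne]
  rw [mem_unitaryGroup_iff', star_eq_conjTranspose, ← hH, hher.spectral_theorem]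
  have : (RCLike.ofReal ∘ hher.eigenvalues : Fin n → ℂ) = fun _ => 1 := by
    funext i
    simp [← hl, hone]
  rw [this, Matrix.diagonal_one, map_one]

theorem norm_det_of_mem_unitaryGroup {n : ℕ} {M : Matrix (Fin n) (Fin n) ℂ}
    (hM : M ∈ unitaryGroup (Fin n) ℂ) : ‖M.det‖ = 1 :=
  CStarRing.norm_of_mem_unitary (det_of_mem_unitary hM)

/-- Real orthonormality controls only the real parts of `Eᴴ E`, but its diagonal is automatically
real. The calibration gives `|det E| ≥ 1`, the extreme case of Hadamard's inequality, so `E` is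
unitary; a number of modulus `1` and real part `1` is `1`. -/
theorem mem_specialUnitaryGroup_of_re_Omega {n : ℕ} {e : Fin n → Cn n} (he : Orthonormal ℝ e)
    (h : (Omega e).re = 1) : frameMatrix e ∈ specialUnitaryGroup (Fin n) ℂ := by
  have hO : (frameMatrix e).det = Omega e := rfl
  have hU : frameMatrix e ∈ unitaryGroup (Fin n) ℂ := by
    apply mem_unitaryGroup_of_one_le_norm_det
    · intro i
      apply Complex.ext
      · rw [re_conjTranspose_mul_frameMatrix, orthonormal_iff_ite.1 he]
        simp
      · rw [Matrix.mul_apply, Complex.im_sum]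
        simp [Matrix.conjTranspose_apply, mul_comm]
    · rw [hO, ← h]
      exact Complex.re_le_norm _
  refine mem_specialUnitaryGroup_iff.2 ⟨hU, ?_⟩
  have h1 : ‖(frameMatrix e).det‖ = 1 := by
    exact norm_det_of_mem_unitaryGroup hU
  rw [hO] at h1 ⊢
  have h2 := Complex.sq_norm (Omega e)
  rw [h1, Complex.normSq_apply, h] at h2
  apply Complex.ext
  · simpa using h
  · have : (Omega e).im * (Omega e).im = 0 := by linarith
    simpa using this

/-- A unitary matrix `U` with `U Uᵀ = 1` is real. -/
theorem exists_orthogonal_of_mul_transpose {n : ℕ} {U : Matrix (Fin n) (Fin n) ℂ}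
    (hU : U ∈ unitaryGroup (Fin n) ℂ) (h : U * Uᵀ = 1) :
    ∃ g ∈ orthogonalGroup (Fin n) ℝ, U = complexify g := by
  have h1 : Uᴴ = Uᵀ := by
    calc Uᴴ = Uᴴ * (U * Uᵀ) := by rw [h, mul_one]
      _ = (star U * U) * Uᵀ := by rw [star_eq_conjTranspose, mul_assoc]
      _ = Uᵀ := by rw [mem_unitaryGroup_iff'.1 hU, one_mul]
  have h2 : U = complexify (U.map Complex.re) := by
    ext i j
    have := congrFun (congrFun h1 j) i
    simp only [conjTranspose_apply, transpose_apply] at this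
    simpa using (Complex.conj_eq_iff_re.1 this).symm
  refine ⟨U.map Complex.re, ?_, h2⟩
  rw [mem_orthogonalGroup_iff]
  apply complexify_injective
  rw [complexify_mul, complexify_transpose, ← h2, h, complexify_one]

/-- The change of basis `U = E⁻¹ E'` satisfies `U Uᵀ = 1`, hence is real. Thus `E Eᵀ` is a complete
invariant of the class of `E` in `U(n)/O(n)`, that is, of the unoriented Lagrangian plane. -/
theorem exists_orthogonal_of_mul_transpose_eq {n : ℕ} {E E' : Matrix (Fin n) (Fin n) ℂ}
    (hE : E ∈ unitaryGroup (Fin n) ℂ) (hE' : E' ∈ unitaryGroup (Fin n) ℂ)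
    (h : E' * E'ᵀ = E * Eᵀ) :
    ∃ g ∈ orthogonalGroup (Fin n) ℝ, E' = E * complexify g := by
  have hU : star E * E' ∈ unitaryGroup (Fin n) ℂ := mul_mem (Unitary.star_mem hE) hE'
  have h1 : star E * E' * (star E * E')ᵀ = 1 := by
    have h3 : Eᵀ * (star E)ᵀ = 1 := by
      rw [← transpose_mul, mem_unitaryGroup_iff'.1 hE, transpose_one]
    calc star E * E' * (star E * E')ᵀ = star E * (E' * E'ᵀ) * (star E)ᵀ := by
          rw [transpose_mul]; simp only [mul_assoc]
      _ = (star E * E) * (Eᵀ * (star E)ᵀ) := by rw [h]; simp only [mul_assoc]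
      _ = 1 := by rw [h3, mem_unitaryGroup_iff'.1 hE, mul_one]
  obtain ⟨g, hg, hgU⟩ := exists_orthogonal_of_mul_transpose hU h1
  refine ⟨g, hg, ?_⟩
  rw [← hgU, ← mul_assoc, mem_unitaryGroup_iff.1 hE, one_mul]

theorem frame_equiv_of_mul_transpose_eq {n : ℕ} {e e' : Frame n}
    (he : frameMatrix e.1 ∈ unitaryGroup (Fin n) ℂ)
    (he' : frameMatrix e'.1 ∈ unitaryGroup (Fin n) ℂ)
    (h : frameMatrix e'.1 * (frameMatrix e'.1)ᵀ = frameMatrix e.1 * (frameMatrix e.1)ᵀ)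
    (hdet : (frameMatrix e'.1).det = (frameMatrix e.1).det) : e ≈ e' := by
  obtain ⟨g, hg, hgE⟩ := exists_orthogonal_of_mul_transpose_eq he he' h
  refine ⟨g, mem_specialOrthogonalGroup_iff.2 ⟨hg, ?_⟩, ?_⟩
  · have h1 := congrArg det hgE
    rw [det_mul, hdet, det_complexify] at h1
    have h0 : (frameMatrix e.1).det ≠ 0 := by
      intro h0
      have := norm_det_of_mem_unitaryGroup he
      rw [h0, norm_zero] at this
      exact zero_ne_one this
    have : (g.det : ℂ) = 1 := mul_left_cancel₀ h0 (by rw [← h1, mul_one])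
    exact_mod_cast this
  · apply frameMatrix_injective
    rw [hgE, frameMatrix_mulFrame]

/-- The symmetric matrix `E Eᵀ`, where the columns of `E` are an oriented orthonormal basis of
the plane. -/
def OrientedPlane.symMatrix {n : ℕ} (η : OrientedPlane n) : Matrix (Fin n) (Fin n) ℂ :=
  Quotient.lift (fun e : Frame n => frameMatrix e.1 * (frameMatrix e.1)ᵀ)
    (by
      rintro e e' ⟨g, hg, h⟩
      have hg' := (mem_orthogonalGroup_iff _ _).1 (mem_specialOrthogonalGroup_iff.1 hg).1
      change frameMatrix e.1 * (frameMatrix e.1)ᵀ = frameMatrix e'.1 * (frameMatrix e'.1)ᵀ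
      rw [h, frameMatrix_mulFrame, transpose_mul, mul_assoc, ← mul_assoc (complexify g),
        ← complexify_transpose, ← complexify_mul, hg', complexify_one, one_mul]) η

theorem OrientedPlane.symMatrix_mk {n : ℕ} (e : Frame n) :
    OrientedPlane.symMatrix ⟦e⟧ = frameMatrix e.1 * (frameMatrix e.1)ᵀ := rfl

theorem continuous_frameMatrix {n : ℕ} : Continuous fun e : Frame n => frameMatrix e.1 := by
  refine continuous_matrix fun i j => ?_
  exact (EuclideanSpace.proj (𝕜 := ℂ) i).continuous.comp
    ((continuous_apply j).comp continuous_subtype_val)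

theorem OrientedPlane.continuous_symMatrix {n : ℕ} :
    Continuous (OrientedPlane.symMatrix : OrientedPlane n → _) :=
by
  have h : Continuous fun e : Frame n => frameMatrix e.1 * (frameMatrix e.1)ᵀ := by
    have h1 := continuous_frameMatrix (n := n)
    fun_prop
  refine (isQuotientMap_quotient_mk' (s := frameSetoid n)).continuous_iff.2 ?_
  exact h

theorem SLagPlane.exists_frame {n : ℕ} (η : SLagPlane n) :
    ∃ e : Frame n, η.1 = ⟦e⟧ ∧ frameMatrix e.1 ∈ specialUnitaryGroup (Fin n) ℂ := by
  obtain ⟨η, hη⟩ := η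
  induction η using Quotient.inductionOn with
  | h e => exact ⟨e, rfl, mem_specialUnitaryGroup_of_re_Omega e.2 hη⟩

/-- The symmetric matrix loses the orientation, but both determinants are `1`, so the change of
basis lies in `SO(n)`. -/
theorem SLagPlane.eq_mk_of_symMatrix {n : ℕ} (η : SLagPlane n) {u : Frame n}
    (hu : frameMatrix u.1 ∈ specialUnitaryGroup (Fin n) ℂ)
    (h : η.1.symMatrix = frameMatrix u.1 * (frameMatrix u.1)ᵀ) : η.1 = ⟦u⟧ := by
  obtain ⟨e, he, heU⟩ := η.exists_frame
  rw [he, OrientedPlane.symMatrix_mk] at h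
  rw [he]
  rw [mem_specialUnitaryGroup_iff] at heU hu
  exact Quotient.sound (frame_equiv_of_mul_transpose_eq heU.1 hu.1 h.symm (by rw [heU.2, hu.2]))

end

/-! ### Diagonalizing symmetric unitary matrices by real orthogonal ones -/

section

open Matrix

/-- Each eigenspace of `A` is preserved by the commuting `B`; orthonormal eigenbases of the
restrictions of `B` are collected over the eigenvalues of `A`. -/
theorem exists_orthonormalBasis_common_eigenvectors {E : Type*} [NormedAddCommGroup E]
    [InnerProductSpace ℝ E] [FiniteDimensional ℝ E] {n : ℕ} (hn : Module.finrank ℝ E = n)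
    {A B : E →ₗ[ℝ] E} (hA : A.IsSymmetric) (hB : B.IsSymmetric) (hAB : Commute A B) :
    ∃ b : OrthonormalBasis (Fin n) ℝ E,
      ∀ i, ∃ α β : ℝ, A (b i) = α • b i ∧ B (b i) = β • b i := by
  classical
  have hmaps : ∀ μ : Module.End.Eigenvalues A,
      ∀ v ∈ Module.End.eigenspace A μ, B v ∈ Module.End.eigenspace A μ :=
    fun μ => Module.End.mapsTo_genEigenspace_of_comm hAB μ 1
  let v := fun μ : Module.End.Eigenvalues A =>
    (hB.restrict_invariant (hmaps μ)).eigenvectorBasis rfl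
  let c := hA.direct_sum_isInternal.collectedOrthonormalBasis
    hA.orthogonalFamily_eigenspaces' v
  have hc : ∀ a, ∃ α β : ℝ, A (c a) = α • c a ∧ B (c a) = β • c a := by
    rintro ⟨μ, j⟩
    have hca : c ⟨μ, j⟩ = (v μ j : E) := by
      simp [c, DirectSum.IsInternal.collectedOrthonormalBasis]
    refine ⟨μ, (hB.restrict_invariant (hmaps μ)).eigenvalues rfl j, ?_, ?_⟩
    · rw [hca]
      exact Module.End.mem_eigenspace_iff.1 (v μ j).2
    · rw [hca]
      have := (hB.restrict_invariant (hmaps μ)).apply_eigenvectorBasis rfl j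
      exact congrArg Subtype.val this
  have hcard : Fintype.card (Σ μ : Module.End.Eigenvalues A,
      Fin (Module.finrank ℝ (Module.End.eigenspace A μ))) = n := by
    rw [← hn, Module.finrank_eq_card_basis c.toBasis]
  refine ⟨c.reindex (Fintype.equivFinOfCardEq hcard), fun i => ?_⟩
  rw [OrthonormalBasis.reindex_apply]
  exact hc _

theorem exists_orthogonal_common_diagonalization {n : ℕ} {A B : Matrix (Fin n) (Fin n) ℝ}
    (hA : Aᵀ = A) (hB : Bᵀ = B) (hAB : A * B = B * A) :
    ∃ O ∈ orthogonalGroup (Fin n) ℝ, ∃ α β : Fin n → ℝ,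
      A = O * diagonal α * Oᵀ ∧ B = O * diagonal β * Oᵀ := by
  have hsym : ∀ {C : Matrix (Fin n) (Fin n) ℝ}, Cᵀ = C → (toEuclideanLin C).IsSymmetric := by
    intro C hC
    rw [isSymmetric_toEuclideanLin_iff, IsHermitian, conjTranspose_eq_transpose_of_trivial, hC]
  have hcomm : Commute (toEuclideanLin A) (toEuclideanLin B) := by
    apply LinearMap.ext
    intro x
    simp only [Module.End.mul_apply, toLpLin_apply]
    congr 1
    simp [mulVec_mulVec, hAB]
  obtain ⟨b, hb⟩ := exists_orthonormalBasis_common_eigenvectors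
    (finrank_euclideanSpace_fin (𝕜 := ℝ) (n := n)) (hsym hA) (hsym hB) hcomm
  choose α β hα hβ using hb
  let O : Matrix (Fin n) (Fin n) ℝ := Matrix.of fun i j => b j i
  have hO : Oᵀ * O = 1 := by
    ext i j
    have := orthonormal_iff_ite.1 b.orthonormal i j
    rw [PiLp.inner_apply] at this
    simp only [mul_apply, transpose_apply, one_apply, O, of_apply]
    rw [← this]
    refine Finset.sum_congr rfl fun k _ => ?_
    simp [mul_comm]
  have hO' : O * Oᵀ = 1 := mul_eq_one_comm.1 hO
  have key : ∀ (C : Matrix (Fin n) (Fin n) ℝ) (γ : Fin n → ℝ),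
      (∀ i, toEuclideanLin C (b i) = γ i • b i) → C = O * diagonal γ * Oᵀ := by
    intro C γ h
    have h1 : C * O = O * diagonal γ := by
      ext i j
      have := congrArg (fun w : EuclideanSpace ℝ (Fin n) => w i) (h j)
      simp only [toLpLin_apply, mulVec, dotProduct, PiLp.smul_apply, smul_eq_mul] at this
      rw [mul_diagonal, mul_apply]
      simp only [O, of_apply]
      rw [this, mul_comm]
    rw [← h1, mul_assoc, hO', mul_one]
  exact ⟨O, (mem_orthogonalGroup_iff _ _).2 hO', α, β, key A α hα, key B β hβ⟩

/-- A symmetric unitary matrix is diagonalized by a real orthogonal one. -/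
theorem exists_orthogonal_diagonalization_of_symm_unitary {n : ℕ}
    {S : Matrix (Fin n) (Fin n) ℂ} (hS : S ∈ unitaryGroup (Fin n) ℂ) (hsym : Sᵀ = S) :
    ∃ O ∈ orthogonalGroup (Fin n) ℝ, ∃ γ : Fin n → ℂ,
      (∀ i, ‖γ i‖ = 1) ∧ S = complexify O * diagonal γ * (complexify O)ᵀ := by
  set A := S.map Complex.re with hA
  set B := S.map Complex.im with hB
  have hAB : S = complexify A + Complex.I • complexify B := by
    ext i j
    simpa [A, B, mul_comm] using (Complex.re_add_im (S i j)).symm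
  have hAt : Aᵀ = A := by rw [hA, ← transpose_map, hsym]
  have hBt : Bᵀ = B := by rw [hB, ← transpose_map, hsym]
  have hSs : star S = complexify A - Complex.I • complexify B := by
    ext i j
    have : S j i = S i j := congrFun (congrFun hsym i) j
    simp only [star_apply, this]
    apply Complex.ext <;> simp [A, B]
  -- By symmetry `star S = A - iB`, so the imaginary part of `S * star S = 1` reads `B A - A B = 0`.
  have hcomm : A * B = B * A := by
    have h1 := mem_unitaryGroup_iff.1 hS
    rw [hSs] at h1
    conv_lhs at h1 => rw [hAB]
    apply Matrix.ext
    intro i j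
    have h2 := congrArg Complex.im (congrFun (congrFun h1 i) j)
    have h3 : ((complexify A + Complex.I • complexify B)
        * (complexify A - Complex.I • complexify B))
        = complexify (A * A + B * B) + Complex.I • complexify (B * A - A * B) := by
      have e1 : complexify (A * A + B * B) = complexify A * complexify A
          + complexify B * complexify B := by
        rw [← complexify_mul, ← complexify_mul]
        exact Matrix.map_add _ (map_add _) _ _
      have e2 : complexify (B * A - A * B) = complexify B * complexify A
          - complexify A * complexify B := by
        rw [← complexify_mul, ← complexify_mul]
        exact Matrix.map_sub _ (map_sub _) _ _
      rw [e1, e2]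
      have hI : ∀ X : Matrix (Fin n) (Fin n) ℂ, Complex.I • Complex.I • X = -X := fun X => by
        rw [smul_smul, Complex.I_mul_I, neg_smul, one_smul]
      simp only [add_mul, mul_sub, smul_mul_assoc, mul_smul_comm, smul_sub, smul_add, hI]
      abel
    rw [h3] at h2
    have h4 : ((1 : Matrix (Fin n) (Fin n) ℂ) i j).im = 0 := by
      rw [one_apply]; split_ifs <;> simp
    rw [h4] at h2
    simp [complexify] at h2
    linarith
  obtain ⟨O, hO, α, β, hα, hβ⟩ := exists_orthogonal_common_diagonalization hAt hBt hcomm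
  have hdiag : S = complexify O * diagonal (fun i => (α i : ℂ) + Complex.I * β i)
      * (complexify O)ᵀ := by
    have e : diagonal (fun i => (α i : ℂ) + Complex.I * β i)
        = complexify (diagonal α) + Complex.I • complexify (diagonal β) := by
      ext i j
      by_cases h : i = j
      · subst h; simp [complexify]
      · simp [complexify, h]
    rw [e, mul_add, add_mul, mul_smul_comm, smul_mul_assoc, ← complexify_transpose,
      ← complexify_mul, ← complexify_mul, ← complexify_mul, ← complexify_mul, ← hα, ← hβ, ← hAB]
  refine ⟨O, hO, _, fun i => ?_, hdiag⟩
  have hOU : complexify O ∈ unitaryGroup (Fin n) ℂ := by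
    rw [mem_unitaryGroup_iff, star_eq_conjTranspose, complexify_conjTranspose, ← complexify_mul,
      (mem_orthogonalGroup_iff _ _).1 hO, complexify_one]
  have hOT : (complexify O)ᵀ = star (complexify O) := by
    rw [star_eq_conjTranspose, complexify_conjTranspose, complexify_transpose]
  have hD : diagonal (fun i => (α i : ℂ) + Complex.I * β i) ∈ unitaryGroup (Fin n) ℂ := by
    have : diagonal (fun i => (α i : ℂ) + Complex.I * β i)
        = star (complexify O) * S * complexify O := by
      rw [hdiag, hOT]
      calc _ = 1 * diagonal (fun i => (α i : ℂ) + Complex.I * β i) * 1 := by simp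
        _ = _ := by
          rw [← mem_unitaryGroup_iff'.1 hOU]
          simp only [mul_assoc]
    rw [this]
    exact mul_mem (mul_mem (Unitary.star_mem hOU) hS) hOU
  have h1 := congrFun (congrFun (mem_unitaryGroup_iff.1 hD) i) i
  rw [star_eq_conjTranspose, diagonal_conjTranspose, diagonal_mul_diagonal, diagonal_apply_eq,
    one_apply_eq] at h1
  have h2 : ((‖(α i : ℂ) + Complex.I * β i‖ ^ 2 : ℝ) : ℂ) = 1 := by
    rw [Complex.ofReal_pow, ← Complex.mul_conj']
    exact h1
  have h3 : ‖(α i : ℂ) + Complex.I * β i‖ ^ 2 = 1 := by exact_mod_cast h2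
  exact (pow_eq_one_iff_of_nonneg (norm_nonneg _) two_ne_zero).1 h3

end

/-! ### The normal form of a pair of special Lagrangian planes -/

section

open Matrix

/-- The unitary matrix `diag (exp (-i φ k))`. -/
def phaseMatrix {n : ℕ} (φ : Fin n → ℝ) : Matrix (Fin n) (Fin n) ℂ :=
  diagonal fun k => Complex.exp (-(φ k : ℂ) * Complex.I)

theorem phaseMatrix_mem_unitaryGroup {n : ℕ} (φ : Fin n → ℝ) :
    phaseMatrix φ ∈ unitaryGroup (Fin n) ℂ := by
  rw [mem_unitaryGroup_iff, star_eq_conjTranspose, phaseMatrix, diagonal_conjTranspose,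
    diagonal_mul_diagonal, ← diagonal_one]
  congr 1
  funext k
  simp only [Pi.star_apply, RCLike.star_def, ← Complex.exp_conj, map_mul, map_neg,
    Complex.conj_ofReal, Complex.conj_I, ← Complex.exp_add]
  simp

theorem det_phaseMatrix {n : ℕ} (φ : Fin n → ℝ) :
    (phaseMatrix φ).det = Complex.exp (-((∑ k, φ k : ℝ) : ℂ) * Complex.I) := by
  rw [phaseMatrix, det_diagonal, ← Complex.exp_sum]
  congr 1
  rw [← Finset.sum_mul]
  push_cast
  rw [Finset.sum_neg_distrib]

theorem phaseMatrix_transpose {n : ℕ} (φ : Fin n → ℝ) : (phaseMatrix φ)ᵀ = phaseMatrix φ :=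
  diagonal_transpose _

theorem phaseMatrix_add {n : ℕ} (φ ψ : Fin n → ℝ) :
    phaseMatrix φ * phaseMatrix ψ = phaseMatrix (φ + ψ) := by
  rw [phaseMatrix, phaseMatrix, diagonal_mul_diagonal, phaseMatrix]
  congr 1
  funext k
  rw [← Complex.exp_add]
  congr 1
  simp
  ring

theorem mul_phaseMatrix_mul_transpose {n : ℕ} (u : Matrix (Fin n) (Fin n) ℂ) (φ : Fin n → ℝ) :
    (u * phaseMatrix φ) * (u * phaseMatrix φ)ᵀ = u * phaseMatrix (φ + φ) * uᵀ := by
  rw [transpose_mul, phaseMatrix_transpose, ← phaseMatrix_add]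
  simp only [mul_assoc]

/-- A simultaneous normal form of two special Lagrangian planes: up to orientation, `η` is spanned
by the columns of the special unitary matrix `u`, and `ξ` by their multiples
by `exp (-i φ k)`. -/
structure NormalForm {n : ℕ} (η ξ : SLagPlane n) (u : Matrix (Fin n) (Fin n) ℂ)
    (φ : Fin n → ℝ) : Prop where
  mem : u ∈ specialUnitaryGroup (Fin n) ℂ
  left : η.1.symMatrix = u * uᵀ
  right : ξ.1.symMatrix = (u * phaseMatrix φ) * (u * phaseMatrix φ)ᵀ

theorem SLagPlane.det_symMatrix {n : ℕ} (η : SLagPlane n) : η.1.symMatrix.det = 1 := by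
  obtain ⟨e, he, heU⟩ := η.exists_frame
  rw [he, OrientedPlane.symMatrix_mk, det_mul, det_transpose,
    (mem_specialUnitaryGroup_iff.1 heU).2, one_mul]

theorem diagonal_sign_mem_unitaryGroup {n : ℕ} {s : Fin n → ℂ} (hs : ∀ i, s i = 1 ∨ s i = -1) :
    diagonal s ∈ unitaryGroup (Fin n) ℂ := by
  rw [mem_unitaryGroup_iff, star_eq_conjTranspose, diagonal_conjTranspose,
    diagonal_mul_diagonal, ← diagonal_one]
  congr 1
  funext i
  rcases hs i with h | h <;> simp [h]

/-- The square of `det u` is the determinant of the symmetric matrix of `η`, which is `1`. If `det u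
= -1`, reversing the first column repairs it: a diagonal sign matrix commutes with the phases and
squares to `1`, so both symmetric matrices are unchanged. -/
theorem exists_normalForm_of_unitary {n : ℕ} (hn : 1 ≤ n) {η ξ : SLagPlane n}
    {u : Matrix (Fin n) (Fin n) ℂ} {φ : Fin n → ℝ} (hu : u ∈ unitaryGroup (Fin n) ℂ)
    (hl : η.1.symMatrix = u * uᵀ)
    (hr : ξ.1.symMatrix = (u * phaseMatrix φ) * (u * phaseMatrix φ)ᵀ) :
    ∃ u', NormalForm η ξ u' φ := by
  have hdet : u.det * u.det = 1 := by
    have := η.det_symMatrix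
    rwa [hl, det_mul, det_transpose] at this
  have hdet' : u.det = 1 ∨ u.det = -1 := mul_self_eq_one_iff.1 hdet
  let i₀ : Fin n := ⟨0, hn⟩
  let s : Fin n → ℂ := Function.update 1 i₀ u.det
  have hs : ∀ i, s i = 1 ∨ s i = -1 := by
    intro i
    by_cases h : i = i₀
    · subst h; simpa [s] using hdet'
    · left; simp [s, h]
  have hss : diagonal s * diagonal s = 1 := by
    rw [diagonal_mul_diagonal, ← diagonal_one]
    congr 1
    funext i
    rcases hs i with h | h <;> simp [h]
  refine ⟨u * diagonal s, ?_, ?_, ?_⟩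
  · refine mem_specialUnitaryGroup_iff.2 ⟨mul_mem hu (diagonal_sign_mem_unitaryGroup hs), ?_⟩
    rw [det_mul, det_diagonal, Finset.prod_update_of_mem (Finset.mem_univ _)]
    simpa using hdet
  · rw [hl, transpose_mul, diagonal_transpose, mul_assoc, ← mul_assoc (diagonal s), hss, one_mul]
  · rw [hr, mul_phaseMatrix_mul_transpose, mul_phaseMatrix_mul_transpose, transpose_mul,
      diagonal_transpose]
    have : diagonal s * phaseMatrix (φ + φ) = phaseMatrix (φ + φ) * diagonal s := by
      rw [phaseMatrix, diagonal_mul_diagonal, diagonal_mul_diagonal]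
      simp only [mul_comm]
    calc u * phaseMatrix (φ + φ) * uᵀ
        = u * (phaseMatrix (φ + φ) * (diagonal s * diagonal s)) * uᵀ := by rw [hss, mul_one]
      _ = u * ((phaseMatrix (φ + φ) * diagonal s) * diagonal s) * uᵀ := by rw [mul_assoc (phaseMatrix _)]
      _ = _ := by rw [← this]; simp only [mul_assoc]

theorem exists_phase_of_norm_one {z : ℂ} (hz : ‖z‖ = 1) :
    ∃ φ : ℝ, 0 ≤ φ ∧ φ < Real.pi ∧ Complex.exp (-((φ + φ : ℝ) : ℂ) * Complex.I) = z := by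
  have h := Complex.norm_mul_exp_arg_mul_I z
  rw [hz, Complex.ofReal_one, one_mul] at h
  have h1 := Complex.neg_pi_lt_arg z
  have h2 := Complex.arg_le_pi z
  have hpi := Real.pi_pos
  rcases le_or_gt z.arg 0 with h0 | h0
  · refine ⟨-z.arg / 2, by linarith, by linarith, ?_⟩
    conv_rhs => rw [← h]
    congr 1
    push_cast
    ring
  · refine ⟨Real.pi - z.arg / 2, by linarith, by linarith, ?_⟩
    conv_rhs => rw [← h]
    rw [← Complex.exp_periodic]
    congr 1
    push_cast
    ring

/-- With `U = E⁻¹ E'`, write the symmetric unitary matrix `U Uᵀ` as `O exp(-2iφ) Oᵀ`. Since `O` is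
real orthogonal, `E O` is another basis of `η`, and multiplying its columns by `exp(-iφ)` gives a
basis of the subspace of `ξ`. -/
theorem exists_normalForm {n : ℕ} (hn : 1 ≤ n) (η ξ : SLagPlane n) :
    ∃ u φ, NormalForm η ξ u φ ∧ ∀ k, 0 ≤ φ k ∧ φ k < Real.pi := by
  obtain ⟨e, he, heU⟩ := η.exists_frame
  obtain ⟨e', he', heU'⟩ := ξ.exists_frame
  set E := frameMatrix e.1
  set E' := frameMatrix e'.1
  have hE := (mem_specialUnitaryGroup_iff.1 heU).1
  have hE' := (mem_specialUnitaryGroup_iff.1 heU').1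
  set U := star E * E' with hUdef
  have hU : U ∈ unitaryGroup (Fin n) ℂ := mul_mem (Unitary.star_mem hE) hE'
  have hUT : Uᵀ ∈ unitaryGroup (Fin n) ℂ := by
    have hs : star Uᵀ = (star U)ᵀ := rfl
    rw [mem_unitaryGroup_iff, hs, ← transpose_mul, mem_unitaryGroup_iff'.1 hU, transpose_one]
  obtain ⟨O, hO, γ, hγ, hS⟩ := exists_orthogonal_diagonalization_of_symm_unitary
    (mul_mem hU hUT) (by rw [transpose_mul, transpose_transpose])
  choose φ hφ0 hφπ hφ using fun i => exists_phase_of_norm_one (hγ i)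
  have hO1 := (mem_orthogonalGroup_iff _ _).1 hO
  have hγφ : diagonal γ = phaseMatrix (φ + φ) := by
    rw [phaseMatrix]
    congr 1
    funext i
    exact (hφ i).symm
  have hOU : complexify O ∈ unitaryGroup (Fin n) ℂ := by
    rw [mem_unitaryGroup_iff, star_eq_conjTranspose, complexify_conjTranspose, ← complexify_mul,
      hO1, complexify_one]
  obtain ⟨u', hu'⟩ := exists_normalForm_of_unitary hn (η := η) (ξ := ξ) (φ := φ)
    (u := E * complexify O) (mul_mem hE hOU)
    (by
      rw [he, OrientedPlane.symMatrix_mk, transpose_mul, ← complexify_transpose, mul_assoc,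
        ← mul_assoc (complexify O), ← complexify_mul, hO1, complexify_one, one_mul])
    (by
      rw [mul_phaseMatrix_mul_transpose, ← hγφ, he', OrientedPlane.symMatrix_mk, transpose_mul]
      calc E' * E'ᵀ = (E * star E) * E' * (E'ᵀ * (E * star E)ᵀ) := by
            rw [mem_unitaryGroup_iff.1 hE, transpose_one, one_mul, mul_one]
        _ = E * (U * Uᵀ) * Eᵀ := by
            rw [hUdef, transpose_mul, transpose_mul]; simp only [mul_assoc]
        _ = _ := by rw [hS]; simp only [mul_assoc])
  exact ⟨u', φ, hu', fun k => ⟨hφ0 k, hφπ k⟩⟩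

/-- The symmetric matrix of `ξ` has determinant `1`, and in normal form this determinant is `exp(-2i
∑ φ)`. -/
theorem NormalForm.exists_sum_eq {n : ℕ} {η ξ : SLagPlane n} {u : Matrix (Fin n) (Fin n) ℂ}
    {φ : Fin n → ℝ} (h : NormalForm η ξ u φ) : ∃ m : ℤ, ∑ k, φ k = m * Real.pi := by
  have h1 := ξ.det_symMatrix
  rw [h.right, det_mul, det_transpose, det_mul, (mem_specialUnitaryGroup_iff.1 h.mem).2, one_mul,
    det_phaseMatrix, ← Complex.exp_add, Complex.exp_eq_one_iff] at h1
  obtain ⟨m, hm⟩ := h1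
  refine ⟨-m, ?_⟩
  have h2 : ((∑ k, φ k : ℝ) : ℂ) * (-2 * Complex.I) = ((-m * Real.pi : ℝ) : ℂ) * (-2 * Complex.I) := by
    push_cast at hm ⊢
    linear_combination hm
  have h3 := mul_right_cancel₀ (by simp) h2
  push_cast
  exact_mod_cast h3

theorem NormalForm.perm {n : ℕ} (hn : 1 ≤ n) {η ξ : SLagPlane n} {u : Matrix (Fin n) (Fin n) ℂ}
    {φ : Fin n → ℝ} (h : NormalForm η ξ u φ) (σ : Equiv.Perm (Fin n)) :
    ∃ u', NormalForm η ξ u' (φ ∘ σ) := by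
  have key : ∀ M : Matrix (Fin n) (Fin n) ℂ,
      M.submatrix id σ * (M.submatrix id σ)ᵀ = M * Mᵀ := fun M => by
    rw [transpose_submatrix, submatrix_mul_equiv, submatrix_id_id]
  have hu := (mem_specialUnitaryGroup_iff.1 h.mem).1
  refine exists_normalForm_of_unitary hn (u := u.submatrix id σ) ?_ ?_ ?_
  · rw [mem_unitaryGroup_iff, star_eq_conjTranspose, conjTranspose_submatrix, submatrix_mul_equiv,
      submatrix_id_id, ← star_eq_conjTranspose, mem_unitaryGroup_iff.1 hu]
  · rw [key, h.left]
  · have : u.submatrix id σ * phaseMatrix (φ ∘ σ) = (u * phaseMatrix φ).submatrix id σ := by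
      ext i j
      simp [phaseMatrix]
    rw [this, key, h.right]

/-- Only `exp(-2iφ_k)` enters the symmetric matrix, so the phases matter modulo `π`. -/
theorem NormalForm.congr_phase {n : ℕ} {η ξ : SLagPlane n} {u : Matrix (Fin n) (Fin n) ℂ}
    {φ φ' : Fin n → ℝ} (h : NormalForm η ξ u φ)
    (hφ : ∀ k, φ' k = φ k ∨ φ' k = φ k + Real.pi) : NormalForm η ξ u φ' := by
  refine ⟨h.mem, h.left, ?_⟩
  rw [h.right, mul_phaseMatrix_mul_transpose, mul_phaseMatrix_mul_transpose]
  congr 2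
  rw [phaseMatrix, phaseMatrix]
  congr 1
  funext k
  rcases hφ k with h | h
  · simp [h]
  · rw [← Complex.exp_periodic.sub_eq]
    congr 1
    simp [h]
    ring

/-- Starting from the basis `exp(-iφ_k) u_k` of `ξ`, a further rotation by `π - φ_k` leads to
`-u_k`, a basis of `η`. -/
theorem NormalForm.swap {n : ℕ} (hn : 1 ≤ n) {η ξ : SLagPlane n} {u : Matrix (Fin n) (Fin n) ℂ}
    {φ : Fin n → ℝ} (h : NormalForm η ξ u φ) :
    ∃ u', NormalForm ξ η u' (fun k => Real.pi - φ k) := by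
  have hu := (mem_specialUnitaryGroup_iff.1 h.mem).1
  refine exists_normalForm_of_unitary hn (mul_mem hu (phaseMatrix_mem_unitaryGroup φ)) h.right ?_
  have : phaseMatrix φ * phaseMatrix (fun k => Real.pi - φ k) = -1 := by
    rw [phaseMatrix_add, phaseMatrix, ← diagonal_one, diagonal_neg]
    congr 1
    funext k
    have : -(((φ + fun k => Real.pi - φ k) k : ℝ) : ℂ) * Complex.I = -(Real.pi * Complex.I) := by
      simp
    rw [this, Complex.exp_neg, Complex.exp_pi_mul_I]
    simp
  rw [mul_assoc u, this, h.left]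
  simp

end

section

open Matrix

/-! ### Subspaces spanned by frames -/

theorem OrientedPlane.toSubmodule_mk {n : ℕ} (e : Frame n) :
    OrientedPlane.toSubmodule ⟦e⟧ = Submodule.span ℝ (Set.range e.1) := rfl

theorem span_range_mulFrame_le {n : ℕ} (e : Fin n → Cn n) (g : Matrix (Fin n) (Fin n) ℝ) :
    Submodule.span ℝ (Set.range (mulFrame e g)) ≤ Submodule.span ℝ (Set.range e) := by
  rw [Submodule.span_le]
  rintro _ ⟨j, rfl⟩
  exact Submodule.sum_mem _ fun i _ => Submodule.smul_mem _ _ (Submodule.subset_span ⟨i, rfl⟩)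

theorem SLagPlane.toSubmodule_eq_span {n : ℕ} (η : SLagPlane n) {v : Frame n}
    (hv : frameMatrix v.1 ∈ unitaryGroup (Fin n) ℂ)
    (h : η.1.symMatrix = frameMatrix v.1 * (frameMatrix v.1)ᵀ) :
    η.1.toSubmodule = Submodule.span ℝ (Set.range v.1) := by
  obtain ⟨e, he, heU⟩ := η.exists_frame
  rw [he, OrientedPlane.symMatrix_mk] at h
  have heU' := (mem_specialUnitaryGroup_iff.1 heU).1
  rw [he, OrientedPlane.toSubmodule_mk]
  have key : ∀ {a b : Frame n}, frameMatrix a.1 ∈ unitaryGroup (Fin n) ℂ →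
      frameMatrix b.1 ∈ unitaryGroup (Fin n) ℂ →
      frameMatrix b.1 * (frameMatrix b.1)ᵀ = frameMatrix a.1 * (frameMatrix a.1)ᵀ →
      Submodule.span ℝ (Set.range b.1) ≤ Submodule.span ℝ (Set.range a.1) := by
    intro a b ha hb hab
    obtain ⟨g, -, hg⟩ := exists_orthogonal_of_mul_transpose_eq ha hb hab
    rw [← frameMatrix_mulFrame] at hg
    rw [frameMatrix_injective hg]
    exact span_range_mulFrame_le _ _
  exact le_antisymm (key hv heU' h) (key heU' hv h.symm)

theorem SLagPlane.symMatrix_eq_of_toSubmodule {n : ℕ} (η : SLagPlane n) {v : Frame n}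
    (hv : frameMatrix v.1 ∈ unitaryGroup (Fin n) ℂ)
    (h : η.1.toSubmodule = Submodule.span ℝ (Set.range v.1)) :
    η.1.symMatrix = frameMatrix v.1 * (frameMatrix v.1)ᵀ := by
  obtain ⟨e, he, heU⟩ := η.exists_frame
  rw [he, OrientedPlane.toSubmodule_mk] at h
  have heU' := (mem_specialUnitaryGroup_iff.1 heU).1
  have h1 : ∀ j, ∃ c : Fin n → ℝ, ∑ i, c i • v.1 i = e.1 j := fun j =>
    (Submodule.mem_span_range_iff_exists_fun ℝ).1 (h ▸ Submodule.subset_span ⟨j, rfl⟩)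
  choose c hc using h1
  let g : Matrix (Fin n) (Fin n) ℝ := Matrix.of fun i j => c j i
  have hg : frameMatrix e.1 = frameMatrix v.1 * complexify g := by
    rw [← frameMatrix_mulFrame]
    congr 1
    funext j
    exact (hc j).symm
  have hgU : complexify g ∈ unitaryGroup (Fin n) ℂ := by
    have : complexify g = star (frameMatrix v.1) * frameMatrix e.1 := by
      rw [hg, ← mul_assoc, mem_unitaryGroup_iff'.1 hv, one_mul]
    rw [this]
    exact mul_mem (Unitary.star_mem hv) heU'
  have hgO : complexify g * (complexify g)ᵀ = 1 := by
    have := mem_unitaryGroup_iff.1 hgU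
    rwa [star_eq_conjTranspose, complexify_conjTranspose, complexify_transpose] at this
  rw [he, OrientedPlane.symMatrix_mk, hg, transpose_mul, mul_assoc, ← mul_assoc (complexify g), hgO,
    one_mul]

theorem frameMatrix_flipFrame {n : ℕ} (e : Frame n) :
    frameMatrix (flipFrame e).1
      = frameMatrix e.1 * diagonal fun i : Fin n => if (i : ℕ) = 0 then (-1 : ℂ) else 1 := by
  ext i j
  rw [mul_diagonal]
  by_cases h : (j : ℕ) = 0 <;> simp [frameMatrix, flipFrame, h]

theorem det_frameMatrix_flipFrame {n : ℕ} (hn : 1 ≤ n) (e : Frame n) :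
    (frameMatrix (flipFrame e).1).det = -(frameMatrix e.1).det := by
  have h : (fun i : Fin n => if (i : ℕ) = 0 then (-1 : ℂ) else 1)
      = Function.update (1 : Fin n → ℂ) (⟨0, hn⟩ : Fin n) (-1) := by
    funext i
    by_cases h : i = ⟨0, hn⟩
    · simp [h]
    · have : (i : ℕ) ≠ 0 := fun h' => h (Fin.ext h')
      simp [h, this]
  rw [frameMatrix_flipFrame, det_mul, det_diagonal, h,
    Finset.prod_update_of_mem (Finset.mem_univ _)]
  simp

theorem frameMatrix_flipFrame_mul_transpose {n : ℕ} (e : Frame n) :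
    frameMatrix (flipFrame e).1 * (frameMatrix (flipFrame e).1)ᵀ
      = frameMatrix e.1 * (frameMatrix e.1)ᵀ := by
  have hss : (diagonal fun i : Fin n => if (i : ℕ) = 0 then (-1 : ℂ) else 1)
      * (diagonal fun i : Fin n => if (i : ℕ) = 0 then (-1 : ℂ) else 1) = 1 := by
    rw [diagonal_mul_diagonal, ← diagonal_one]
    congr 1
    funext i
    split_ifs <;> simp
  rw [frameMatrix_flipFrame, transpose_mul, diagonal_transpose, mul_assoc,
    ← mul_assoc (diagonal _), hss, one_mul]

theorem frameMatrix_flipFrame_mem {n : ℕ} {e : Frame n}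
    (he : frameMatrix e.1 ∈ unitaryGroup (Fin n) ℂ) :
    frameMatrix (flipFrame e).1 ∈ unitaryGroup (Fin n) ℂ := by
  rw [frameMatrix_flipFrame]
  refine mul_mem he (diagonal_sign_mem_unitaryGroup fun i => ?_)
  split_ifs <;> simp

theorem flipFrame_flipFrame {n : ℕ} (e : Frame n) : flipFrame (flipFrame e) = e := by
  apply Subtype.ext
  funext i
  by_cases h : (i : ℕ) = 0 <;> simp [flipFrame, h]

theorem OrientedPlane.neg_mk {n : ℕ} (e : Frame n) :
    OrientedPlane.neg ⟦e⟧ = ⟦flipFrame e⟧ := rfl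

theorem OrientedPlane.neg_neg {n : ℕ} (η : OrientedPlane n) : η.neg.neg = η := by
  induction η using Quotient.inductionOn with
  | h e => rw [neg_mk, neg_mk, flipFrame_flipFrame]

/-- Flipping the first vector of `v` turns the determinant into `1`, so the flipped frame is the one
that orients `ξ`. -/
theorem SLagPlane.neg_eq_mk_of_symMatrix {n : ℕ} (hn : 1 ≤ n) (ξ : SLagPlane n) {v : Frame n}
    (hv : frameMatrix v.1 ∈ unitaryGroup (Fin n) ℂ) (hdet : (frameMatrix v.1).det = -1)
    (h : ξ.1.symMatrix = frameMatrix v.1 * (frameMatrix v.1)ᵀ) : ξ.1.neg = ⟦v⟧ := by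
  have h1 : ξ.1 = ⟦flipFrame v⟧ := by
    apply ξ.eq_mk_of_symMatrix
    · refine mem_specialUnitaryGroup_iff.2 ⟨frameMatrix_flipFrame_mem hv, ?_⟩
      rw [det_frameMatrix_flipFrame hn, hdet]
      simp
    · rw [frameMatrix_flipFrame_mul_transpose, h]
  rw [h1, OrientedPlane.neg_mk, flipFrame_flipFrame]

/-! ### Symmetry of the angle criterion -/

theorem orthonormal_sumElim_iff {n : ℕ} {e f : Fin n → Cn n} :
    Orthonormal ℝ (Sum.elim e f) ↔ Orthonormal ℝ e ∧ Orthonormal ℝ f ∧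
      ∀ i j, inner ℝ (e i) (f j) = 0 := by
  constructor
  · intro h
    refine ⟨h.comp Sum.inl Sum.inl_injective, h.comp Sum.inr Sum.inr_injective, fun i j => ?_⟩
    exact h.2 (i := Sum.inl i) (j := Sum.inr j) (by simp)
  · rintro ⟨he, hf, hef⟩
    refine ⟨?_, ?_⟩
    · rintro (i | i)
      exacts [he.1 i, hf.1 i]
    · rintro (i | i) (j | j) hij
      · exact he.2 (by simpa using hij)
      · exact hef i j
      · rw [Sum.elim_inr, Sum.elim_inl, real_inner_comm]
        exact hef j i
      · exact hf.2 (by simpa using hij)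

theorem IsCharacterizingAngles.symm {n : ℕ} {η ξ : OrientedPlane n} {θ : Fin n → ℝ}
    (h : IsCharacterizingAngles η ξ θ) : IsCharacterizingAngles ξ η θ := by
  obtain ⟨h1, h2, h3, e, f, e', hef, he', hη, hξ⟩ := h
  -- In the plane of `e j` and `f j`, this is the unit vector orthogonal to `e' j` on the side of `e
  -- j`; thus `e j` is `cos θ` times `e' j` plus `sin θ` times it.
  refine ⟨h1, h2, h3, e', fun j => Real.sin (θ j) • e.1 j - Real.cos (θ j) • f j, e, ?_, ?_, hξ, hη⟩
  · obtain ⟨he, hf, hef⟩ := orthonormal_sumElim_iff.1 hef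
    have hfe : ∀ i j, inner ℝ (f i) (e.1 j) = 0 := fun i j => by rw [real_inner_comm, hef]
    rw [orthonormal_iff_ite] at he hf
    refine orthonormal_sumElim_iff.2 ⟨e'.2, ?_, ?_⟩
    · rw [orthonormal_iff_ite]
      intro i j
      simp only [inner_sub_left, inner_sub_right, real_inner_smul_left, real_inner_smul_right,
        he, hf, hef, hfe]
      by_cases hij : i = j
      · subst hij
        simp only [if_true]
        linear_combination Real.sin_sq_add_cos_sq (θ i)
      · simp [hij]
    · intro i j
      simp only [he', inner_sub_right, inner_add_left, real_inner_smul_left,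
        real_inner_smul_right, he, hf, hef, hfe]
      by_cases hij : i = j
      · subst hij
        simp only [if_true]
        ring
      · simp [hij]
  · intro j
    rw [he', smul_sub, smul_add, smul_smul, smul_smul, smul_smul, smul_smul,
      mul_comm (Real.sin (θ j)) (Real.cos (θ j)), add_add_sub_cancel, ← add_smul]
    rw [show Real.cos (θ j) * Real.cos (θ j) + Real.sin (θ j) * Real.sin (θ j) = 1 by
      linear_combination Real.sin_sq_add_cos_sq (θ j), one_smul]

theorem IsCharacterizingAngles.neg {n : ℕ} {η ξ : OrientedPlane n} {θ : Fin n → ℝ}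
    (h : IsCharacterizingAngles η ξ θ) : IsCharacterizingAngles η.neg ξ.neg θ := by
  obtain ⟨h1, h2, h3, e, f, e', hef, he', rfl, rfl⟩ := h
  obtain ⟨he, hf, hef⟩ := orthonormal_sumElim_iff.1 hef
  refine ⟨h1, h2, h3, flipFrame e, (flipFrame ⟨f, hf⟩).1, flipFrame e', ?_, ?_, rfl, rfl⟩
  · refine orthonormal_sumElim_iff.2 ⟨(flipFrame e).2, (flipFrame ⟨f, hf⟩).2, fun i j => ?_⟩
    simp only [flipFrame, real_inner_smul_left, real_inner_smul_right, hef, mul_zero]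
  · intro j
    simp only [flipFrame, he', smul_add]
    rw [smul_comm, smul_comm (Real.sin _)]

theorem AngleCriterion.symm {n : ℕ} {η ξ : OrientedPlane n} (h : AngleCriterion η ξ) :
    AngleCriterion ξ η := by
  obtain ⟨θ, hθ, hs⟩ := h
  refine ⟨θ, ?_, hs⟩
  have := hθ.symm.neg
  rwa [OrientedPlane.neg_neg] at this

theorem OrientedPlane.Transverse.symm {n : ℕ} {η ξ : OrientedPlane n} (h : η.Transverse ξ) :
    ξ.Transverse η := by
  rwa [OrientedPlane.Transverse, sup_comm]

/-! ### The angle criterion for planes in normal form -/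

theorem unitaryFrame_mul_phaseMatrix {n : ℕ} {u : Matrix (Fin n) (Fin n) ℂ}
    (hu : u ∈ unitaryGroup (Fin n) ℂ) (φ : Fin n → ℝ) (j : Fin n) :
    (unitaryFrame (u * phaseMatrix φ) (mul_mem hu (phaseMatrix_mem_unitaryGroup φ))).1 j
      = Real.cos (φ j) • (unitaryFrame u hu).1 j
        + Real.sin (φ j) • ((-Complex.I) • (unitaryFrame u hu).1 j) := by
  ext i
  simp only [unitaryFrame, phaseMatrix, mul_diagonal, PiLp.add_apply, PiLp.smul_apply,
    Complex.real_smul, smul_eq_mul]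
  rw [show -(φ j : ℂ) * Complex.I = ((-φ j : ℝ) : ℂ) * Complex.I by push_cast; ring,
    Complex.exp_mul_I, ← Complex.ofReal_cos, ← Complex.ofReal_sin, Real.cos_neg, Real.sin_neg]
  push_cast
  ring

theorem orthonormal_unitaryFrame_sumElim {n : ℕ} {u : Matrix (Fin n) (Fin n) ℂ}
    (hu : u ∈ unitaryGroup (Fin n) ℂ) :
    Orthonormal ℝ (Sum.elim (unitaryFrame u hu).1
      fun j => (-Complex.I) • (unitaryFrame u hu).1 j) := by
  have hfm : frameMatrix (fun j => (-Complex.I) • (unitaryFrame u hu).1 j) = (-Complex.I) • u := by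
    ext i j
    simp [frameMatrix, unitaryFrame]
  have huu : uᴴ * u = 1 := mem_unitaryGroup_iff'.1 hu
  refine orthonormal_sumElim_iff.2 ⟨(unitaryFrame u hu).2, ?_, fun i j => ?_⟩
  · apply orthonormal_of_unitary
    rw [hfm, mem_unitaryGroup_iff', star_eq_conjTranspose, conjTranspose_smul, smul_mul_smul_comm,
      huu]
    simp
  · rw [← re_conjTranspose_mul_frameMatrix (unitaryFrame u hu).1
      fun j => (-Complex.I) • (unitaryFrame u hu).1 j, hfm, frameMatrix_unitaryFrame, mul_smul_comm, huu,
      Matrix.smul_apply, one_apply]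
    split_ifs <;> simp

/-- The orthonormal basis required by the definition consists of `u_k` and `-i u_k`. The rotated
frame `exp(-iφ_k) u_k` has determinant `exp(-iπ) = -1`, which is exactly the orientation of `-ξ`.
Sorting the phases supplies the monotonicity. -/
theorem NormalForm.angleCriterion {n : ℕ} (hn : 1 ≤ n) {η ξ : SLagPlane n}
    {u : Matrix (Fin n) (Fin n) ℂ} {φ : Fin n → ℝ} (h : NormalForm η ξ u φ)
    (h0 : ∀ k, 0 ≤ φ k) (hsum : ∑ k, φ k = Real.pi) : AngleCriterion η.1 ξ.1 := by
  obtain ⟨u', h'⟩ := h.perm hn (Tuple.sort φ)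
  have hmono := Tuple.monotone_sort φ
  have hsum' : ∑ k, (φ ∘ Tuple.sort φ) k = Real.pi := by
    rw [← hsum]
    exact Equiv.sum_comp (Tuple.sort φ) φ
  have h0' : ∀ k, 0 ≤ (φ ∘ Tuple.sort φ) k := fun k => h0 _
  generalize φ ∘ Tuple.sort φ = θ at *
  have hu := (mem_specialUnitaryGroup_iff.1 h'.mem).1
  -- The bounds `π/2` and `π - θ i` in the definition follow from the order and from this: two of
  -- the nonnegative angles cannot exceed their total `π`.
  have hpair : ∀ i j, i ≠ j → θ i + θ j ≤ Real.pi := fun i j hij => by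
    rw [← hsum', ← Finset.sum_pair hij]
    exact Finset.sum_le_sum_of_subset_of_nonneg (Finset.subset_univ _) fun k _ _ => h0' k
  refine ⟨θ, ⟨fun i => ⟨h0' i, ?_⟩, hmono, fun i j hij => ?_, unitaryFrame u' hu, _,
    unitaryFrame (u' * phaseMatrix θ) (mul_mem hu (phaseMatrix_mem_unitaryGroup θ)),
    orthonormal_unitaryFrame_sumElim hu, unitaryFrame_mul_phaseMatrix hu θ, ?_, ?_⟩, hsum'⟩
  · rw [← hsum']
    exact Finset.single_le_sum (fun k _ => h0' k) (Finset.mem_univ i)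
  · have := hpair i j hij.ne
    have := hmono hij.le
    constructor <;> linarith
  · exact η.eq_mk_of_symMatrix h'.mem h'.left
  · apply ξ.neg_eq_mk_of_symMatrix hn
    · exact mul_mem hu (phaseMatrix_mem_unitaryGroup θ)
    · rw [frameMatrix_unitaryFrame, det_mul, (mem_specialUnitaryGroup_iff.1 h'.mem).2, one_mul,
        det_phaseMatrix, hsum', neg_mul, Complex.exp_neg, Complex.exp_pi_mul_I]
      norm_num
    · exact h'.right

/-- With phases in `[0, π)` of sum `mπ` one has `0 ≤ m < n`, which for `n ≤ 3` leaves `m = 0`, `1`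
or `n - 1`. The last case becomes `m = 1` after interchanging the planes. -/
theorem angleCriterion_of_le_three {n : ℕ} (hn : 1 ≤ n) (hn3 : n ≤ 3) (η ξ : SLagPlane n) :
    AngleCriterion η.1 ξ.1 := by
  obtain ⟨u, φ, h, hφ⟩ := exists_normalForm hn η ξ
  obtain ⟨m, hm⟩ := h.exists_sum_eq
  have hpi := Real.pi_pos
  have : Nonempty (Fin n) := ⟨⟨0, hn⟩⟩
  have hm0 : 0 ≤ m := by
    have : 0 ≤ (m : ℝ) * Real.pi := hm ▸ Finset.sum_nonneg fun k _ => (hφ k).1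
    exact_mod_cast nonneg_of_mul_nonneg_left this hpi
  have hmn : m < n := by
    have h1 : ∑ k, φ k < ∑ _k : Fin n, Real.pi :=
      Finset.sum_lt_sum_of_nonempty Finset.univ_nonempty fun k _ => (hφ k).2
    rw [hm] at h1
    simp only [Finset.sum_const, Finset.card_univ, Fintype.card_fin, nsmul_eq_mul] at h1
    exact_mod_cast lt_of_mul_lt_mul_right h1 hpi.le
  have hcases : m = 0 ∨ m = 1 ∨ m = n - 1 := by omega
  rcases hcases with rfl | rfl | hmn1
  · have hz : ∀ k, φ k = 0 := fun k =>
      (Finset.sum_eq_zero_iff_of_nonneg fun k _ => (hφ k).1).1 (by simpa using hm) k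
        (Finset.mem_univ k)
    -- All phases vanish, so the planes coincide; trading one phase `0` for `π` makes the sum `π`.
    refine (h.congr_phase (φ' := Function.update 0 ⟨0, hn⟩ Real.pi) fun k => ?_).angleCriterion hn
      (fun k => ?_) ?_
    · by_cases hk : k = ⟨0, hn⟩
      · subst hk; simp [hz]
      · simp [hk, hz]
    · by_cases hk : k = ⟨0, hn⟩
      · subst hk; simpa using hpi.le
      · simp [hk]
    · rw [Finset.sum_update_of_mem (Finset.mem_univ _)]
      simp
  · exact h.angleCriterion hn (fun k => (hφ k).1) (by simpa using hm)
  · obtain ⟨u', h'⟩ := h.swap hn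
    refine (h'.angleCriterion hn (fun k => by linarith [(hφ k).2]) ?_).symm
    rw [Finset.sum_sub_distrib, hm, hmn1]
    simp
    ring

/-! ### Transversality for planes in normal form -/

/-- If `sin φ_k = 0`, then `-i u_k` is orthogonal to both planes. Otherwise `-i u_k` is a
combination of `u_k` and `exp(-iφ_k) u_k`, and the vectors `u_k`, `-i u_k` span `ℂⁿ` over `ℝ`. -/
theorem NormalForm.transverse_iff {n : ℕ} {η ξ : SLagPlane n}
    {u : Matrix (Fin n) (Fin n) ℂ} {φ : Fin n → ℝ} (h : NormalForm η ξ u φ) :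
    η.1.Transverse ξ.1 ↔ ∀ k, Real.sin (φ k) ≠ 0 := by
  have hu := (mem_specialUnitaryGroup_iff.1 h.mem).1
  have hl := η.toSubmodule_eq_span (v := unitaryFrame u hu) hu h.left
  have hr := ξ.toSubmodule_eq_span (v := unitaryFrame (u * phaseMatrix φ)
    (mul_mem hu (phaseMatrix_mem_unitaryGroup φ)))
    (mul_mem hu (phaseMatrix_mem_unitaryGroup φ)) h.right
  rw [OrientedPlane.Transverse, hl, hr]
  set e := (unitaryFrame u hu).1 with he
  obtain ⟨hee, -, hef⟩ := orthonormal_sumElim_iff.1 (orthonormal_unitaryFrame_sumElim hu)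
  have hff := (orthonormal_sumElim_iff.1 (orthonormal_unitaryFrame_sumElim hu)).2.1
  rw [orthonormal_iff_ite] at hee hff
  constructor
  · intro htop k hk
    have hle : Submodule.span ℝ (Set.range e) ⊔ Submodule.span ℝ (Set.range
        (unitaryFrame (u * phaseMatrix φ) (mul_mem hu (phaseMatrix_mem_unitaryGroup φ))).1)
        ≤ (ℝ ∙ ((-Complex.I) • e k))ᗮ := by
      refine sup_le ?_ ?_ <;> rw [Submodule.span_le] <;> rintro _ ⟨j, rfl⟩ <;>
        rw [SetLike.mem_coe, Submodule.mem_orthogonal_singleton_iff_inner_left]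
      · exact hef j k
      · rw [unitaryFrame_mul_phaseMatrix hu, inner_add_left, real_inner_smul_left,
          real_inner_smul_left, hef, hff]
        by_cases hjk : j = k
        · simp [hjk, hk]
        · simp [hjk]
    rw [htop] at hle
    have h1 := Submodule.mem_orthogonal_singleton_iff_inner_left.1
      (hle (Submodule.mem_top (x := (-Complex.I) • e k)))
    rw [hff] at h1
    simp at h1
  · intro hs
    rw [eq_top_iff]
    set W := Submodule.span ℝ (Set.range e) ⊔ Submodule.span ℝ (Set.range
        (unitaryFrame (u * phaseMatrix φ) (mul_mem hu (phaseMatrix_mem_unitaryGroup φ))).1)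
    have h1 : ∀ j, e j ∈ W := fun j => le_sup_left (α := Submodule ℝ (Cn n))
      (Submodule.subset_span ⟨j, rfl⟩)
    have h2 : ∀ j, (-Complex.I) • e j ∈ W := fun j => by
      have h3 : (unitaryFrame (u * phaseMatrix φ)
          (mul_mem hu (phaseMatrix_mem_unitaryGroup φ))).1 j ∈ W :=
        le_sup_right (α := Submodule ℝ (Cn n)) (Submodule.subset_span ⟨j, rfl⟩)
      rw [unitaryFrame_mul_phaseMatrix hu] at h3
      have h4 := (Submodule.add_mem_iff_right W (W.smul_mem _ (h1 j))).1 h3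
      exact (Submodule.smul_mem_iff W (hs j)).1 h4
    intro w _
    have hw : w = ∑ j, ((((uᴴ *ᵥ w.ofLp) j).re • e j)
        + (-((uᴴ *ᵥ w.ofLp) j).im) • ((-Complex.I) • e j)) := by
      have h5 : u *ᵥ (uᴴ *ᵥ w.ofLp) = w.ofLp := by
        rw [mulVec_mulVec, ← star_eq_conjTranspose, mem_unitaryGroup_iff.1 hu, one_mulVec]
      ext i
      conv_lhs => rw [← h5]
      simp only [mulVec, dotProduct, WithLp.ofLp_sum, Finset.sum_apply, PiLp.add_apply,
        PiLp.smul_apply, Complex.real_smul, smul_eq_mul]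
      refine Finset.sum_congr rfl fun j _ => ?_
      set z := ∑ x, uᴴ j x * w.ofLp x
      have : (e j).ofLp i = u i j := rfl
      rw [this]
      conv_lhs => rw [← Complex.re_add_im z]
      push_cast
      ring
    rw [hw]
    exact W.sum_mem fun j _ => W.add_mem (W.smul_mem _ (h1 j)) (W.smul_mem _ (h2 j))

end

/-! ### From characterizing angles back to the phases; Lawlor pairs -/

section

open Matrix

/-- Equal multiplicities make corresponding fibres of `f` and `g` equinumerous; bijections of the
fibres are glued. -/
theorem exists_perm_of_map_univ_eq {ι α : Type*} [Fintype ι] {f g : ι → α}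
    (h : Finset.univ.val.map f = Finset.univ.val.map g) :
    ∃ σ : Equiv.Perm ι, ∀ i, g (σ i) = f i := by
  classical
  have hcard : ∀ c, Nonempty ({a // f a = c} ≃ {b // g b = c}) := fun c => by
    refine ⟨Fintype.equivOfCardEq ?_⟩
    have := congrArg (Multiset.count c) h
    rw [Multiset.count_map, Multiset.count_map] at this
    rw [Fintype.card_subtype, Fintype.card_subtype]
    simpa [Finset.card_def, Finset.filter_val, eq_comm] using this
  exact ⟨Equiv.ofFiberEquiv fun c => (hcard c).some, fun i => Equiv.ofFiberEquiv_map _ i⟩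

theorem exists_perm_of_charpoly_diagonal_eq {n : ℕ} {a b : Fin n → ℝ}
    (h : (diagonal a).charpoly = (diagonal b).charpoly) :
    ∃ σ : Equiv.Perm (Fin n), ∀ i, b (σ i) = a i := by
  rw [charpoly_diagonal, charpoly_diagonal] at h
  have key : ∀ c : Fin n → ℝ, (∏ i, (Polynomial.X - Polynomial.C (c i))).roots
      = Finset.univ.val.map c := fun c => by
    rw [← Polynomial.roots_multiset_prod_X_sub_C (Finset.univ.val.map c), Multiset.map_map]
    rfl
  exact exists_perm_of_map_univ_eq (by rw [← key, ← key, h])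

theorem re_complexify_mul_phaseMatrix_mul {n : ℕ} (X Y : Matrix (Fin n) (Fin n) ℝ)
    (φ : Fin n → ℝ) :
    (complexify X * phaseMatrix φ * complexify Y).map Complex.re
      = X * diagonal (fun k => Real.cos (φ k)) * Y := by
  ext i j
  rw [map_apply, mul_apply, mul_apply, Complex.re_sum]
  refine Finset.sum_congr rfl fun k _ => ?_
  rw [phaseMatrix, mul_diagonal, mul_diagonal,
    show -(φ k : ℂ) * Complex.I = ((-φ k : ℝ) : ℂ) * Complex.I by push_cast; ring]
  simp only [map_apply, Complex.ofRealHom_eq_coe]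
  rw [Complex.re_mul_ofReal, Complex.re_ofReal_mul, Complex.exp_ofReal_mul_I_re, Real.cos_neg]

/-- Two systems of angles with the same squared cosines, and products of cosines related as for
special Lagrangian planes. -/
theorem sum_eq_of_cos_sq_eq {n : ℕ} {θ φ : Fin n → ℝ} (hφ : ∀ k, 0 < φ k ∧ φ k < Real.pi)
    (hθ : ∀ k, 0 ≤ θ k ∧ θ k ≤ Real.pi) (hθs : ∑ k, θ k = Real.pi)
    (hsq : ∀ k, Real.cos (θ k) ^ 2 = Real.cos (φ k) ^ 2)
    (hint : Real.cos (∑ k, φ k) = 1 ∨ Real.cos (∑ k, φ k) = -1)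
    (hprod : ∏ k, Real.cos (θ k) = -Real.cos (∑ k, φ k) * ∏ k, Real.cos (φ k)) :
    ∑ k, φ k = Real.pi ∨ ∑ k, φ k = (n - 1 : ℝ) * Real.pi := by
  classical
  have hpi := Real.pi_pos
  have hcase : ∀ k, φ k = θ k ∨ φ k = Real.pi - θ k := fun k => by
    rcases sq_eq_sq_iff_eq_or_eq_neg.1 (hsq k) with h | h
    · left
      exact (Real.injOn_cos ⟨(hθ k).1, (hθ k).2⟩ ⟨(hφ k).1.le, (hφ k).2.le⟩ h).symm
    · right
      rw [← Real.cos_pi_sub] at h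
      have := Real.injOn_cos ⟨(hθ k).1, (hθ k).2⟩
        ⟨by linarith [(hφ k).2], by linarith [(hφ k).1]⟩ h
      linarith
  have hθ0 : ∀ k, 0 < θ k := fun k => by
    have := hφ k
    have := hθ k
    rcases hcase k with h | h <;> linarith
  -- `R` is the set of reflected indices. The second condition fixes the parity of its cardinality.
  have hR : ∃ R : Finset (Fin n), (∀ k, φ k = if k ∈ R then Real.pi - θ k else θ k) ∧
      Real.cos (∑ k, φ k) * (-1) ^ R.card = -1 := by
    let R₀ := Finset.univ.filter fun k => φ k ≠ θ k
    have hR₀ : ∀ k, φ k = if k ∈ R₀ then Real.pi - θ k else θ k := fun k => by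
      by_cases h : φ k = θ k
      · simp [R₀, h]
      · simpa [R₀, h] using (hcase k).resolve_left h
    -- If some angle is `π/2`, the product relation is vacuous, but that index may be counted in `R`
    -- or not, so the parity can be chosen. Otherwise the product of cosines can be cancelled from
    -- `hprod`.
    by_cases hz : ∃ k, θ k = Real.pi / 2
    · obtain ⟨k₀, hk₀⟩ := hz
      have hφk₀ : φ k₀ = θ k₀ := by
        rcases hcase k₀ with h | h <;> linarith
      have hk₀R : k₀ ∉ R₀ := by simp [R₀, hφk₀]
      have hR₁ : ∀ k, φ k = if k ∈ insert k₀ R₀ then Real.pi - θ k else θ k := fun k => by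
        by_cases h : k = k₀
        · subst h
          simp only [Finset.mem_insert_self, if_true]
          linarith
        · simpa [h] using hR₀ k
      rcases hint with h | h <;> rcases neg_one_pow_eq_or ℝ R₀.card with h' | h'
      · exact ⟨insert k₀ R₀, hR₁, by
          rw [Finset.card_insert_of_notMem hk₀R, pow_succ, h, h']; norm_num⟩
      · exact ⟨R₀, hR₀, by rw [h, h']; norm_num⟩
      · exact ⟨R₀, hR₀, by rw [h, h']; norm_num⟩
      · exact ⟨insert k₀ R₀, hR₁, by
          rw [Finset.card_insert_of_notMem hk₀R, pow_succ, h, h']; norm_num⟩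
    · refine ⟨R₀, hR₀, ?_⟩
      have hne : ∏ k, Real.cos (θ k) ≠ 0 := by
        rw [Finset.prod_ne_zero_iff]
        intro k _ h
        refine hz ⟨k, ?_⟩
        rw [← Real.cos_pi_div_two] at h
        exact Real.injOn_cos ⟨(hθ k).1, (hθ k).2⟩ ⟨by linarith, by linarith⟩ h
      have hcos : ∏ k, Real.cos (φ k) = (-1) ^ R₀.card * ∏ k, Real.cos (θ k) := by
        have : ∀ k, Real.cos (φ k) = (if k ∈ R₀ then (-1 : ℝ) else 1) * Real.cos (θ k) :=
          fun k => by
            rw [hR₀ k]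
            split_ifs
            · rw [Real.cos_pi_sub]; ring
            · ring
        rw [Finset.prod_congr rfl fun k _ => this k, Finset.prod_mul_distrib]
        congr 1
        rw [Finset.prod_ite_mem, Finset.univ_inter, Finset.prod_const]
      rw [hcos] at hprod
      have : (1 + Real.cos (∑ k, φ k) * (-1) ^ R₀.card) * ∏ k, Real.cos (θ k) = 0 := by
        linear_combination hprod
      have := (mul_eq_zero.1 this).resolve_right hne
      linarith
  obtain ⟨R, hR, hcR⟩ := hR
  set S := ∑ k, (if k ∈ R then -θ k else θ k) with hS
  have hsum : ∑ k, φ k = S + R.card * Real.pi := by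
    have : ∀ k, φ k = (if k ∈ R then -θ k else θ k) + (if k ∈ R then Real.pi else 0) := fun k => by
      rw [hR k]
      split_ifs <;> ring
    rw [Finset.sum_congr rfl fun k _ => this k, Finset.sum_add_distrib, Finset.sum_ite_mem,
      Finset.univ_inter, Finset.sum_const, nsmul_eq_mul]
  -- The signed sum `S = ∑ ±θ` lies in `[-π, π]`, so cosine `-1` means `S = ±π`. As all `θ k` are
  -- positive with sum `π`, all signs agree: `R` is empty or everything.
  have hcosS : Real.cos S = -1 := by
    rw [hsum, Real.cos_add_nat_mul_pi] at hcR
    have : ((-1 : ℝ) ^ R.card) * (-1) ^ R.card = 1 := by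
      rw [← mul_pow]; simp
    calc Real.cos S = ((-1 : ℝ) ^ R.card * (-1) ^ R.card) * Real.cos S := by rw [this, one_mul]
      _ = (-1) ^ R.card * Real.cos S * (-1) ^ R.card := by ring
      _ = -1 := hcR
  have h1 : S = Real.pi - ∑ k, (if k ∈ R then 2 * θ k else 0) := by
    rw [← hθs, ← Finset.sum_sub_distrib]
    refine Finset.sum_congr rfl fun k _ => ?_
    split_ifs <;> ring
  have h2 : S = -Real.pi + ∑ k, (if k ∈ R then 0 else 2 * θ k) := by
    rw [← hθs, ← Finset.sum_neg_distrib, ← Finset.sum_add_distrib]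
    refine Finset.sum_congr rfl fun k _ => ?_
    split_ifs <;> ring
  have h1' : 0 ≤ ∑ k, (if k ∈ R then 2 * θ k else 0) := Finset.sum_nonneg fun k _ => by
    split_ifs <;> linarith [hθ0 k]
  have h2' : 0 ≤ ∑ k, (if k ∈ R then 0 else 2 * θ k) := Finset.sum_nonneg fun k _ => by
    split_ifs <;> linarith [hθ0 k]
  have habs : |S| = Real.pi := by
    refine Real.injOn_cos ⟨abs_nonneg _, abs_le.2 ⟨by linarith, by linarith⟩⟩ ⟨hpi.le, le_rfl⟩ ?_
    rw [Real.cos_abs, hcosS, Real.cos_pi]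
  rcases abs_choice S with h | h
  · left
    have hz : ∑ k, (if k ∈ R then 2 * θ k else 0) = 0 := by linarith
    have hz' := (Finset.sum_eq_zero_iff_of_nonneg fun k _ => by
      split_ifs <;> linarith [hθ0 k]).1 hz
    have hR0 : R = ∅ := Finset.eq_empty_of_forall_notMem fun k hk => by
      have := hz' k (Finset.mem_univ k)
      rw [if_pos hk] at this
      linarith [hθ0 k]
    rw [hsum, hR0]
    simp
    linarith
  · right
    have hz : ∑ k, (if k ∈ R then 0 else 2 * θ k) = 0 := by linarith
    have hz' := (Finset.sum_eq_zero_iff_of_nonneg fun k _ => by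
      split_ifs <;> linarith [hθ0 k]).1 hz
    have hR0 : R = Finset.univ := Finset.eq_univ_of_forall fun k => by
      by_contra hk
      have := hz' k (Finset.mem_univ k)
      rw [if_neg hk] at this
      linarith [hθ0 k]
    rw [hsum, hR0]
    simp
    linarith

theorem pos_and_lt_pi_of_sin_ne_zero {φ : ℝ} (h : 0 ≤ φ ∧ φ ≤ Real.pi) (hs : Real.sin φ ≠ 0) :
    0 < φ ∧ φ < Real.pi := by
  constructor
  · exact h.1.lt_of_ne fun h0 => hs (by rw [← h0, Real.sin_zero])
  · exact h.2.lt_of_ne fun h0 => hs (by rw [h0, Real.sin_pi])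

/-- The frames witnessing the angle criterion differ from those of the normal form by real
orthogonal matrices `g` and `k`. Comparing real Gram matrices gives `gᵀ diag(cos φ) k = diag(cos
θ)`: the singular values determine `cos² θ` up to order, and the determinants of `g` and `k` give
the sign of the product. It applies to any normal form with phases in `[0, π]`, as the openness
proof needs. -/
theorem NormalForm.sum_eq_of_angleCriterion {n : ℕ} (hn : 1 ≤ n) {η ξ : SLagPlane n}
    {u : Matrix (Fin n) (Fin n) ℂ} {φ : Fin n → ℝ} (h : NormalForm η ξ u φ)
    (hφ : ∀ k, 0 ≤ φ k ∧ φ k ≤ Real.pi) (ht : η.1.Transverse ξ.1)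
    (hac : AngleCriterion η.1 ξ.1) :
    (∀ k, 0 < φ k ∧ φ k < Real.pi) ∧
      (∑ k, φ k = Real.pi ∨ ∑ k, φ k = (n - 1 : ℝ) * Real.pi) := by
  have hφ' : ∀ k, 0 < φ k ∧ φ k < Real.pi := fun k =>
    pos_and_lt_pi_of_sin_ne_zero (hφ k) (h.transverse_iff.1 ht k)
  refine ⟨hφ', ?_⟩
  obtain ⟨θ, ⟨hθ, -, -, e, f, e', hef, he', hη, hξ⟩, hθs⟩ := hac
  obtain ⟨huU, hudet⟩ := mem_specialUnitaryGroup_iff.1 h.mem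
  have hξ' : ξ.1 = ⟦flipFrame e'⟧ := by
    rw [← ξ.1.neg_neg, hξ, OrientedPlane.neg_mk]
  have hE : frameMatrix e.1 ∈ specialUnitaryGroup (Fin n) ℂ :=
    mem_specialUnitaryGroup_of_re_Omega e.2 (by
      have := η.2
      rw [hη] at this
      exact this)
  have hF : frameMatrix (flipFrame e').1 ∈ specialUnitaryGroup (Fin n) ℂ :=
    mem_specialUnitaryGroup_of_re_Omega (flipFrame e').2 (by
      have := ξ.2
      rw [hξ'] at this
      exact this)
  obtain ⟨hEU, hEdet⟩ := mem_specialUnitaryGroup_iff.1 hE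
  obtain ⟨hFU, hFdet⟩ := mem_specialUnitaryGroup_iff.1 hF
  have hE'U : frameMatrix e'.1 ∈ unitaryGroup (Fin n) ℂ := by
    have := frameMatrix_flipFrame_mem hFU
    rwa [flipFrame_flipFrame] at this
  have hE'det : (frameMatrix e'.1).det = -1 := by
    rw [det_frameMatrix_flipFrame hn] at hFdet
    rw [← hFdet, _root_.neg_neg]
  obtain ⟨g, hg, hgE⟩ := exists_orthogonal_of_mul_transpose_eq huU hEU (by
    rw [← h.left, hη, OrientedPlane.symMatrix_mk])
  obtain ⟨k, hk, hkE⟩ := exists_orthogonal_of_mul_transpose_eq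
    (mul_mem huU (phaseMatrix_mem_unitaryGroup φ)) hE'U (by
    rw [← h.right, hξ', OrientedPlane.symMatrix_mk, frameMatrix_flipFrame_mul_transpose])
  have hg1 := (mem_orthogonalGroup_iff _ _).1 hg
  have hk1 := (mem_orthogonalGroup_iff _ _).1 hk
  have hgram : gᵀ * diagonal (fun i => Real.cos (φ i)) * k
      = diagonal fun i => Real.cos (θ i) := by
    rw [← re_complexify_mul_phaseMatrix_mul]
    have h1 : complexify gᵀ * phaseMatrix φ * complexify k
        = (frameMatrix e.1)ᴴ * frameMatrix e'.1 := by
      rw [hgE, hkE, conjTranspose_mul, complexify_conjTranspose]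
      calc complexify gᵀ * phaseMatrix φ * complexify k
          = complexify gᵀ * (star u * u) * phaseMatrix φ * complexify k := by
            rw [mem_unitaryGroup_iff'.1 huU, mul_one]
        _ = _ := by rw [star_eq_conjTranspose]; simp only [mul_assoc]
    rw [h1]
    obtain ⟨hee, -, hef⟩ := orthonormal_sumElim_iff.1 hef
    ext i j
    rw [map_apply, re_conjTranspose_mul_frameMatrix, he', inner_add_right, real_inner_smul_right,
      real_inner_smul_right, hef, orthonormal_iff_ite.1 hee, diagonal_apply]
    by_cases hij : i = j
    · simp [hij]
    · simp [hij]
  have hgdet : g.det = 1 := by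
    have h1 := congrArg det hgE
    rw [det_mul, hEdet, hudet, one_mul, det_complexify] at h1
    exact_mod_cast h1.symm
  have hexp : Complex.exp (-((∑ i, φ i : ℝ) : ℂ) * Complex.I) * (k.det : ℂ) = -1 := by
    have h1 := congrArg det hkE
    rw [det_mul, hE'det, det_mul, hudet, one_mul, det_complexify, det_phaseMatrix] at h1
    exact h1.symm
  have hre : Real.cos (∑ i, φ i) * k.det = -1 := by
    rw [show -((∑ i, φ i : ℝ) : ℂ) * Complex.I = ((-(∑ i, φ i) : ℝ) : ℂ) * Complex.I by
      push_cast; ring] at hexp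
    have h1 := congrArg Complex.re hexp
    rw [Complex.re_mul_ofReal, Complex.exp_ofReal_mul_I_re, Real.cos_neg] at h1
    simpa using h1
  have hkdet : k.det = 1 ∨ k.det = -1 := by
    have h1 := congrArg det hk1
    rw [det_mul, det_transpose, det_one] at h1
    exact mul_self_eq_one_iff.1 h1
  have hcos : Real.cos (∑ i, φ i) = 1 ∨ Real.cos (∑ i, φ i) = -1 := by
    rcases hkdet with h1 | h1 <;> rw [h1] at hre
    · right; linarith
    · left; linarith
  -- Both factors of `hre` are `±1` and their product is `-1`.
  have hkcos : k.det = -Real.cos (∑ i, φ i) := by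
    rcases hkdet with h1 | h1 <;> rw [h1] at hre ⊢ <;> linarith
  have hprod : ∏ i, Real.cos (θ i) = -Real.cos (∑ i, φ i) * ∏ i, Real.cos (φ i) := by
    have h1 := congrArg det hgram
    rw [det_mul, det_mul, det_transpose, hgdet, det_diagonal, det_diagonal, hkcos] at h1
    rw [← h1]
    ring
  -- With `D = gᵀ diag(cos φ) k`, the product `D Dᵀ` no longer involves `k`, and `g` only conjugates
  -- it.
  have hchar : (diagonal fun i => Real.cos (θ i) ^ 2).charpoly
      = (diagonal fun i => Real.cos (φ i) ^ 2).charpoly := by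
    have hd : ∀ α : Fin n → ℝ, (diagonal fun i => α i ^ 2) = diagonal α * (diagonal α)ᵀ :=
      fun α => by
        rw [diagonal_transpose, diagonal_mul_diagonal]
        simp only [sq]
    rw [hd fun i => Real.cos (θ i), hd fun i => Real.cos (φ i), ← hgram]
    have e1 : gᵀ * diagonal (fun i => Real.cos (φ i)) * k
        * (gᵀ * diagonal (fun i => Real.cos (φ i)) * k)ᵀ
        = gᵀ * (diagonal (fun i => Real.cos (φ i)) * (diagonal fun i => Real.cos (φ i))ᵀ * g) := by
      rw [transpose_mul, transpose_mul, transpose_transpose]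
      calc _ = gᵀ * (diagonal (fun i => Real.cos (φ i)) * (k * kᵀ)
            * ((diagonal fun i => Real.cos (φ i))ᵀ * g)) := by simp only [mul_assoc]
        _ = _ := by rw [hk1, mul_one]; simp only [mul_assoc]
    rw [e1, charpoly_mul_comm, mul_assoc, hg1, mul_one]
  obtain ⟨σ, hσ⟩ := exists_perm_of_charpoly_diagonal_eq hchar
  have hsφ : ∑ i, φ (σ i) = ∑ i, φ i := Equiv.sum_comp σ φ
  have := sum_eq_of_cos_sq_eq (φ := fun i => φ (σ i)) (fun i => hφ' (σ i)) hθ hθs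
    (fun i => (hσ i).symm) (by rwa [hsφ])
    (by rw [hsφ, hprod, Equiv.prod_comp σ fun i => Real.cos (φ i)])
  rwa [hsφ] at this

/-- The planes `η` and `ξ` are, after a special unitary transformation, the planes to which one of
Lawlor's submanifolds is asymptotic as `y → -∞` and as `y → ∞`. -/
def LawlorPair {n : ℕ} (η ξ : SLagPlane n) : Prop :=
  ∃ u θ, NormalForm η ξ u θ ∧ (∀ k, 0 < θ k ∧ θ k < Real.pi) ∧ ∑ k, θ k = Real.pi

theorem NormalForm.lawlorPair {n : ℕ} (hn : 1 ≤ n) {η ξ : SLagPlane n}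
    {u : Matrix (Fin n) (Fin n) ℂ} {φ : Fin n → ℝ} (h : NormalForm η ξ u φ)
    (hφ : ∀ k, 0 < φ k ∧ φ k < Real.pi)
    (hs : ∑ k, φ k = Real.pi ∨ ∑ k, φ k = (n - 1 : ℝ) * Real.pi) :
    LawlorPair η ξ ∨ LawlorPair ξ η := by
  rcases hs with hs | hs
  · exact Or.inl ⟨u, φ, h, hφ, hs⟩
  · obtain ⟨u', h'⟩ := h.swap hn
    refine Or.inr ⟨u', _, h', fun k => ⟨by linarith [(hφ k).2], by linarith [(hφ k).1]⟩, ?_⟩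
    rw [Finset.sum_sub_distrib, hs]
    simp
    ring

theorem LawlorPair.transverse_and_angleCriterion {n : ℕ} (hn : 1 ≤ n) {η ξ : SLagPlane n}
    (h : LawlorPair η ξ) : η.1.Transverse ξ.1 ∧ AngleCriterion η.1 ξ.1 := by
  obtain ⟨u, θ, h, hθ, hs⟩ := h
  exact ⟨h.transverse_iff.2 fun k => (Real.sin_pos_of_pos_of_lt_pi (hθ k).1 (hθ k).2).ne',
    h.angleCriterion hn (fun k => (hθ k).1.le) hs⟩

theorem transverse_and_angleCriterion_iff {n : ℕ} (hn : 1 ≤ n) (η ξ : SLagPlane n) :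
    (η.1.Transverse ξ.1 ∧ AngleCriterion η.1 ξ.1) ↔ LawlorPair η ξ ∨ LawlorPair ξ η := by
  constructor
  · rintro ⟨ht, hac⟩
    obtain ⟨u, φ, h, hφ⟩ := exists_normalForm hn η ξ
    obtain ⟨h1, h2⟩ := h.sum_eq_of_angleCriterion hn (fun k => ⟨(hφ k).1, (hφ k).2.le⟩) ht hac
    exact h.lawlorPair hn h1 h2
  · rintro (h | h)
    · exact h.transverse_and_angleCriterion hn
    · have := h.transverse_and_angleCriterion hn
      exact ⟨this.1.symm, this.2.symm⟩

/-! ### Openness -/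

theorem isCompact_specialUnitaryGroup {n : ℕ} :
    IsCompact {u : Matrix (Fin n) (Fin n) ℂ | u ∈ specialUnitaryGroup (Fin n) ℂ} := by
  have hK := isCompact_univ_pi fun _ : Fin n => isCompact_univ_pi fun _ : Fin n =>
    isCompact_closedBall (0 : ℂ) 1
  refine IsCompact.of_isClosed_subset (X := Matrix (Fin n) (Fin n) ℂ) hK ?_ ?_
  · have h1 : {u : Matrix (Fin n) (Fin n) ℂ | u ∈ specialUnitaryGroup (Fin n) ℂ}
        = {u | u * star u = 1} ∩ {u | u.det = 1} := by
      ext u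
      simp [mem_specialUnitaryGroup_iff, mem_unitaryGroup_iff]
    rw [h1]
    refine (isClosed_eq ?_ continuous_const).inter (isClosed_eq ?_ continuous_const)
    · exact continuous_id.matrix_mul continuous_star
    · exact continuous_id.matrix_det
  · intro u hu i _ j _
    rw [mem_closedBall_zero_iff]
    exact entry_norm_bound_of_unitary (mem_specialUnitaryGroup_iff.1 hu).1 i j

theorem continuous_phaseMatrix {n : ℕ} :
    Continuous (phaseMatrix : (Fin n → ℝ) → Matrix (Fin n) (Fin n) ℂ) := by
  refine Continuous.matrix_diagonal (continuous_pi fun k => ?_)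
  fun_prop

/-- The complement is the preimage, under the continuous map to pairs of symmetric matrices, of a
compact set: the image of the normal forms with bad phases. No continuous choice of normal form is
needed, because goodness does not depend on the normal form chosen. -/
theorem isOpen_transverse_and_angleCriterion {n : ℕ} (hn : 1 ≤ n) :
    IsOpen {q : SLagPlane n × SLagPlane n | q.1.1.Transverse q.2.1 ∧ AngleCriterion q.1.1 q.2.1} := by
  -- For an actual normal form the sum is a multiple of `π`, so being different from `π` and `(n -
  -- 1)π` is the same as being at distance at least `1 < π` from both. This form of the condition is
  -- closed.
  let bad : Set (Fin n → ℝ) := {φ | (∃ k, φ k = 0 ∨ φ k = Real.pi) ∨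
    (1 ≤ |∑ k, φ k - Real.pi| ∧ 1 ≤ |∑ k, φ k - (n - 1 : ℝ) * Real.pi|)}
  let C : Set (Matrix (Fin n) (Fin n) ℂ × (Fin n → ℝ)) :=
    {u | u ∈ specialUnitaryGroup (Fin n) ℂ} ×ˢ
      (Set.univ.pi (fun _ => Set.Icc 0 Real.pi) ∩ bad)
  let F : Matrix (Fin n) (Fin n) ℂ × (Fin n → ℝ) →
      Matrix (Fin n) (Fin n) ℂ × Matrix (Fin n) (Fin n) ℂ :=
    fun p => (p.1 * p.1ᵀ, (p.1 * phaseMatrix p.2) * (p.1 * phaseMatrix p.2)ᵀ)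
  have hbad : IsClosed bad := by
    have h1 : bad = (⋃ k, {φ | φ k = 0 ∨ φ k = Real.pi}) ∪
        ({φ | 1 ≤ |∑ k, φ k - Real.pi|} ∩ {φ | 1 ≤ |∑ k, φ k - (n - 1 : ℝ) * Real.pi|}) := by
      ext φ
      simp [bad]
    rw [h1]
    refine IsClosed.union (isClosed_iUnion_of_finite fun k => ?_) (IsClosed.inter ?_ ?_)
    · exact (isClosed_eq (continuous_apply k) continuous_const).union
        (isClosed_eq (continuous_apply k) continuous_const)
    · exact isClosed_le continuous_const (by fun_prop)
    · exact isClosed_le continuous_const (by fun_prop)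
  have hC : IsCompact C := isCompact_specialUnitaryGroup.prod
    ((isCompact_univ_pi fun _ => isCompact_Icc).inter_right hbad)
  have hF : Continuous F := by
    have hv : Continuous fun p : Matrix (Fin n) (Fin n) ℂ × (Fin n → ℝ) =>
        p.1 * phaseMatrix p.2 :=
      continuous_fst.matrix_mul (continuous_phaseMatrix.comp continuous_snd)
    exact (continuous_fst.matrix_mul continuous_fst.matrix_transpose).prodMk
      (hv.matrix_mul hv.matrix_transpose)
  have hclosed : IsClosed (F '' C) := (hC.image hF).isClosed
  have hT : Continuous fun q : SLagPlane n × SLagPlane n =>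
      (q.1.1.symMatrix, q.2.1.symMatrix) := by
    have h1 : Continuous fun η : SLagPlane n => η.1.symMatrix :=
      OrientedPlane.continuous_symMatrix.comp continuous_subtype_val
    exact (h1.comp continuous_fst).prodMk (h1.comp continuous_snd)
  convert (hclosed.preimage hT).isOpen_compl using 1
  ext ⟨η, ξ⟩
  simp only [Set.mem_ofPred_eq, Set.mem_compl_iff, Set.mem_preimage]
  have hpi := Real.pi_pos
  constructor
  · rintro ⟨ht, hac⟩ ⟨⟨u, φ⟩, ⟨hu, hφ, hb⟩, hFe⟩
    obtain ⟨hl, hr⟩ := Prod.mk.inj hFe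
    have hφ' : ∀ k, 0 ≤ φ k ∧ φ k ≤ Real.pi := fun k => hφ k (Set.mem_univ k)
    obtain ⟨h1, h2⟩ := NormalForm.sum_eq_of_angleCriterion hn ⟨hu, hl.symm, hr.symm⟩ hφ' ht hac
    rcases hb with ⟨k, hk | hk⟩ | ⟨hb1, hb2⟩
    · linarith [(h1 k).1]
    · linarith [(h1 k).2]
    · simp only at hb1 hb2
      rcases h2 with h2 | h2
      · rw [h2, sub_self, abs_zero] at hb1
        linarith
      · rw [h2, sub_self, abs_zero] at hb2
        linarith
  · intro hnot
    obtain ⟨u, φ, h, hφ⟩ := exists_normalForm hn η ξ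
    have hnb : φ ∉ bad := fun hb => hnot ⟨(u, φ), ⟨h.mem,
      fun k _ => ⟨(hφ k).1, (hφ k).2.le⟩, hb⟩, Prod.ext h.left.symm h.right.symm⟩
    simp only [bad, Set.mem_ofPred_eq, not_or, not_exists, not_and, not_le] at hnb
    obtain ⟨hk, hsum⟩ := hnb
    rw [transverse_and_angleCriterion_iff hn]
    refine h.lawlorPair hn (fun k => ⟨(hφ k).1.lt_of_ne (Ne.symm (hk k).1), (hφ k).2⟩) ?_
    obtain ⟨m, hm⟩ := h.exists_sum_eq
    have key : ∀ l : ℤ, |∑ k, φ k - l * Real.pi| < 1 → ∑ k, φ k = l * Real.pi := by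
      intro l hl
      rw [hm] at hl ⊢
      have : m = l := by
        rw [← sub_mul, abs_mul, abs_of_pos hpi] at hl
        have h3 : |((m - l : ℤ) : ℝ)| < 1 := by
          push_cast
          nlinarith [abs_nonneg ((m : ℝ) - l), Real.pi_gt_three]
        rw [← Int.cast_abs] at h3
        have h4 : |m - l| < 1 := by exact_mod_cast h3
        have := Int.abs_lt_one_iff.1 h4
        omega
      rw [this]
    by_cases h1 : 1 ≤ |∑ k, φ k - Real.pi|
    · right
      have := key (n - 1) (by push_cast; exact hsum h1)
      push_cast at this
      exact this
    · left
      have := key 1 (by push_cast; rw [one_mul]; exact not_le.1 h1)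
      simpa using this

end

section

open MeasureTheory Filter Topology

/-! ### The polynomial and the integrand -/

theorem continuous_lawlorPoly {n : ℕ} :
    Continuous fun q : (Fin n → ℝ) × ℝ => lawlorPoly q.1 q.2 := by
  unfold lawlorPoly
  fun_prop

theorem contDiff_lawlorPoly {n : ℕ} (a : Fin n → ℝ) : ContDiff ℝ ∞ (lawlorPoly a) := by
  unfold lawlorPoly
  fun_prop

theorem lawlorPoly_term_nonneg {n : ℕ} {a : Fin n → ℝ} (ha : ∀ k, 0 < a k) (x : ℝ)
    (S : Finset (Fin n)) : 0 ≤ (∏ k ∈ S, a k) * x ^ (2 * (S.card - 1)) := by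
  rw [pow_mul]
  exact mul_nonneg (Finset.prod_nonneg fun k _ => (ha k).le) (pow_nonneg (sq_nonneg x) _)

theorem term_le_lawlorPoly {n : ℕ} {a : Fin n → ℝ} (ha : ∀ k, 0 < a k) (x : ℝ)
    {S : Finset (Fin n)} (hS : S ≠ ∅) :
    (∏ k ∈ S, a k) * x ^ (2 * (S.card - 1)) ≤ lawlorPoly a x :=
  Finset.single_le_sum (f := fun S : Finset (Fin n) => (∏ k ∈ S, a k) * x ^ (2 * (S.card - 1)))
    (fun S _ => lawlorPoly_term_nonneg ha x S) (Finset.mem_erase.2 ⟨hS, Finset.mem_univ S⟩)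

theorem le_lawlorPoly {n : ℕ} {a : Fin n → ℝ} (ha : ∀ k, 0 < a k) (x : ℝ) (j : Fin n) :
    a j ≤ lawlorPoly a x := by
  simpa using term_le_lawlorPoly ha x (Finset.singleton_ne_empty j)

/-- The term of a two-element subset. This quadratic growth of `p`, available only for `n ≥ 2`, is
what makes the phases decay fast enough for the asymptotics. -/
theorem mul_mul_sq_le_lawlorPoly {n : ℕ} {a : Fin n → ℝ} (ha : ∀ k, 0 < a k) (x : ℝ)
    {i j : Fin n} (hij : i ≠ j) : a i * a j * x ^ 2 ≤ lawlorPoly a x := by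
  have := term_le_lawlorPoly ha x (S := {i, j}) (by simp)
  rwa [Finset.prod_pair hij, Finset.card_pair hij] at this

theorem lawlorPoly_neg {n : ℕ} (a : Fin n → ℝ) (x : ℝ) : lawlorPoly a (-x) = lawlorPoly a x := by
  unfold lawlorPoly
  simp only [pow_mul, neg_sq]

theorem lawlorPoly_mono {n : ℕ} {a b : Fin n → ℝ} (ha : ∀ k, 0 < a k) (hab : ∀ k, a k ≤ b k)
    (x : ℝ) : lawlorPoly a x ≤ lawlorPoly b x := by
  refine Finset.sum_le_sum fun S _ => mul_le_mul_of_nonneg_right ?_ ?_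
  · exact Finset.prod_le_prod (fun k _ => (ha k).le) fun k _ => hab k
  · rw [pow_mul]
    exact pow_nonneg (sq_nonneg x) _

theorem lawlorPoly_pos {n : ℕ} {a : Fin n → ℝ} (ha : ∀ k, 0 < a k) (k : Fin n) (x : ℝ) :
    0 < lawlorPoly a x := (ha k).trans_le (le_lawlorPoly ha x k)

theorem one_add_mul_sq_pos {c : ℝ} (hc : 0 < c) (x : ℝ) : 0 < 1 + c * x ^ 2 := by positivity

theorem lawlorIntegrand_pos {n : ℕ} {a : Fin n → ℝ} (ha : ∀ k, 0 < a k) (k : Fin n) (x : ℝ) :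
    0 < lawlorIntegrand a k x :=
  div_pos (ha k) (mul_pos (one_add_mul_sq_pos (ha k) x) (Real.sqrt_pos.2 (lawlorPoly_pos ha k x)))

theorem lawlorIntegrand_neg {n : ℕ} (a : Fin n → ℝ) (k : Fin n) (x : ℝ) :
    lawlorIntegrand a k (-x) = lawlorIntegrand a k x := by
  rw [lawlorIntegrand, lawlorIntegrand, lawlorPoly_neg, neg_sq]

theorem contDiff_lawlorIntegrand {n : ℕ} {a : Fin n → ℝ} (ha : ∀ k, 0 < a k) (k : Fin n) :
    ContDiff ℝ ∞ (lawlorIntegrand a k) := by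
  unfold lawlorIntegrand
  refine contDiff_const.div (ContDiff.mul (by fun_prop)
    ((contDiff_lawlorPoly a).sqrt fun x => (lawlorPoly_pos ha k x).ne')) fun x => ?_
  exact (mul_pos (one_add_mul_sq_pos (ha k) x) (Real.sqrt_pos.2 (lawlorPoly_pos ha k x))).ne'

theorem continuous_lawlorIntegrand {n : ℕ} {a : Fin n → ℝ} (ha : ∀ k, 0 < a k) (k : Fin n) :
    Continuous (lawlorIntegrand a k) := (contDiff_lawlorIntegrand ha k).continuous

theorem div_one_add_mul_sq_eq {c : ℝ} (hc : 0 < c) (x : ℝ) :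
    c / (1 + c * x ^ 2) = c * (1 + (Real.sqrt c * x) ^ 2)⁻¹ := by
  rw [mul_pow, Real.sq_sqrt hc.le, div_eq_mul_inv]

theorem integrable_div_one_add_mul_sq {c : ℝ} (hc : 0 < c) :
    Integrable fun x : ℝ => c / (1 + c * x ^ 2) := by
  simp only [div_one_add_mul_sq_eq hc]
  exact (integrable_inv_one_add_sq.comp_mul_left' (Real.sqrt_pos.2 hc).ne').const_mul c

theorem integral_div_one_add_mul_sq {c : ℝ} (hc : 0 < c) :
    ∫ x : ℝ, c / (1 + c * x ^ 2) = Real.sqrt c * Real.pi := by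
  have hs := Real.sqrt_pos.2 hc
  simp only [div_one_add_mul_sq_eq hc]
  rw [integral_const_mul, Measure.integral_comp_mul_left (fun x : ℝ => (1 + x ^ 2)⁻¹),
    integral_univ_inv_one_add_sq, abs_of_pos (inv_pos.2 hs), smul_eq_mul]
  nth_rewrite 1 [← Real.mul_self_sqrt hc.le]
  field_simp

theorem lawlorIntegrand_le {n : ℕ} {a : Fin n → ℝ} (ha : ∀ k, 0 < a k) (j k : Fin n) (x : ℝ) :
    lawlorIntegrand a k x ≤ (Real.sqrt (a j))⁻¹ * (a k / (1 + a k * x ^ 2)) := by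
  have hs := Real.sqrt_pos.2 (ha j)
  have h1 := one_add_mul_sq_pos (ha k) x
  rw [lawlorIntegrand, ← div_div, inv_mul_eq_div]
  exact div_le_div_of_nonneg_left (div_pos (ha k) h1).le hs
    (Real.sqrt_le_sqrt (le_lawlorPoly ha x j))

theorem integrable_lawlorIntegrand {n : ℕ} {a : Fin n → ℝ} (ha : ∀ k, 0 < a k) (k : Fin n) :
    Integrable (lawlorIntegrand a k) := by
  refine ((integrable_div_one_add_mul_sq (ha k)).const_mul (Real.sqrt (a k))⁻¹).mono'
    (continuous_lawlorIntegrand ha k).aestronglyMeasurable (ae_of_all _ fun x => ?_)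
  rw [Real.norm_of_nonneg (lawlorIntegrand_pos ha k x).le]
  exact lawlorIntegrand_le ha k k x

/-! ### The total angles -/

/-- Replacing `p` by its lower bound `a j` leaves an arctangent integral. The resulting bound `π √(a
k / a j)` provides the a priori estimates in `exists_lawlorAngle_eq`. -/
theorem lawlorAngle_le {n : ℕ} {a : Fin n → ℝ} (ha : ∀ k, 0 < a k) (j k : Fin n) :
    lawlorAngle a k ≤ (Real.sqrt (a j))⁻¹ * (Real.sqrt (a k) * Real.pi) := by
  rw [← integral_div_one_add_mul_sq (ha k), ← integral_const_mul]
  exact integral_mono (integrable_lawlorIntegrand ha k)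
    ((integrable_div_one_add_mul_sq (ha k)).const_mul _) (lawlorIntegrand_le ha j k)

/-- With `a k` fixed, the other parameters enter the integrand only through `√p` in the denominator,
and `p` increases with them. -/
theorem lawlorAngle_anti {n : ℕ} {a b : Fin n → ℝ} (ha : ∀ k, 0 < a k) (hab : ∀ k, a k ≤ b k)
    {k : Fin n} (hk : a k = b k) : lawlorAngle b k ≤ lawlorAngle a k := by
  have hb : ∀ k, 0 < b k := fun k => (ha k).trans_le (hab k)
  refine integral_mono (integrable_lawlorIntegrand hb k) (integrable_lawlorIntegrand ha k)
    fun x => ?_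
  simp only [lawlorIntegrand]
  rw [← hk]
  have h1 := one_add_mul_sq_pos (ha k) x
  exact div_le_div_of_nonneg_left (ha k).le
    (mul_pos h1 (Real.sqrt_pos.2 (lawlorPoly_pos ha k x)))
    (mul_le_mul_of_nonneg_left (Real.sqrt_le_sqrt (lawlorPoly_mono ha hab x)) h1.le)

theorem continuousOn_lawlorAngle {n : ℕ} {ε M : ℝ} (hε : 0 < ε) (k : Fin n) :
    ContinuousOn (fun a : Fin n → ℝ => lawlorAngle a k) (Set.univ.pi fun _ => Set.Icc ε M) := by
  have hpos : ∀ a ∈ (Set.univ.pi fun _ => Set.Icc ε M : Set (Fin n → ℝ)), ∀ k, 0 < a k :=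
    fun a ha k => hε.trans_le (ha k (Set.mem_univ k)).1
  refine continuousOn_of_dominated
    (bound := fun x => (M / ε * (Real.sqrt ε)⁻¹) * (ε / (1 + ε * x ^ 2))) (fun a ha =>
      (continuous_lawlorIntegrand (hpos a ha) k).aestronglyMeasurable) (fun a ha =>
      ae_of_all _ fun x => ?_) ((integrable_div_one_add_mul_sq hε).const_mul _)
      (ae_of_all _ fun x => ?_)
  · have hk := ha k (Set.mem_univ k)
    have h1 := one_add_mul_sq_pos hε x
    have h2 : 1 + ε * x ^ 2 ≤ 1 + a k * x ^ 2 := by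
      have := mul_le_mul_of_nonneg_right hk.1 (sq_nonneg x)
      linarith
    have hsε := Real.sqrt_pos.2 hε
    have h3 : Real.sqrt ε ≤ Real.sqrt (lawlorPoly a x) :=
      Real.sqrt_le_sqrt (hk.1.trans (le_lawlorPoly (hpos a ha) x k))
    rw [Real.norm_of_nonneg (lawlorIntegrand_pos (hpos a ha) k x).le, lawlorIntegrand]
    calc a k / ((1 + a k * x ^ 2) * Real.sqrt (lawlorPoly a x))
        ≤ M / ((1 + ε * x ^ 2) * Real.sqrt ε) :=
          div_le_div₀ (hε.le.trans (hk.1.trans hk.2)) hk.2 (mul_pos h1 hsε)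
            (mul_le_mul h2 h3 hsε.le (h1.le.trans h2))
      _ = _ := by field_simp
  · unfold lawlorIntegrand
    refine ContinuousOn.div (continuous_apply k).continuousOn ?_ fun a ha => ?_
    · have h1 : Continuous fun a : Fin n → ℝ => lawlorPoly a x :=
        continuous_lawlorPoly.comp (continuous_id.prodMk continuous_const)
      exact (Continuous.mul (by fun_prop) h1.sqrt).continuousOn
    · exact (mul_pos (one_add_mul_sq_pos (hpos a ha k) x)
        (Real.sqrt_pos.2 (lawlorPoly_pos (hpos a ha) k x))).ne'

theorem hasDerivAt_prod_one_add_mul_sq {n : ℕ} {a : Fin n → ℝ} (ha : ∀ k, 0 < a k) (x : ℝ) :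
    HasDerivAt (fun y => ∏ k, (1 + a k * y ^ 2))
      ((∏ k, (1 + a k * x ^ 2)) * ∑ k, 2 * x * (a k / (1 + a k * x ^ 2))) x := by
  have h1 : ∀ k ∈ Finset.univ, HasDerivAt (fun y => 1 + a k * y ^ 2) (a k * (2 * x)) x :=
    fun k _ => by simpa using ((hasDerivAt_pow 2 x).const_mul (a k)).const_add 1
  refine (HasDerivAt.fun_finsetProd h1).congr_deriv ?_
  rw [Finset.mul_sum]
  refine Finset.sum_congr rfl fun k _ => ?_
  rw [← Finset.mul_prod_erase _ _ (Finset.mem_univ k), smul_eq_mul]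
  have h2 := (one_add_mul_sq_pos (ha k) x).ne'
  generalize ∏ i ∈ Finset.univ.erase k, (1 + a i * x ^ 2) = P
  generalize 1 + a k * x ^ 2 = q at h2
  field_simp

/-- The sum of the integrands has the antiderivative `arctan (x √p(x))`. On `x > 0` this is `arctan
√(G - 1)` with `G = ∏ (1 + a k x²)`, and the logarithmic derivative of `G` produces the sum. The
half-line contributes `π/2`, and evenness doubles it. -/
theorem sum_lawlorAngle {n : ℕ} (hn : 1 ≤ n) {a : Fin n → ℝ} (ha : ∀ k, 0 < a k) :
    ∑ k, lawlorAngle a k = Real.pi := by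
  have hint : Integrable fun x => ∑ k, lawlorIntegrand a k x :=
    integrable_finsetSum _ fun k _ => integrable_lawlorIntegrand ha k
  have h1 : ∑ k, lawlorAngle a k = ∫ x, ∑ k, lawlorIntegrand a k |x| := by
    have habs : ∀ k x, lawlorIntegrand a k |x| = lawlorIntegrand a k x := fun k x => by
      rcases abs_choice x with h | h <;> rw [h]
      exact lawlorIntegrand_neg a k x
    simp only [habs]
    rw [integral_finsetSum _ fun k _ => integrable_lawlorIntegrand ha k]
    rfl
  rw [h1, integral_comp_abs (f := fun x => ∑ k, lawlorIntegrand a k x)]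
  let i₀ : Fin n := ⟨0, hn⟩
  let f : ℝ → ℝ := fun x => Real.arctan (x * Real.sqrt (lawlorPoly a x))
  have hcont : Continuous f := by
    have := (contDiff_lawlorPoly a).continuous
    fun_prop
  have hderiv : ∀ x ∈ Set.Ioi (0 : ℝ), HasDerivAt f (∑ k, lawlorIntegrand a k x) x := by
    intro x hx
    have hx' : (0 : ℝ) < x := hx
    have hp := lawlorPoly_pos ha i₀ x
    have hsp := Real.sqrt_pos.2 hp
    have heq : f =ᶠ[𝓝 x] fun y => Real.arctan (Real.sqrt ((∏ k, (1 + a k * y ^ 2)) - 1)) := by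
      filter_upwards [Ioi_mem_nhds hx'] with y hy
      have hy' : (0 : ℝ) < y := hy
      simp only [f]
      rw [← one_add_sq_mul_lawlorPoly, add_sub_cancel_left, Real.sqrt_mul (sq_nonneg y),
        Real.sqrt_sq hy'.le]
    refine HasDerivAt.congr_of_eventuallyEq ?_ heq
    have hG := one_add_sq_mul_lawlorPoly a x
    have hG1 : (∏ k, (1 + a k * x ^ 2)) - 1 = x ^ 2 * lawlorPoly a x := by rw [← hG]; ring
    have hne : (∏ k, (1 + a k * x ^ 2)) - 1 ≠ 0 := by
      rw [hG1]; positivity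
    refine (((hasDerivAt_prod_one_add_mul_sq ha x).sub_const 1).sqrt hne).arctan.congr_deriv ?_
    have hprod : 0 < ∏ k, (1 + a k * x ^ 2) :=
      Finset.prod_pos fun k _ => one_add_mul_sq_pos (ha k) x
    rw [Real.sq_sqrt (by rw [hG1]; positivity), add_sub_cancel, hG1, Real.sqrt_mul (sq_nonneg x),
      Real.sqrt_sq hx'.le, ← Finset.mul_sum]
    have : ∑ k, lawlorIntegrand a k x
        = (∑ k, a k / (1 + a k * x ^ 2)) / Real.sqrt (lawlorPoly a x) := by
      rw [Finset.sum_div]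
      exact Finset.sum_congr rfl fun k _ => by rw [lawlorIntegrand, div_div]
    rw [this]
    generalize ∑ k, a k / (1 + a k * x ^ 2) = s
    generalize ∏ k, (1 + a k * x ^ 2) = P at hprod
    field_simp
  have htop : Tendsto f atTop (𝓝 (Real.pi / 2)) := by
    refine (Real.tendsto_arctan_atTop.mono_right nhdsWithin_le_nhds).comp ?_
    refine tendsto_atTop_mono' atTop ?_
      (tendsto_id.atTop_mul_const (Real.sqrt_pos.2 (ha i₀)))
    filter_upwards [eventually_ge_atTop 0] with x hx
    exact mul_le_mul_of_nonneg_left (Real.sqrt_le_sqrt (le_lawlorPoly ha x i₀)) hx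
  rw [integral_Ioi_of_hasDerivAt_of_tendsto hcont.continuousWithinAt hderiv
    hint.integrableOn htop]
  simp [f]
  ring

/-- Normalize one parameter to `1` and maximize `∑ a k` subject to `lawlorAngle a k ≤ τ k` for the
other indices. If an inequality were strict at the maximum, raising that parameter slightly would
preserve it by continuity and would not increase the other constrained angles by `lawlorAngle_anti`,
contradicting maximality. The last angle is right because both sums are `π`. -/
theorem exists_lawlorAngle_eq {n : ℕ} (hn : 1 ≤ n) {τ : Fin n → ℝ} (hτ : ∀ k, 0 < τ k)
    (hs : ∑ k, τ k = Real.pi) : ∃ a : Fin n → ℝ, (∀ k, 0 < a k) ∧ ∀ k, lawlorAngle a k = τ k := by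
  have hpi := Real.pi_pos
  let i₀ : Fin n := ⟨0, hn⟩
  have : Nonempty (Fin n) := ⟨i₀⟩
  obtain ⟨k₁, hk₁⟩ := Finite.exists_min τ
  -- Small enough that parameters `ε`, next to the normalized `1`, give angles at most `√ε π ≤ τ k`;
  -- hence the constraint set is nonempty.
  set ε := min 1 ((τ k₁ / Real.pi) ^ 2) with hεdef
  have hε : 0 < ε := lt_min one_pos (pow_pos (div_pos (hτ k₁) hpi) 2)
  have hε1 : ε ≤ 1 := min_le_left _ _
  have hsε : ∀ k, Real.sqrt ε * Real.pi ≤ τ k := fun k => by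
    have h1 : Real.sqrt ε ≤ τ k₁ / Real.pi := by
      rw [← Real.sqrt_sq (div_pos (hτ k₁) hpi).le]
      exact Real.sqrt_le_sqrt (min_le_right _ _)
    exact ((le_div_iff₀ hpi).1 h1).trans (hk₁ k)
  -- Chosen so that the upper wall of the box is never reached: the constraints force the angle at
  -- `i₀` to be at least `τ i₀`, and it is at most `π / √(a k)`.
  set M := (Real.pi / τ i₀) ^ 2 + 1 with hM
  have hM1 : 1 ≤ M := by
    have := sq_nonneg (Real.pi / τ i₀)
    linarith
  let B : Set (Fin n → ℝ) := Set.univ.pi fun _ => Set.Icc ε M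
  have hBpos : ∀ a ∈ B, ∀ k, 0 < a k := fun a ha k => hε.trans_le (ha k (Set.mem_univ k)).1
  have hBcont : ∀ k, ContinuousOn (fun a => lawlorAngle a k) B := continuousOn_lawlorAngle hε
  have hBc : IsCompact B := isCompact_univ_pi fun _ => isCompact_Icc
  let K : Set (Fin n → ℝ) := {a ∈ B | a i₀ = 1 ∧ ∀ k, k ≠ i₀ → lawlorAngle a k ≤ τ k}
  have hKc : IsCompact K := by
    refine hBc.of_isClosed_subset ?_ fun a ha => ha.1
    have h1 : K = (B ∩ {a | a i₀ = 1}) ∩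
        ⋂ k : {k // k ≠ i₀}, B ∩ {a | lawlorAngle a k ≤ τ k} := by
      ext a
      simp only [K, Set.mem_ofPred_eq, Set.mem_inter_iff, Set.mem_iInter, Subtype.forall]
      constructor
      · rintro ⟨h1, h2, h3⟩
        exact ⟨⟨h1, h2⟩, fun k hk => ⟨h1, h3 k hk⟩⟩
      · rintro ⟨⟨h1, h2⟩, h3⟩
        exact ⟨h1, h2, fun k hk => (h3 k hk).2⟩
    rw [h1]
    refine (hBc.isClosed.inter (isClosed_eq (continuous_apply i₀) continuous_const)).inter
      (isClosed_iInter fun k => ?_)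
    exact (hBcont k).preimage_isClosed_of_isClosed hBc.isClosed isClosed_Iic
  have hKne : K.Nonempty := by
    refine ⟨Function.update (fun _ => ε) i₀ 1, ?_⟩
    have hB : Function.update (fun _ => ε) i₀ 1 ∈ B := by
      intro k _
      by_cases h : k = i₀
      · subst h; simpa using ⟨hε1, hM1⟩
      · simpa [h] using hε1.trans hM1
    refine ⟨hB, by simp, fun k hk => ?_⟩
    have := lawlorAngle_le (hBpos _ hB) i₀ k
    refine this.trans ?_
    simpa [hk] using hsε k
  obtain ⟨a, haK, hmax⟩ := hKc.exists_isMaxOn hKne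
    (f := fun a : Fin n → ℝ => ∑ k, a k) (Continuous.continuousOn (by fun_prop))
  obtain ⟨haB, ha1, hale⟩ := haK
  have hapos := hBpos a haB
  have hsum := sum_lawlorAngle hn hapos
  have hge0 : τ i₀ ≤ lawlorAngle a i₀ := by
    rw [← Finset.add_sum_erase _ _ (Finset.mem_univ i₀)] at hsum hs
    have : ∑ k ∈ Finset.univ.erase i₀, lawlorAngle a k ≤ ∑ k ∈ Finset.univ.erase i₀, τ k :=
      Finset.sum_le_sum fun k hk => hale k (Finset.ne_of_mem_erase hk)
    linarith
  have haM : ∀ k, a k < M := fun k => by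
    have h1 := hge0.trans (lawlorAngle_le hapos k i₀)
    rw [ha1, Real.sqrt_one, one_mul] at h1
    have hsk := Real.sqrt_pos.2 (hapos k)
    have h2 : Real.sqrt (a k) ≤ Real.pi / τ i₀ := by
      rw [le_div_iff₀ (hτ i₀)]
      calc Real.sqrt (a k) * τ i₀ ≤ Real.sqrt (a k) * ((Real.sqrt (a k))⁻¹ * Real.pi) :=
            mul_le_mul_of_nonneg_left h1 hsk.le
        _ = Real.pi := by field_simp
    have h3 : a k ≤ (Real.pi / τ i₀) ^ 2 := by
      rw [← Real.sq_sqrt (hapos k).le]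
      exact pow_le_pow_left₀ hsk.le h2 2
    linarith
  have heq : ∀ k, k ≠ i₀ → lawlorAngle a k = τ k := by
    intro k hk
    by_contra hne
    have hlt : lawlorAngle a k < τ k := (hale k hk).lt_of_ne hne
    have hupB : ∀ t ∈ Set.Icc (a k) M, Function.update a k t ∈ B := by
      intro t ht i _
      by_cases h : i = k
      · subst h
        simpa using ⟨(haB i (Set.mem_univ i)).1.trans ht.1, ht.2⟩
      · simpa [h] using haB i (Set.mem_univ i)
    have hc : ContinuousWithinAt (fun t => lawlorAngle (Function.update a k t) k)
        (Set.Icc (a k) M) (a k) := by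
      have h1 := (hBcont k) (Function.update a k (a k)) (by simpa using haB)
      exact h1.comp (continuous_const.update k continuous_id).continuousWithinAt hupB
    have hev : ∀ᶠ t in 𝓝[Set.Icc (a k) M] (a k), lawlorAngle (Function.update a k t) k < τ k := by
      apply hc.eventually_lt continuousWithinAt_const
      simpa using hlt
    rw [nhdsWithin_Icc_eq_nhdsGE (haM k)] at hev
    have hev' : ∀ᶠ t in 𝓝[>] (a k), lawlorAngle (Function.update a k t) k < τ k :=
      hev.filter_mono (nhdsWithin_mono _ Set.Ioi_subset_Ici_self)
    obtain ⟨t, ht1, ht2⟩ := (hev'.and (Ioc_mem_nhdsGT (haM k))).exists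
    have htB := hupB t ⟨ht2.1.le, ht2.2⟩
    have hle : ∀ i, a i ≤ Function.update a k t i := fun i => by
      by_cases h : i = k
      · subst h; simpa using ht2.1.le
      · simp [h]
    have htK : Function.update a k t ∈ K := by
      refine ⟨htB, by simp [hk.symm, ha1], fun i hi => ?_⟩
      by_cases h : i = k
      · subst h; exact ht1.le
      · exact (lawlorAngle_anti hapos hle (by simp [h])).trans (hale i hi)
    have h1 : ∑ i, Function.update a k t i ≤ ∑ i, a i := hmax htK
    have h2 : ∑ i, a i < ∑ i, Function.update a k t i :=
      Finset.sum_lt_sum (fun i _ => hle i) ⟨k, Finset.mem_univ k, by simpa using ht2.1⟩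
    linarith
  refine ⟨a, hapos, fun k => ?_⟩
  by_cases hk : k = i₀
  · subst hk
    rw [← Finset.add_sum_erase _ _ (Finset.mem_univ i₀)] at hsum hs
    have : ∑ k ∈ Finset.univ.erase i₀, lawlorAngle a k = ∑ k ∈ Finset.univ.erase i₀, τ k :=
      Finset.sum_congr rfl fun k hk => heq k (Finset.ne_of_mem_erase hk)
    linarith
  · exact heq k hk

end

section

open MeasureTheory Filter Topology

/-! ### The phases -/

theorem hasDerivAt_lawlorPhase {n : ℕ} {a : Fin n → ℝ} (ha : ∀ k, 0 < a k) (k : Fin n) (y : ℝ) :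
    HasDerivAt (lawlorPhase a k) (lawlorIntegrand a k y) y := by
  have hint := integrable_lawlorIntegrand ha k
  have hc := continuous_lawlorIntegrand ha k
  have h1 : lawlorPhase a k = fun y => lawlorPhase a k 0 + ∫ x in (0 : ℝ)..y, lawlorIntegrand a k x := by
    funext y
    rw [← intervalIntegral.integral_Iic_sub_Iic hint.integrableOn hint.integrableOn]
    simp [lawlorPhase]
  rw [h1]
  exact (hc.integral_hasStrictDerivAt 0 y).hasDerivAt.const_add _

theorem contDiff_lawlorPhase {n : ℕ} {a : Fin n → ℝ} (ha : ∀ k, 0 < a k) (k : Fin n) :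
    ContDiff ℝ ∞ (lawlorPhase a k) := by
  refine contDiff_infty_iff_deriv.2 ⟨fun y => (hasDerivAt_lawlorPhase ha k y).differentiableAt, ?_⟩
  rw [show deriv (lawlorPhase a k) = lawlorIntegrand a k from
    funext fun y => (hasDerivAt_lawlorPhase ha k y).deriv]
  exact contDiff_lawlorIntegrand ha k

theorem lawlorPhase_neg_add {n : ℕ} {a : Fin n → ℝ} (ha : ∀ k, 0 < a k) (k : Fin n) (y : ℝ) :
    lawlorPhase a k (-y) + lawlorPhase a k y = lawlorAngle a k := by
  have hint := integrable_lawlorIntegrand ha k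
  have h1 : lawlorPhase a k (-y) = ∫ x in Set.Ioi y, lawlorIntegrand a k x := by
    have := integral_comp_neg_Iic (-y) (lawlorIntegrand a k)
    simp only [lawlorIntegrand_neg, neg_neg] at this
    exact this
  rw [h1, lawlorPhase, lawlorAngle, add_comm]
  exact intervalIntegral.integral_Iic_add_Ioi hint.integrableOn hint.integrableOn

theorem lawlorPhase_strictMono {n : ℕ} {a : Fin n → ℝ} (ha : ∀ k, 0 < a k) (k : Fin n) :
    StrictMono (lawlorPhase a k) :=
  strictMono_of_deriv_pos fun y => by
    rw [(hasDerivAt_lawlorPhase ha k y).deriv]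
    exact lawlorIntegrand_pos ha k y

theorem lawlorPhase_pos {n : ℕ} {a : Fin n → ℝ} (ha : ∀ k, 0 < a k) (k : Fin n) (y : ℝ) :
    0 < lawlorPhase a k y := by
  refine lt_of_le_of_lt ?_ (lawlorPhase_strictMono ha k (sub_one_lt y))
  exact setIntegral_nonneg measurableSet_Iic fun x _ => (lawlorIntegrand_pos ha k x).le

theorem tendsto_integral_Iic_atBot {g : ℝ → ℝ} (hg : Integrable g) :
    Tendsto (fun y => ∫ x in Set.Iic y, g x) atBot (𝓝 0) := by
  have h1 := intervalIntegral_tendsto_integral_Iic 0 hg.integrableOn (tendsto_id (α := ℝ) (x := atBot))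
  have h2 : (fun y => ∫ x in Set.Iic y, g x)
      = fun y => (∫ x in Set.Iic 0, g x) - ∫ x in y..0, g x := by
    funext y
    rw [← intervalIntegral.integral_Iic_sub_Iic hg.integrableOn hg.integrableOn, sub_sub_cancel]
  rw [h2]
  simpa using h1.const_sub (∫ x in Set.Iic 0, g x)

theorem abs_mul_lawlorIntegrand_le {n : ℕ} {a : Fin n → ℝ} (ha : ∀ k, 0 < a k) {i j : Fin n}
    (hij : i ≠ j) (k : Fin n) (x : ℝ) :
    |x| * lawlorIntegrand a k x ≤ (Real.sqrt (a i * a j))⁻¹ * (a k / (1 + a k * x ^ 2)) := by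
  have hs := Real.sqrt_pos.2 (mul_pos (ha i) (ha j))
  have hp := Real.sqrt_pos.2 (lawlorPoly_pos ha k x)
  have h1 := one_add_mul_sq_pos (ha k) x
  have h2 : Real.sqrt (a i * a j) * |x| ≤ Real.sqrt (lawlorPoly a x) := by
    rw [← Real.sqrt_sq_eq_abs, ← Real.sqrt_mul (mul_pos (ha i) (ha j)).le]
    exact Real.sqrt_le_sqrt (mul_mul_sq_le_lawlorPoly ha x hij)
  have h3 : |x| / Real.sqrt (lawlorPoly a x) ≤ (Real.sqrt (a i * a j))⁻¹ := by
    rw [div_le_iff₀ hp, inv_mul_eq_div, le_div_iff₀ hs, mul_comm]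
    exact h2
  calc |x| * lawlorIntegrand a k x
      = |x| / Real.sqrt (lawlorPoly a x) * (a k / (1 + a k * x ^ 2)) := by
        rw [lawlorIntegrand]; field_simp
    _ ≤ _ := mul_le_mul_of_nonneg_right h3 (div_pos (ha k) h1).le

theorem integrable_abs_mul_lawlorIntegrand {n : ℕ} [Nontrivial (Fin n)] {a : Fin n → ℝ}
    (ha : ∀ k, 0 < a k) (k : Fin n) : Integrable fun x => |x| * lawlorIntegrand a k x := by
  obtain ⟨i, j, hij⟩ := exists_pair_ne (Fin n)
  refine ((integrable_div_one_add_mul_sq (ha k)).const_mul (Real.sqrt (a i * a j))⁻¹).mono'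
    (continuous_abs.mul (continuous_lawlorIntegrand ha k)).aestronglyMeasurable
    (ae_of_all _ fun x => ?_)
  rw [Real.norm_of_nonneg (mul_nonneg (abs_nonneg x) (lawlorIntegrand_pos ha k x).le)]
  exact abs_mul_lawlorIntegrand_le ha hij k x

/-- On `(-∞, -r]` one has `r ≤ |x|`, so the quantity is at most the tail of the integrable function
`|x| * lawlorIntegrand a k x`. -/
theorem tendsto_mul_lawlorPhase_neg {n : ℕ} [Nontrivial (Fin n)] {a : Fin n → ℝ}
    (ha : ∀ k, 0 < a k) (k : Fin n) :
    Tendsto (fun r => r * lawlorPhase a k (-r)) atTop (𝓝 0) := by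
  have h1 := (tendsto_integral_Iic_atBot (integrable_abs_mul_lawlorIntegrand ha k)).comp
    tendsto_neg_atTop_atBot
  refine squeeze_zero' ?_ ?_ h1
  · filter_upwards [eventually_ge_atTop 0] with r hr
    exact mul_nonneg hr (lawlorPhase_pos ha k _).le
  · filter_upwards [eventually_ge_atTop 0] with r hr
    rw [lawlorPhase, ← integral_const_mul]
    refine setIntegral_mono_on ((integrable_lawlorIntegrand ha k).const_mul r).integrableOn
      (integrable_abs_mul_lawlorIntegrand ha k).integrableOn measurableSet_Iic fun x hx => ?_
    have hx' : x ≤ -r := hx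
    exact mul_le_mul_of_nonneg_right (by rw [abs_of_nonpos (by linarith)]; linarith)
      (lawlorIntegrand_pos ha k x).le

theorem tendsto_mul_lawlorIntegrand {n : ℕ} {a : Fin n → ℝ} (ha : ∀ k, 0 < a k) (k : Fin n) :
    Tendsto (fun r => r * lawlorIntegrand a k r) atTop (𝓝 0) := by
  have h1 : Tendsto (fun r : ℝ => (Real.sqrt (a k))⁻¹ * r⁻¹) atTop (𝓝 0) := by
    simpa using tendsto_inv_atTop_zero.const_mul (Real.sqrt (a k))⁻¹
  refine squeeze_zero' ?_ ?_ h1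
  · filter_upwards [eventually_ge_atTop 0] with r hr
    exact mul_nonneg hr (lawlorIntegrand_pos ha k _).le
  · filter_upwards [eventually_gt_atTop 0] with r hr
    have h2 := lawlorIntegrand_le ha k k r
    have hs := Real.sqrt_pos.2 (ha k)
    have h3 : a k / (1 + a k * r ^ 2) ≤ 1 / r ^ 2 := by
      rw [div_le_div_iff₀ (one_add_mul_sq_pos (ha k) r) (by positivity)]
      linarith
    calc r * lawlorIntegrand a k r
        ≤ r * ((Real.sqrt (a k))⁻¹ * (1 / r ^ 2)) :=
          mul_le_mul_of_nonneg_left (h2.trans (mul_le_mul_of_nonneg_left h3 (inv_pos.2 hs).le)) hr.le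
      _ = _ := by field_simp

/-! ### The profile curve -/

theorem one_div_add_sq_pos {c : ℝ} (hc : 0 < c) (y : ℝ) : 0 < 1 / c + y ^ 2 := by positivity

theorem contDiff_lawlorCurve {n : ℕ} {a : Fin n → ℝ} (ha : ∀ k, 0 < a k) (k : Fin n) :
    ContDiff ℝ ∞ (lawlorCurve a k) := by
  unfold lawlorCurve
  have h1 : ContDiff ℝ ∞ fun y : ℝ => Real.sqrt (1 / a k + y ^ 2) :=
    ContDiff.sqrt (by fun_prop) fun y => (one_div_add_sq_pos (ha k) y).ne'
  refine ContDiff.mul (Complex.ofRealCLM.contDiff.comp h1) ?_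
  exact ((((Complex.ofRealCLM.contDiff.comp (contDiff_lawlorPhase ha k)).neg).mul
    contDiff_const)).cexp

theorem norm_lawlorCurve {n : ℕ} (a : Fin n → ℝ) (k : Fin n) (y : ℝ) :
    ‖lawlorCurve a k y‖ = Real.sqrt (1 / a k + y ^ 2) := by
  rw [lawlorCurve, norm_mul, show -(lawlorPhase a k y : ℂ) * Complex.I
    = ((-lawlorPhase a k y : ℝ) : ℂ) * Complex.I by push_cast; ring,
    Complex.norm_exp_ofReal_mul_I, mul_one, Complex.norm_real,
    Real.norm_of_nonneg (Real.sqrt_nonneg _)]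

/-- The integrand is even, so the phases at `y` and `-y` add up to the total angle. Through this
symmetry the asymptotics at `+∞` follow from those at `-∞`. -/
theorem lawlorCurve_eq_conj {n : ℕ} {a : Fin n → ℝ} (ha : ∀ k, 0 < a k) (k : Fin n) (y : ℝ) :
    lawlorCurve a k y = Complex.exp (-(lawlorAngle a k : ℂ) * Complex.I)
      * (starRingEnd ℂ) (lawlorCurve a k (-y)) := by
  rw [lawlorCurve, lawlorCurve, map_mul, Complex.conj_ofReal, ← Complex.exp_conj, neg_sq,
    mul_left_comm, ← Complex.exp_add, ← lawlorPhase_neg_add ha k y]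
  congr 2
  simp
  ring

theorem tendsto_sqrt_add_sq_sub {c : ℝ} (hc : 0 < c) :
    Tendsto (fun r => Real.sqrt (c + r ^ 2) - r) atTop (𝓝 0) := by
  have h1 : Tendsto (fun r : ℝ => c * r⁻¹) atTop (𝓝 0) := by
    simpa using tendsto_inv_atTop_zero.const_mul c
  refine squeeze_zero' ?_ ?_ h1
  · filter_upwards [eventually_ge_atTop 0] with r hr
    rw [sub_nonneg]
    exact Real.le_sqrt_of_sq_le (by linarith)
  · filter_upwards [eventually_gt_atTop 0] with r hr
    have h2 : 0 ≤ c * r⁻¹ := by positivity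
    -- Squaring `r + c/r` already gives `r² + 2c` plus a square.
    rw [sub_le_iff_le_add, Real.sqrt_le_left (by linarith)]
    have : c * r⁻¹ * r = c := by field_simp
    nlinarith [sq_nonneg (c * r⁻¹)]

theorem tendsto_exp_lawlorPhase_neg {n : ℕ} [Nontrivial (Fin n)] {a : Fin n → ℝ}
    (ha : ∀ k, 0 < a k) (k : Fin n) :
    Tendsto (fun r : ℝ => (r : ℂ) * (Complex.exp (-(lawlorPhase a k (-r) : ℂ) * Complex.I) - 1))
      atTop (𝓝 0) := by
  rw [tendsto_zero_iff_norm_tendsto_zero]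
  refine squeeze_zero' (Eventually.of_forall fun r => norm_nonneg _) ?_
    (tendsto_mul_lawlorPhase_neg ha k)
  filter_upwards [eventually_ge_atTop 0] with r hr
  rw [norm_mul, Complex.norm_real, Real.norm_of_nonneg hr]
  refine mul_le_mul_of_nonneg_left ?_ hr
  have := Real.norm_exp_I_mul_ofReal_sub_one_le (x := -lawlorPhase a k (-r))
  rw [norm_neg, Real.norm_of_nonneg (lawlorPhase_pos ha k _).le] at this
  refine le_trans (le_of_eq ?_) this
  congr 3
  push_cast
  ring

theorem tendsto_exp_lawlorPhase_neg' {n : ℕ} [Nontrivial (Fin n)] {a : Fin n → ℝ}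
    (ha : ∀ k, 0 < a k) (k : Fin n) :
    Tendsto (fun r : ℝ => Complex.exp (-(lawlorPhase a k (-r) : ℂ) * Complex.I))
      atTop (𝓝 1) := by
  have h1 : Tendsto (fun r : ℝ => ((r⁻¹ : ℝ) : ℂ)) atTop (𝓝 0) := by
    have h := (Complex.continuous_ofReal.tendsto 0).comp tendsto_inv_atTop_zero
    rwa [Complex.ofReal_zero] at h
  have h2 := (h1.mul (tendsto_exp_lawlorPhase_neg ha k)).add_const 1
  rw [mul_zero, zero_add] at h2
  refine h2.congr' ?_
  filter_upwards [eventually_gt_atTop 0] with r hr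
  have : (r : ℂ) ≠ 0 := by exact_mod_cast hr.ne'
  push_cast
  field_simp
  ring

/-- The difference splits as `(√(1/a + r²) - r) exp(-iψ) + r (exp(-iψ) - 1)`; the second part
vanishes in the limit because `r ψ(-r) → 0`. -/
theorem tendsto_lawlorCurve_neg_sub {n : ℕ} [Nontrivial (Fin n)] {a : Fin n → ℝ}
    (ha : ∀ k, 0 < a k) (k : Fin n) :
    Tendsto (fun r : ℝ => lawlorCurve a k (-r) - r) atTop (𝓝 0) := by
  have h1 := (Complex.continuous_ofReal.tendsto 0).comp
    (tendsto_sqrt_add_sq_sub (one_div_pos.2 (ha k)))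
  have h2 := (h1.mul (tendsto_exp_lawlorPhase_neg' ha k)).add (tendsto_exp_lawlorPhase_neg ha k)
  simp only [Complex.ofReal_zero, zero_mul, zero_add] at h2
  refine h2.congr fun r => ?_
  simp only [lawlorCurve, Function.comp_apply, Complex.ofReal_sub, neg_sq]
  ring

theorem hasDerivAt_lawlorCurve {n : ℕ} {a : Fin n → ℝ} (ha : ∀ k, 0 < a k) (k : Fin n) (y : ℝ) :
    HasDerivAt (lawlorCurve a k)
      (((y / Real.sqrt (1 / a k + y ^ 2) : ℝ) : ℂ)
          * Complex.exp (-(lawlorPhase a k y : ℂ) * Complex.I)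
        - ((Real.sqrt (1 / a k + y ^ 2) * lawlorIntegrand a k y : ℝ) : ℂ) * Complex.I
          * Complex.exp (-(lawlorPhase a k y : ℂ) * Complex.I)) y := by
  have h1 : HasDerivAt (fun y : ℝ => Real.sqrt (1 / a k + y ^ 2))
      (y / Real.sqrt (1 / a k + y ^ 2)) y := by
    have := ((hasDerivAt_pow 2 y).const_add (1 / a k)).sqrt (one_div_add_sq_pos (ha k) y).ne'
    refine this.congr_deriv ?_
    simp
    rw [mul_div_mul_left _ _ two_ne_zero]
  have h2 := (hasDerivAt_lawlorPhase ha k y).ofReal_comp.neg.mul_const Complex.I |>.cexp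
  refine (h1.ofReal_comp.mul h2).congr_deriv ?_
  simp only [Pi.neg_apply]
  push_cast
  ring

theorem tendsto_deriv_lawlorCurve_neg {n : ℕ} [Nontrivial (Fin n)] {a : Fin n → ℝ}
    (ha : ∀ k, 0 < a k) (k : Fin n) :
    Tendsto (deriv fun r : ℝ => lawlorCurve a k (-r)) atTop (𝓝 1) := by
  have hd : (deriv fun r : ℝ => lawlorCurve a k (-r)) = fun r : ℝ =>
      ((r / Real.sqrt (1 / a k + r ^ 2) : ℝ) : ℂ)
          * Complex.exp (-(lawlorPhase a k (-r) : ℂ) * Complex.I)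
        + ((Real.sqrt (1 / a k + r ^ 2) * lawlorIntegrand a k r : ℝ) : ℂ) * Complex.I
          * Complex.exp (-(lawlorPhase a k (-r) : ℂ) * Complex.I) := by
    funext r
    have h1 := (hasDerivAt_lawlorCurve ha k (-r)).scomp r (hasDerivAt_neg r)
    have h2 : deriv (fun r : ℝ => lawlorCurve a k (-r)) r = _ := h1.deriv
    rw [h2, neg_sq, lawlorIntegrand_neg, neg_smul, one_smul]
    push_cast
    ring
  have hs := tendsto_sqrt_add_sq_sub (one_div_pos.2 (ha k))
  have hsq : Tendsto (fun r : ℝ => Real.sqrt (1 / a k + r ^ 2)) atTop atTop :=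
    tendsto_atTop_mono' atTop (by
      filter_upwards [eventually_ge_atTop 0] with r hr
      exact Real.le_sqrt_of_sq_le (by
        have := one_div_pos.2 (ha k)
        simp only [id]
        linarith)) tendsto_id
  have h1 : Tendsto (fun r : ℝ => r / Real.sqrt (1 / a k + r ^ 2)) atTop (𝓝 1) := by
    have h2 := (hs.mul (tendsto_inv_atTop_zero.comp hsq)).const_sub 1
    rw [zero_mul, sub_zero] at h2
    refine h2.congr fun r => ?_
    have := (Real.sqrt_pos.2 (one_div_add_sq_pos (ha k) r)).ne'
    simp only [Function.comp_apply]
    field_simp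
    ring
  have hf : Tendsto (fun r => lawlorIntegrand a k r) atTop (𝓝 0) := by
    have h2 := tendsto_inv_atTop_zero.mul (tendsto_mul_lawlorIntegrand ha k)
    rw [zero_mul] at h2
    refine h2.congr' ?_
    filter_upwards [eventually_gt_atTop 0] with r hr
    field_simp
  have h3 : Tendsto (fun r : ℝ => Real.sqrt (1 / a k + r ^ 2) * lawlorIntegrand a k r) atTop
      (𝓝 0) := by
    have h2 := (hs.mul hf).add (tendsto_mul_lawlorIntegrand ha k)
    rw [zero_mul, zero_add] at h2
    refine h2.congr fun r => ?_
    ring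
  have he := tendsto_exp_lawlorPhase_neg' ha k
  have h4 := (((Complex.continuous_ofReal.tendsto 1).comp h1).mul he).add
    ((((Complex.continuous_ofReal.tendsto 0).comp h3).mul_const Complex.I).mul he)
  rw [hd]
  simpa using h4

theorem tendsto_lawlorCurve_sub {n : ℕ} [Nontrivial (Fin n)] {a : Fin n → ℝ}
    (ha : ∀ k, 0 < a k) (k : Fin n) :
    Tendsto (fun r : ℝ => lawlorCurve a k r
      - Complex.exp (-(lawlorAngle a k : ℂ) * Complex.I) * r) atTop (𝓝 0) := by
  have h1 := ((Complex.continuous_conj.tendsto 0).comp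
    (tendsto_lawlorCurve_neg_sub ha k)).const_mul
      (Complex.exp (-(lawlorAngle a k : ℂ) * Complex.I))
  rw [map_zero, mul_zero] at h1
  refine h1.congr fun r => ?_
  rw [lawlorCurve_eq_conj ha k r]
  simp only [Function.comp_apply, map_sub, Complex.conj_ofReal]
  ring

theorem tendsto_deriv_lawlorCurve {n : ℕ} [Nontrivial (Fin n)] {a : Fin n → ℝ}
    (ha : ∀ k, 0 < a k) (k : Fin n) :
    Tendsto (deriv (lawlorCurve a k)) atTop
      (𝓝 (Complex.exp (-(lawlorAngle a k : ℂ) * Complex.I))) := by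
  have h1 := ((Complex.continuous_conj.tendsto 1).comp
    (tendsto_deriv_lawlorCurve_neg ha k)).const_mul
      (Complex.exp (-(lawlorAngle a k : ℂ) * Complex.I))
  rw [map_one, mul_one] at h1
  refine h1.congr fun r => ?_
  have hd : HasDerivAt (fun r : ℝ => lawlorCurve a k (-r))
      (deriv (fun r : ℝ => lawlorCurve a k (-r)) r) r := by
    have : Differentiable ℝ fun r : ℝ => lawlorCurve a k (-r) :=
      ((contDiff_lawlorCurve ha k).differentiable (by simp)).comp differentiable_neg
    exact (this r).hasDerivAt
  have h2 := (Complex.conjCLE.toContinuousLinearMap.hasFDerivAt.comp_hasDerivAt r hd).const_mul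
    (Complex.exp (-(lawlorAngle a k : ℂ) * Complex.I))
  have h3 : lawlorCurve a k = fun r => Complex.exp (-(lawlorAngle a k : ℂ) * Complex.I)
      * (starRingEnd ℂ) (lawlorCurve a k (-r)) := funext (lawlorCurve_eq_conj ha k)
  conv_rhs => rw [h3]
  exact h2.deriv.symm

end

section

open Filter Topology

/-! ### Ends given by a radial profile -/

theorem frameMap_apply {n : ℕ} (e : Fin n → Cn n) (x : EuclideanSpace ℝ (Fin n)) :
    frameMap e x = ∑ k, x k • e k := by
  simp [frameMap]

theorem frameMap_single {n : ℕ} (e : Fin n → Cn n) (j : Fin n) :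
    frameMap e (EuclideanSpace.single j (1 : ℝ)) = e j := by
  rw [frameMap_apply, Finset.sum_eq_single j]
  · simp
  · intro k _ hk
    simp [hk]
  · simp

/-- The map `x ↦ ∑ k, (w k ‖x‖ / ‖x‖) x k • v k`. -/
def radialMap {n : ℕ} (w : Fin n → ℝ → ℂ) (v : Fin n → Cn n) (x : EuclideanSpace ℝ (Fin n)) :
    Cn n :=
  ∑ k, (w k ‖x‖ * ((‖x‖⁻¹ : ℝ) : ℂ) * (x k : ℂ)) • v k

theorem contDiffAt_radialMap {n : ℕ} {w : Fin n → ℝ → ℂ} (hw : ∀ k, ContDiff ℝ ∞ (w k))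
    (v : Fin n → Cn n) {x : EuclideanSpace ℝ (Fin n)} (hx : x ≠ 0) :
    ContDiffAt ℝ ∞ (radialMap w v) x := by
  have hnorm : ContDiffAt ℝ ∞ (fun y : EuclideanSpace ℝ (Fin n) => ‖y‖) x := contDiffAt_norm ℝ hx
  refine ContDiffAt.sum fun k _ => ?_
  refine ContDiffAt.smul (((((hw k).contDiffAt).comp x hnorm).mul
    (Complex.ofRealCLM.contDiff.contDiffAt.comp x (hnorm.inv (norm_ne_zero_iff.2 hx)))).mul ?_)
    contDiffAt_const
  exact (Complex.ofRealCLM.comp (EuclideanSpace.proj k)).contDiff.contDiffAt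

theorem radialMap_sub_frameMap {n : ℕ} (w : Fin n → ℝ → ℂ) (c : Fin n → ℂ) (v : Fin n → Cn n)
    (x : EuclideanSpace ℝ (Fin n)) :
    radialMap w v x - frameMap (fun k => c k • v k) x
      = ∑ k, ((w k ‖x‖ * ((‖x‖⁻¹ : ℝ) : ℂ) - c k) * (x k : ℂ)) • v k := by
  rw [frameMap_apply, radialMap, ← Finset.sum_sub_distrib]
  refine Finset.sum_congr rfl fun k _ => ?_
  rw [sub_mul, sub_smul, mul_comm (c k), mul_smul (x k : ℂ)]
  rfl

theorem tendsto_radialMap {n : ℕ} {w : Fin n → ℝ → ℂ} {c : Fin n → ℂ}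
    (h0 : ∀ k, Tendsto (fun r : ℝ => w k r - c k * r) atTop (𝓝 0)) (v : Fin n → Cn n) :
    Tendsto (fun x => radialMap w v x - frameMap (fun k => c k • v k) x)
      (Bornology.cobounded _) (𝓝 0) := by
  have hlim : Tendsto (fun x : EuclideanSpace ℝ (Fin n) =>
      ∑ k, ‖w k ‖x‖ - c k * ‖x‖‖ * ‖v k‖) (Bornology.cobounded _) (𝓝 0) := by
    have : Tendsto (fun r : ℝ => ∑ k, ‖w k r - c k * r‖ * ‖v k‖) atTop (𝓝 0) := by
      have h1 := tendsto_finsetSum Finset.univ fun k _ =>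
        ((tendsto_zero_iff_norm_tendsto_zero.1 (h0 k)).mul_const ‖v k‖)
      simpa using h1
    exact this.comp tendsto_norm_cobounded_atTop
  rw [tendsto_zero_iff_norm_tendsto_zero]
  refine squeeze_zero' (Eventually.of_forall fun x => norm_nonneg _) ?_ hlim
  filter_upwards [tendsto_norm_cobounded_atTop.eventually (eventually_gt_atTop 0)] with x hx
  rw [radialMap_sub_frameMap]
  refine norm_sum_le_of_le _ fun k _ => ?_
  rw [norm_smul]
  refine mul_le_mul_of_nonneg_right ?_ (norm_nonneg _)
  have h1 : w k ‖x‖ * ((‖x‖⁻¹ : ℝ) : ℂ) - c k = (w k ‖x‖ - c k * ‖x‖) * ((‖x‖⁻¹ : ℝ) : ℂ) := by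
    have : ((‖x‖ : ℝ) : ℂ) ≠ 0 := by exact_mod_cast hx.ne'
    push_cast
    field_simp
  rw [h1, mul_assoc, norm_mul]
  refine mul_le_of_le_one_right (norm_nonneg _) ?_
  rw [norm_mul, Complex.norm_real, Complex.norm_real, norm_inv, norm_norm,
    inv_mul_le_iff₀ hx, mul_one]
  exact PiLp.norm_apply_le x k

/-- The error has coefficients `h(‖x‖) x_k` with `h(r) = w(r)/r - c`. Since the norm is
`1`-Lipschitz, their derivatives are bounded by `|h| + |r h'|`. -/
theorem tendsto_fderiv_radialMap {n : ℕ} {w : Fin n → ℝ → ℂ} {c : Fin n → ℂ}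
    (hw : ∀ k, ContDiff ℝ ∞ (w k))
    (h0 : ∀ k, Tendsto (fun r : ℝ => w k r - c k * r) atTop (𝓝 0))
    (h1 : ∀ k, Tendsto (deriv (w k)) atTop (𝓝 (c k))) (v : Fin n → Cn n) :
    Tendsto (fun x => fderiv ℝ (radialMap w v) x - frameMap (fun k => c k • v k))
      (Bornology.cobounded _) (𝓝 0) := by
  let h : Fin n → ℝ → ℂ := fun k r => w k r * ((r⁻¹ : ℝ) : ℂ) - c k
  let h' : Fin n → ℝ → ℂ := fun k r => deriv (w k) r * ((r⁻¹ : ℝ) : ℂ)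
    + w k r * ((-(r ^ 2)⁻¹ : ℝ) : ℂ)
  have hh' : ∀ k r, 0 < r → HasDerivAt (h k) (h' k r) r := fun k r hr =>
    ((((hw k).differentiable (by simp)) r).hasDerivAt.mul
      (hasDerivAt_inv hr.ne').ofReal_comp).sub_const _
  have hinv : Tendsto (fun r : ℝ => ((r⁻¹ : ℝ) : ℂ)) atTop (𝓝 0) := by
    have h := (Complex.continuous_ofReal.tendsto 0).comp tendsto_inv_atTop_zero
    rwa [Complex.ofReal_zero] at h
  have hlim1 : ∀ k, Tendsto (h k) atTop (𝓝 0) := fun k => by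
    have h2 := (h0 k).mul hinv
    rw [zero_mul] at h2
    refine h2.congr' ?_
    filter_upwards [eventually_gt_atTop 0] with r hr
    have : (r : ℂ) ≠ 0 := by exact_mod_cast hr.ne'
    simp only [h]
    push_cast
    field_simp
  -- This rests on `r h' = (w' - c) - h`.
  have hlim2 : ∀ k, Tendsto (fun r : ℝ => (r : ℂ) * h' k r) atTop (𝓝 0) := fun k => by
    have h2 := ((h1 k).sub_const (c k)).sub (hlim1 k)
    rw [sub_self, sub_zero] at h2
    refine h2.congr' ?_
    filter_upwards [eventually_gt_atTop 0] with r hr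
    have : (r : ℂ) ≠ 0 := by exact_mod_cast hr.ne'
    simp only [h, h']
    push_cast
    field_simp
    ring
  have hlim : Tendsto (fun x : EuclideanSpace ℝ (Fin n) =>
      ∑ k, (‖h k ‖x‖‖ + ‖(‖x‖ : ℂ) * h' k ‖x‖‖) * ‖v k‖) (Bornology.cobounded _) (𝓝 0) := by
    have : Tendsto (fun r : ℝ => ∑ k, (‖h k r‖ + ‖(r : ℂ) * h' k r‖) * ‖v k‖) atTop (𝓝 0) := by
      have h1 := tendsto_finsetSum Finset.univ fun k _ =>
        (((tendsto_zero_iff_norm_tendsto_zero.1 (hlim1 k)).add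
          (tendsto_zero_iff_norm_tendsto_zero.1 (hlim2 k))).mul_const ‖v k‖)
      simpa using h1
    exact this.comp tendsto_norm_cobounded_atTop
  rw [tendsto_zero_iff_norm_tendsto_zero]
  refine squeeze_zero' (Eventually.of_forall fun x => norm_nonneg _) ?_ hlim
  filter_upwards [tendsto_norm_cobounded_atTop.eventually (eventually_gt_atTop 0)] with x hx
  have hx0 : x ≠ 0 := norm_pos_iff.1 hx
  have hdn : DifferentiableAt ℝ (fun y : EuclideanSpace ℝ (Fin n) => ‖y‖) x :=
    (contDiffAt_norm ℝ hx0 (n := 1)).differentiableAt (by simp)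
  have hN : ‖fderiv ℝ (fun y : EuclideanSpace ℝ (Fin n) => ‖y‖) x‖ ≤ 1 := by
    simpa using norm_fderiv_le_of_lipschitz ℝ (x₀ := x)
      (lipschitzWith_one_norm (E := EuclideanSpace ℝ (Fin n)))
  set N := fderiv ℝ (fun y : EuclideanSpace ℝ (Fin n) => ‖y‖) x with hNdef
  let P : Fin n → EuclideanSpace ℝ (Fin n) →L[ℝ] ℂ := fun k =>
    Complex.ofRealCLM.comp (EuclideanSpace.proj k)
  have hP : ∀ k, ‖P k‖ ≤ 1 := fun k => ContinuousLinearMap.opNorm_le_bound _ zero_le_one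
    fun y => by
      rw [one_mul]
      refine le_trans (le_of_eq ?_) (PiLp.norm_apply_le y k)
      exact Complex.norm_real _
  let L : Fin n → EuclideanSpace ℝ (Fin n) →L[ℝ] ℂ := fun k =>
    h k ‖x‖ • P k + (x k : ℂ) • (N.smulRight (h' k ‖x‖))
  have hL : ∀ k, HasFDerivAt (fun y : EuclideanSpace ℝ (Fin n) => h k ‖y‖ * (y k : ℂ)) (L k) x :=
    fun k => by
      have e1 : HasFDerivAt (fun y : EuclideanSpace ℝ (Fin n) => h k ‖y‖)
          (N.smulRight (h' k ‖x‖)) x := by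
        have := (hh' k ‖x‖ hx).hasFDerivAt.comp x hdn.hasFDerivAt
        refine this.congr_fderiv ?_
        ext y
        simp [N]
      exact e1.mul (P k).hasFDerivAt
  have hLn : ∀ k, ‖L k‖ ≤ ‖h k ‖x‖‖ + ‖(‖x‖ : ℂ) * h' k ‖x‖‖ := fun k => by
    refine (norm_add_le _ _).trans (add_le_add ?_ ?_)
    · rw [norm_smul]
      exact mul_le_of_le_one_right (norm_nonneg _) (hP k)
    · rw [norm_smul, norm_mul, ContinuousLinearMap.norm_smulRight_apply, Complex.norm_real,
        Complex.norm_real, norm_norm]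
      refine mul_le_mul (PiLp.norm_apply_le x k) ?_ (by positivity) (norm_nonneg _)
      exact mul_le_of_le_one_left (norm_nonneg _) hN
  have hfd : HasFDerivAt (radialMap w v)
      (frameMap (fun k => c k • v k) + ∑ k, (L k).smulRight (v k)) x := by
    have e1 : radialMap w v = fun y => frameMap (fun k => c k • v k) y
        + ∑ k, (h k ‖y‖ * (y k : ℂ)) • v k := by
      funext y
      rw [← radialMap_sub_frameMap w c v y]
      abel
    rw [e1]
    refine (frameMap fun k => c k • v k).hasFDerivAt.add ?_
    exact HasFDerivAt.fun_sum fun k _ => (hL k).smul_const (v k)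
  rw [hfd.fderiv, add_sub_cancel_left]
  refine norm_sum_le_of_le _ fun k _ => ?_
  refine (ContinuousLinearMap.opNorm_le_bound _ (by positivity) fun y => ?_)
  rw [ContinuousLinearMap.smulRight_apply, norm_smul, mul_right_comm]
  exact mul_le_mul_of_nonneg_right (((L k).le_opNorm y).trans
    (mul_le_mul_of_nonneg_right (hLn k) (norm_nonneg y))) (norm_nonneg _)

theorem eventually_re_Omega_fderiv_pos {n : ℕ} {Φ : EuclideanSpace ℝ (Fin n) → Cn n}
    {e : Fin n → Cn n} (he : 0 < (Omega e).re)
    (h : Tendsto (fun x => fderiv ℝ Φ x - frameMap e) (Bornology.cobounded _) (𝓝 0)) :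
    ∃ R : ℝ, ∀ x, R < ‖x‖ →
      0 < (Omega fun j => fderiv ℝ Φ x (EuclideanSpace.single j (1 : ℝ))).re := by
  have hc : Continuous fun L : EuclideanSpace ℝ (Fin n) →L[ℝ] Cn n =>
      (Omega fun j => L (EuclideanSpace.single j (1 : ℝ))).re := by
    refine Complex.continuous_re.comp (Continuous.matrix_det ?_)
    refine continuous_matrix fun i j => ?_
    exact (EuclideanSpace.proj (𝕜 := ℂ) i).continuous.comp
      (ContinuousLinearMap.apply ℝ (Cn n) (EuclideanSpace.single j (1 : ℝ))).continuous
  have h1 : Tendsto (fun x => fderiv ℝ Φ x) (Bornology.cobounded _) (𝓝 (frameMap e)) := by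
    simpa using h.add_const (frameMap e)
  have h2 := (hc.tendsto (frameMap e)).comp h1
  simp only [frameMap_single] at h2
  have h3 := h2.eventually (lt_mem_nhds he)
  rw [← comap_norm_atTop, eventually_comap, eventually_atTop] at h3
  obtain ⟨R, hR⟩ := h3
  exact ⟨R, fun x hx => hR ‖x‖ hx.le x rfl⟩

end

section

open Filter Topology

/-! ### Parametrization of Lawlor necks -/

/-- The point `∑ k, z k (y) x k • e k`. -/
def neckMap {n : ℕ} (a : Fin n → ℝ) (e : Fin n → Cn n) (y : ℝ) (x : EuclideanSpace ℝ (Fin n)) :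
    Cn n :=
  ∑ k, (lawlorCurve a k y * (x k : ℂ)) • e k

theorem sum_smul_unitaryFrame {n : ℕ} {A : Matrix (Fin n) (Fin n) ℂ}
    (hA : A ∈ Matrix.unitaryGroup (Fin n) ℂ) (w : Fin n → ℂ) :
    (∑ k, w k • (unitaryFrame A hA).1 k).ofLp = A.mulVec w := by
  funext i
  simp [unitaryFrame, Matrix.mulVec, dotProduct, mul_comm]

theorem toEuclideanLin_eq_sum {n : ℕ} {A : Matrix (Fin n) (Fin n) ℂ}
    (hA : A ∈ Matrix.unitaryGroup (Fin n) ℂ) (w : Cn n) :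
    Matrix.toEuclideanLin A w = ∑ k, w k • (unitaryFrame A hA).1 k := by
  apply WithLp.ofLp_injective
  rw [sum_smul_unitaryFrame, Matrix.ofLp_toLpLin, Matrix.toLin'_apply]

theorem sum_smul_unitaryFrame_injective {n : ℕ} {A : Matrix (Fin n) (Fin n) ℂ}
    (hA : A ∈ Matrix.unitaryGroup (Fin n) ℂ) {w w' : Fin n → ℂ}
    (h : ∑ k, w k • (unitaryFrame A hA).1 k = ∑ k, w' k • (unitaryFrame A hA).1 k) : w = w' := by
  have h1 := congrArg (fun p : Cn n => (star A).mulVec p.ofLp) h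
  simp only [sum_smul_unitaryFrame] at h1
  rwa [Matrix.mulVec_mulVec, Matrix.mulVec_mulVec, Matrix.mem_unitaryGroup_iff'.1 hA,
    Matrix.one_mulVec, Matrix.one_mulVec] at h1

theorem image_lawlorModel {n : ℕ} (a : Fin n → ℝ) {A : Matrix (Fin n) (Fin n) ℂ}
    (hA : A ∈ Matrix.unitaryGroup (Fin n) ℂ) (t : ℝ) :
    (fun w : Cn n => t • Matrix.toEuclideanLin A w) '' lawlorModel a
      = {p | ∃ (y : ℝ) (x : EuclideanSpace ℝ (Fin n)),
          ‖x‖ = 1 ∧ p = t • neckMap a (unitaryFrame A hA).1 y x} := by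
  ext p
  constructor
  · rintro ⟨w, ⟨y, x, hx, hw⟩, rfl⟩
    refine ⟨y, x, hx, ?_⟩
    simp only [toEuclideanLin_eq_sum hA, neckMap, hw]
  · rintro ⟨y, x, hx, rfl⟩
    refine ⟨WithLp.toLp 2 fun k => lawlorCurve a k y * (x k : ℂ), ⟨y, x, hx, fun k => rfl⟩, ?_⟩
    simp only [toEuclideanLin_eq_sum hA, neckMap]

/-- Moduli give `(1/a k + y²) x_k² = (1/a k + y'²) x'_k²`, so `x'_k² ≤ x_k²` for all `k`. Both
families sum to `1`, hence they agree, and then so do `y²` and `y'²`. -/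
theorem sq_eq_sq_of_lawlorCurve_mul_eq {n : ℕ} {a : Fin n → ℝ} (ha : ∀ k, 0 < a k) {y y' : ℝ}
    {x x' : EuclideanSpace ℝ (Fin n)} (hx : ‖x‖ = 1) (hx' : ‖x'‖ = 1) (hyy : y ^ 2 ≤ y' ^ 2)
    (h : ∀ k, lawlorCurve a k y * (x k : ℂ) = lawlorCurve a k y' * (x' k : ℂ)) :
    y ^ 2 = y' ^ 2 := by
  have h1 : ∀ k, (1 / a k + y ^ 2) * x k ^ 2 = (1 / a k + y' ^ 2) * x' k ^ 2 := fun k => by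
    have := congrArg (fun z : ℂ => ‖z‖ ^ 2) (h k)
    simpa only [norm_mul, mul_pow, norm_lawlorCurve, Complex.norm_real, Real.norm_eq_abs, sq_abs,
      Real.sq_sqrt (one_div_add_sq_pos (ha k) _).le] using this
  rw [EuclideanSpace.norm_eq, Real.sqrt_eq_one] at hx hx'
  simp only [Real.norm_eq_abs, sq_abs] at hx hx'
  have h2 : ∀ k, x' k ^ 2 ≤ x k ^ 2 := fun k => by
    have hp := one_div_add_sq_pos (ha k) y
    refine le_of_mul_le_mul_left ?_ hp
    rw [h1 k]
    exact mul_le_mul_of_nonneg_right (by linarith) (sq_nonneg _)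
  have h3 : ∀ k, x' k ^ 2 = x k ^ 2 := fun k =>
    (Finset.sum_eq_sum_iff_of_le fun k _ => h2 k).1 (hx'.trans hx.symm) k (Finset.mem_univ k)
  have h4 : ∑ k, (y' ^ 2 - y ^ 2) * x k ^ 2 = 0 :=
    Finset.sum_eq_zero fun k _ => by
      have := h1 k
      rw [h3 k] at this
      linear_combination -this
  rw [← Finset.mul_sum, hx, mul_one] at h4
  linarith

/-- The arguments at `y` and `-y` differ by `ψ(y) - ψ(-y)`, which lies in `(0, π)` because the total
angle is below `π`. So the two values are not real multiples of each other. -/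
theorem lawlorCurve_neg_mul_ne {n : ℕ} {a : Fin n → ℝ} (ha : ∀ k, 0 < a k)
    (hθ : ∀ k, lawlorAngle a k ∈ Set.Ioo 0 Real.pi) {y : ℝ} (hy : 0 < y) (k : Fin n) {s t : ℝ}
    (hs : s ≠ 0) : lawlorCurve a k y * (s : ℂ) ≠ lawlorCurve a k (-y) * (t : ℂ) := by
  intro h
  have hne : ((Real.sqrt (1 / a k + y ^ 2) : ℝ) : ℂ) ≠ 0 := by
    exact_mod_cast (Real.sqrt_pos.2 (one_div_add_sq_pos (ha k) y)).ne'
  rw [lawlorCurve, lawlorCurve, neg_sq, mul_assoc, mul_assoc] at h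
  have h1 := mul_left_cancel₀ hne h
  have h2 : Complex.exp (((-(lawlorPhase a k y - lawlorPhase a k (-y)) : ℝ) : ℂ) * Complex.I) * s
      = t := by
    have h3 := congrArg (fun z => Complex.exp ((lawlorPhase a k (-y) : ℂ) * Complex.I) * z) h1
    simp only [← mul_assoc, ← Complex.exp_add] at h3
    rw [← add_mul, ← add_mul, add_neg_cancel, zero_mul, Complex.exp_zero, one_mul] at h3
    rw [← h3]
    congr 2
    push_cast
    ring
  have h4 := congrArg Complex.im h2
  rw [Complex.im_mul_ofReal, Complex.exp_ofReal_mul_I_im, Real.sin_neg, Complex.ofReal_im] at h4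
  have hlt : lawlorPhase a k (-y) < lawlorPhase a k y :=
    lawlorPhase_strictMono ha k (by linarith)
  have hsum := lawlorPhase_neg_add ha k y
  have hpos := lawlorPhase_pos ha k (-y)
  have hsin := Real.sin_pos_of_pos_of_lt_pi (sub_pos.2 hlt) (by linarith [(hθ k).2])
  rcases mul_eq_zero.1 h4 with h5 | h5
  · linarith
  · exact hs h5

theorem neckMap_injective {n : ℕ} {a : Fin n → ℝ} (ha : ∀ k, 0 < a k)
    (hθ : ∀ k, lawlorAngle a k ∈ Set.Ioo 0 Real.pi) {A : Matrix (Fin n) (Fin n) ℂ}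
    (hA : A ∈ Matrix.unitaryGroup (Fin n) ℂ) {y y' : ℝ} {x x' : EuclideanSpace ℝ (Fin n)}
    (hx : ‖x‖ = 1) (hx' : ‖x'‖ = 1)
    (h : neckMap a (unitaryFrame A hA).1 y x = neckMap a (unitaryFrame A hA).1 y' x') :
    y = y' ∧ x = x' := by
  have h1 : ∀ k, lawlorCurve a k y * (x k : ℂ) = lawlorCurve a k y' * (x' k : ℂ) :=
    fun k => congrFun (sum_smul_unitaryFrame_injective hA h) k
  have hsq : y ^ 2 = y' ^ 2 := by
    rcases le_total (y ^ 2) (y' ^ 2) with hle | hle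
    · exact sq_eq_sq_of_lawlorCurve_mul_eq ha hx hx' hle h1
    · exact (sq_eq_sq_of_lawlorCurve_mul_eq ha hx' hx hle fun k => (h1 k).symm).symm
  have hcoord : ∀ {z : EuclideanSpace ℝ (Fin n)}, ‖z‖ = 1 → ∃ k, z k ≠ 0 := by
    intro z hz
    by_contra! hall
    have : z = 0 := by ext k; simpa using hall k
    rw [this, norm_zero] at hz
    exact zero_ne_one hz
  have hyy : y = y' := by
    rcases sq_eq_sq_iff_eq_or_eq_neg.1 hsq with h2 | h2
    · exact h2
    · rcases lt_trichotomy y' 0 with h3 | h3 | h3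
      · obtain ⟨k, hk⟩ := hcoord hx
        have := h1 k
        rw [show y' = -y by linarith] at this
        exact absurd this (lawlorCurve_neg_mul_ne ha hθ (by linarith) k hk)
      · rw [h2, h3, neg_zero]
      · obtain ⟨k, hk⟩ := hcoord hx'
        have := h1 k
        rw [h2] at this
        exact absurd this.symm (lawlorCurve_neg_mul_ne ha hθ h3 k hk)
  refine ⟨hyy, ?_⟩
  ext k
  have h2 := h1 k
  rw [hyy] at h2
  have hne : lawlorCurve a k y' ≠ 0 := by
    rw [← norm_ne_zero_iff, norm_lawlorCurve]
    exact (Real.sqrt_pos.2 (one_div_add_sq_pos (ha k) y')).ne'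
  exact_mod_cast mul_left_cancel₀ hne h2

/-- Reversal of the first coordinate. -/
def flipCoord {n : ℕ} (x : EuclideanSpace ℝ (Fin n)) : EuclideanSpace ℝ (Fin n) :=
  WithLp.toLp 2 fun i => (if (i : ℕ) = 0 then (-1 : ℝ) else 1) * x i

theorem flipCoord_flipCoord {n : ℕ} (x : EuclideanSpace ℝ (Fin n)) :
    flipCoord (flipCoord x) = x := by
  ext i
  by_cases h : (i : ℕ) = 0 <;> simp [flipCoord, h]

theorem norm_flipCoord {n : ℕ} (x : EuclideanSpace ℝ (Fin n)) : ‖flipCoord x‖ = ‖x‖ := by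
  rw [EuclideanSpace.norm_eq, EuclideanSpace.norm_eq]
  congr 1
  refine Finset.sum_congr rfl fun i _ => ?_
  by_cases h : (i : ℕ) = 0 <;> simp [flipCoord, h]

theorem flipCoord_smul {n : ℕ} (c : ℝ) (x : EuclideanSpace ℝ (Fin n)) :
    flipCoord (c • x) = c • flipCoord x := by
  ext i
  simp only [flipCoord, PiLp.smul_apply, smul_eq_mul]
  ring

theorem radialMap_neg_eq_neckMap {n : ℕ} (a : Fin n → ℝ) (e : Fin n → Cn n)
    (x : EuclideanSpace ℝ (Fin n)) :
    radialMap (fun k r => lawlorCurve a k (-r)) e x = neckMap a e (-‖x‖) (‖x‖⁻¹ • x) := by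
  refine Finset.sum_congr rfl fun k _ => ?_
  simp only [PiLp.smul_apply, smul_eq_mul]
  push_cast
  rw [mul_assoc]

/-- The end at `+∞` needs a reflected coordinate: the unreflected frame tends to one of determinant
`-1`, which orients `-ξ`. -/
theorem radialMap_eq_neckMap {n : ℕ} (a : Fin n → ℝ) (e : Frame n)
    (x : EuclideanSpace ℝ (Fin n)) :
    radialMap (lawlorCurve a) (flipFrame e).1 x = neckMap a e.1 ‖x‖ (‖x‖⁻¹ • flipCoord x) := by
  refine Finset.sum_congr rfl fun k _ => ?_
  by_cases h : (k : ℕ) = 0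
  · simp [flipFrame, flipCoord, h, mul_assoc]
  · simp [flipFrame, flipCoord, h, mul_assoc]

theorem norm_inv_smul_eq_one {n : ℕ} {x : EuclideanSpace ℝ (Fin n)} (hx : 0 < ‖x‖) :
    ‖‖x‖⁻¹ • x‖ = 1 := by
  rw [norm_smul, norm_inv, norm_norm, inv_mul_cancel₀ hx.ne']

theorem continuous_neckMap {n : ℕ} {a : Fin n → ℝ} (ha : ∀ k, 0 < a k) (e : Fin n → Cn n) :
    Continuous fun q : ℝ × EuclideanSpace ℝ (Fin n) => neckMap a e q.1 q.2 := by
  refine continuous_finsetSum _ fun k _ => Continuous.fun_smul (Continuous.fun_mul ?_ ?_)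
    continuous_const
  · exact (contDiff_lawlorCurve ha k).continuous.comp continuous_fst
  · exact (Complex.ofRealCLM.comp (EuclideanSpace.proj k)).continuous.comp continuous_snd

/-- The ends are the parts `y < -R` and `y > R` of the neck in polar coordinates `|y| = ‖x‖`.
Injectivity of `neckMap` makes them embedded and disjoint, and shows that what remains is the image
of the compact set `[-R, R] × S^{n-1}`. -/
theorem NormalForm.isAsymptoticTo {n : ℕ} [Nontrivial (Fin n)] (hn : 1 ≤ n) {η ξ : SLagPlane n}
    {u : Matrix (Fin n) (Fin n) ℂ} {a : Fin n → ℝ} (h : NormalForm η ξ u (lawlorAngle a))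
    (ha : ∀ k, 0 < a k) (hθ : ∀ k, lawlorAngle a k ∈ Set.Ioo 0 Real.pi) :
    IsAsymptoticTo ((fun w : Cn n => (1 : ℝ) • Matrix.toEuclideanLin u w) '' lawlorModel a)
      η.1 ξ.1 := by
  obtain ⟨huU, hudet⟩ := Matrix.mem_specialUnitaryGroup_iff.1 h.mem
  set e := unitaryFrame u huU with he
  set e' := unitaryFrame (u * phaseMatrix (lawlorAngle a))
    (mul_mem huU (phaseMatrix_mem_unitaryGroup _)) with he'
  have hη : η.1 = ⟦e⟧ := η.eq_mk_of_symMatrix h.mem h.left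
  have hdet' : (frameMatrix e'.1).det = -1 := by
    rw [he', frameMatrix_unitaryFrame, Matrix.det_mul, hudet, one_mul, det_phaseMatrix,
      sum_lawlorAngle hn ha, neg_mul, Complex.exp_neg, Complex.exp_pi_mul_I]
    norm_num
  have hξ : ξ.1 = ⟦flipFrame e'⟧ := by
    rw [← ξ.1.neg_neg, ξ.neg_eq_mk_of_symMatrix hn (v := e')
      (mul_mem huU (phaseMatrix_mem_unitaryGroup _)) hdet' h.right, OrientedPlane.neg_mk]
  rw [image_lawlorModel a huU, ← he]
  simp only [one_smul]
  set Φ := radialMap (fun k r => lawlorCurve a k (-r)) e.1 with hΦ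
  set Ψ := radialMap (lawlorCurve a) (flipFrame e).1 with hΨ
  have hsm1 : ∀ k, ContDiff ℝ ∞ fun r => lawlorCurve a k (-r) := fun k =>
    (contDiff_lawlorCurve ha k).comp contDiff_neg
  have hfr1 : (fun k => (1 : ℂ) • e.1 k) = e.1 := by simp
  have hfr2 : (fun k => Complex.exp (-(lawlorAngle a k : ℂ) * Complex.I) • (flipFrame e).1 k)
      = (flipFrame e').1 := by
    funext k
    ext i
    simp only [flipFrame, he, he', unitaryFrame, phaseMatrix, Matrix.mul_diagonal,
      PiLp.smul_apply, smul_eq_mul, Complex.real_smul]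
    ring
  have hΦ0 : Tendsto (fun x => Φ x - frameMap e.1 x) (Bornology.cobounded _) (𝓝 0) := by
    have := tendsto_radialMap (w := fun k r => lawlorCurve a k (-r)) (c := fun _ => 1)
      (fun k => by simpa using tendsto_lawlorCurve_neg_sub ha k) e.1
    rwa [hfr1] at this
  have hΦ1 : Tendsto (fun x => fderiv ℝ Φ x - frameMap e.1) (Bornology.cobounded _) (𝓝 0) := by
    have := tendsto_fderiv_radialMap (w := fun k r => lawlorCurve a k (-r)) (c := fun _ => 1) hsm1
      (fun k => by simpa using tendsto_lawlorCurve_neg_sub ha k)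
      (tendsto_deriv_lawlorCurve_neg ha) e.1
    rwa [hfr1] at this
  have hΨ0 : Tendsto (fun x => Ψ x - frameMap (flipFrame e').1 x) (Bornology.cobounded _) (𝓝 0) := by
    have := tendsto_radialMap (tendsto_lawlorCurve_sub ha) (flipFrame e).1
    rwa [hfr2] at this
  have hΨ1 : Tendsto (fun x => fderiv ℝ Ψ x - frameMap (flipFrame e').1)
      (Bornology.cobounded _) (𝓝 0) := by
    have := tendsto_fderiv_radialMap (contDiff_lawlorCurve ha) (tendsto_lawlorCurve_sub ha)
      (tendsto_deriv_lawlorCurve ha) (flipFrame e).1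
    rwa [hfr2] at this
  obtain ⟨R₁, hR₁⟩ := eventually_re_Omega_fderiv_pos (by
    have : Omega e.1 = 1 := hudet
    rw [this]; simp) hΦ1
  obtain ⟨R₂, hR₂⟩ := eventually_re_Omega_fderiv_pos (by
    have : Omega (flipFrame e').1 = 1 := by
      have := det_frameMatrix_flipFrame hn e'
      rwa [hdet', neg_neg] at this
    rw [this]; simp) hΨ1
  set R := max 1 (max R₁ R₂) with hR
  have hR0 : 0 < R := one_pos.trans_le (le_max_left _ _)
  have hR1 : R₁ ≤ R := (le_max_left _ _).trans (le_max_right _ _)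
  have hR2 : R₂ ≤ R := (le_max_right _ _).trans (le_max_right _ _)
  have hpos : ∀ x ∈ exterior n R, 0 < ‖x‖ := fun x hx => hR0.trans hx
  have hΦx : ∀ x, Φ x = neckMap a e.1 (-‖x‖) (‖x‖⁻¹ • x) := radialMap_neg_eq_neckMap a e.1
  have hΨx : ∀ x, Ψ x = neckMap a e.1 ‖x‖ (‖x‖⁻¹ • flipCoord x) := radialMap_eq_neckMap a e
  have hn1 : ∀ x ∈ exterior n R, ‖‖x‖⁻¹ • x‖ = 1 := fun x hx => norm_inv_smul_eq_one (hpos x hx)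
  have hn2 : ∀ x ∈ exterior n R, ‖‖x‖⁻¹ • flipCoord x‖ = 1 := fun x hx => by
    rw [← norm_flipCoord x]
    exact norm_inv_smul_eq_one (by rw [norm_flipCoord]; exact hpos x hx)
  have hne : ∀ x : EuclideanSpace ℝ (Fin n), R ≤ ‖x‖ → x ≠ 0 := fun x hx =>
    norm_pos_iff.1 (hR0.trans_le hx)
  refine ⟨R, hR0, Φ, Ψ, ⟨fun x hx => contDiffAt_radialMap hsm1 e.1 (hne x hx), ?_, ?_,
    fun x hx => hR₁ x (hR1.trans_lt hx), e, hη, hΦ0, hΦ1⟩,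
    ⟨fun x hx => contDiffAt_radialMap (contDiff_lawlorCurve ha) _ (hne x hx), ?_, ?_,
    fun x hx => hR₂ x (hR2.trans_lt hx), flipFrame e', hξ, hΨ0, hΨ1⟩, ?_, ?_⟩
  · intro x hx x' hx' hxx
    rw [hΦx, hΦx] at hxx
    obtain ⟨h1, h2⟩ := neckMap_injective ha hθ huU (hn1 x hx) (hn1 x' hx') hxx
    rw [neg_inj] at h1
    rw [h1] at h2
    exact smul_right_injective _ (inv_pos.2 (hpos x' hx')).ne' h2
  · exact fun x hx => ⟨_, _, hn1 x hx, hΦx x⟩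
  · intro x hx x' hx' hxx
    rw [hΨx, hΨx] at hxx
    obtain ⟨h1, h2⟩ := neckMap_injective ha hθ huU (hn2 x hx) (hn2 x' hx') hxx
    rw [h1] at h2
    rw [← flipCoord_flipCoord x, smul_right_injective _ (inv_pos.2 (hpos x' hx')).ne' h2,
      flipCoord_flipCoord]
  · exact fun x hx => ⟨_, _, hn2 x hx, hΨx x⟩
  · rw [Set.disjoint_left]
    rintro _ ⟨x, hx, rfl⟩ ⟨x', hx', hxx⟩
    rw [hΦx, hΨx] at hxx
    have := (neckMap_injective ha hθ huU (hn2 x' hx') (hn1 x hx) hxx).1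
    linarith [hpos x hx, hpos x' hx']
  · have hK : IsCompact ((fun q : ℝ × EuclideanSpace ℝ (Fin n) => neckMap a e.1 q.1 q.2) ''
        (Set.Icc (-R) R ×ˢ Metric.sphere 0 1)) :=
      (isCompact_Icc.prod (isCompact_sphere 0 1)).image (continuous_neckMap ha e.1)
    convert hK using 1
    ext p
    constructor
    · rintro ⟨⟨y, x, hx, rfl⟩, hp⟩
      refine ⟨(y, x), ⟨?_, by simpa using hx⟩, rfl⟩
      by_contra hy
      apply hp
      simp only [Set.mem_Icc, not_and_or, not_le] at hy
      rcases hy with hy | hy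
      · left
        have hnx : ‖(-y) • x‖ = -y := by
          rw [norm_smul, hx, mul_one, Real.norm_of_nonneg (by linarith)]
        refine ⟨(-y) • x, show R < ‖(-y) • x‖ by rw [hnx]; linarith, ?_⟩
        rw [hΦx, hnx, neg_neg, smul_smul, inv_mul_cancel₀ (by linarith), one_smul]
      · right
        have hnx : ‖y • flipCoord x‖ = y := by
          rw [norm_smul, norm_flipCoord, hx, mul_one, Real.norm_of_nonneg (by linarith)]
        refine ⟨y • flipCoord x, show R < ‖y • flipCoord x‖ by rw [hnx]; exact hy, ?_⟩
        rw [hΨx, hnx, flipCoord_smul, flipCoord_flipCoord, smul_smul,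
          inv_mul_cancel₀ (by linarith), one_smul]
    · rintro ⟨⟨y, x⟩, ⟨hy, hx⟩, rfl⟩
      have hx1 : ‖x‖ = 1 := by simpa using hx
      refine ⟨⟨y, x, hx1, rfl⟩, ?_⟩
      rintro (⟨x', hx', hxx⟩ | ⟨x', hx', hxx⟩)
      · rw [hΦx] at hxx
        have h1 := (neckMap_injective ha hθ huU (hn1 x' hx') hx1 hxx).1
        have h2 : R < ‖x'‖ := hx'
        have h3 : -R ≤ y := hy.1
        linarith
      · rw [hΨx] at hxx
        have h1 := (neckMap_injective ha hθ huU (hn2 x' hx') hx1 hxx).1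
        have h2 : R < ‖x'‖ := hx'
        have h3 : y ≤ R := hy.2
        linarith

theorem IsAsymptoticTo.symm {n : ℕ} {N : Set (Cn n)} {η ξ : OrientedPlane n}
    (h : IsAsymptoticTo N η ξ) : IsAsymptoticTo N ξ η := by
  obtain ⟨R, hR, Φ, Ψ, hΦ, hΨ, hd, hc⟩ := h
  exact ⟨R, hR, Ψ, Φ, hΨ, hΦ, hd.symm, by rwa [Set.union_comm]⟩

/-- Prescribing Lawlor's angles to be the phases puts the neck in position without any dilation. For
`n = 1` the phase would be `π`, which is excluded. -/
theorem LawlorPair.exists_isLawlorNeck {n : ℕ} (hn : 1 ≤ n) {η ξ : SLagPlane n}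
    (h : LawlorPair η ξ) : ∃ N, IsLawlorNeck N ∧ IsAsymptoticTo N η.1 ξ.1 := by
  obtain ⟨u, θ, hu, hθ, hs⟩ := h
  have hn2 : 2 ≤ n := by
    by_contra hlt
    obtain rfl : n = 1 := by omega
    rw [Fin.sum_univ_one] at hs
    linarith [(hθ 0).2]
  have : Nontrivial (Fin n) := Fin.nontrivial_iff_two_le.2 hn2
  obtain ⟨a, ha, haθ⟩ := exists_lawlorAngle_eq hn (fun k => (hθ k).1) hs
  obtain rfl : lawlorAngle a = θ := funext haθ
  have hIoo : ∀ k, lawlorAngle a k ∈ Set.Ioo 0 Real.pi := fun k => hθ k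
  exact ⟨_, ⟨a, ha, hIoo, u, hu.mem, 1, one_pos, rfl⟩, hu.isAsymptoticTo hn ha hIoo⟩

end

section

open Filter Topology

/-! ### Sets at bounded distance -/

/-- Every point of `X` is at bounded distance from a point of `Y`. -/
def CoarselyIn {E : Type*} [SeminormedAddCommGroup E] (X Y : Set E) : Prop :=
  ∃ C : ℝ, ∀ x ∈ X, ∃ y ∈ Y, ‖x - y‖ ≤ C

theorem CoarselyIn.trans {E : Type*} [SeminormedAddCommGroup E] {X Y Z : Set E}
    (h : CoarselyIn X Y) (h' : CoarselyIn Y Z) : CoarselyIn X Z := by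
  obtain ⟨C, hC⟩ := h
  obtain ⟨C', hC'⟩ := h'
  refine ⟨C + C', fun x hx => ?_⟩
  obtain ⟨y, hy, hxy⟩ := hC x hx
  obtain ⟨z, hz, hyz⟩ := hC' y hy
  refine ⟨z, hz, ?_⟩
  rw [← sub_add_sub_cancel x y z]
  exact (norm_add_le _ _).trans (add_le_add hxy hyz)

theorem CoarselyIn.union {E : Type*} [SeminormedAddCommGroup E] {X Y Z : Set E}
    (h : CoarselyIn X Z) (h' : CoarselyIn Y Z) : CoarselyIn (X ∪ Y) Z := by
  obtain ⟨C, hC⟩ := h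
  obtain ⟨C', hC'⟩ := h'
  refine ⟨max C C', ?_⟩
  rintro x (hx | hx)
  · obtain ⟨y, hy, hxy⟩ := hC x hx
    exact ⟨y, hy, hxy.trans (le_max_left _ _)⟩
  · obtain ⟨y, hy, hxy⟩ := hC' x hx
    exact ⟨y, hy, hxy.trans (le_max_right _ _)⟩

theorem CoarselyIn.mono_left {E : Type*} [SeminormedAddCommGroup E] {X Y Z : Set E}
    (h : CoarselyIn Y Z) (hXY : X ⊆ Y) : CoarselyIn X Z := by
  obtain ⟨C, hC⟩ := h
  exact ⟨C, fun x hx => hC x (hXY hx)⟩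

theorem CoarselyIn.mono_right {E : Type*} [SeminormedAddCommGroup E] {X Y Z : Set E}
    (h : CoarselyIn X Y) (hYZ : Y ⊆ Z) : CoarselyIn X Z := by
  obtain ⟨C, hC⟩ := h
  refine ⟨C, fun x hx => ?_⟩
  obtain ⟨y, hy, hxy⟩ := hC x hx
  exact ⟨y, hYZ hy, hxy⟩

/-- Scaling down removes the bounded error: `m v` is within `C` of some `y m` in the union, so `y m
/ m → v`, and the union is a closed cone. A subspace contained in a union of two subspaces lies in
one of them. -/
theorem submodule_le_or_le_of_coarselyIn {E : Type*} [NormedAddCommGroup E] [NormedSpace ℝ E]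
    [FiniteDimensional ℝ E] {V V₁ V₂ : Submodule ℝ E}
    (h : CoarselyIn (V : Set E) ((V₁ : Set E) ∪ V₂)) : V ≤ V₁ ∨ V ≤ V₂ := by
  obtain ⟨C, hC⟩ := h
  have hsub : ∀ v ∈ V, v ∈ V₁ ∨ v ∈ V₂ := by
    intro v hv
    have hcl : IsClosed ((V₁ : Set E) ∪ V₂) :=
      V₁.closed_of_finiteDimensional.union V₂.closed_of_finiteDimensional
    choose y hy hvy using fun m : ℕ => hC ((m : ℝ) • v) (V.smul_mem _ hv)
    have hlim : Tendsto (fun m : ℕ => (m : ℝ)⁻¹ • y m) atTop (𝓝 v) := by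
      rw [tendsto_iff_norm_sub_tendsto_zero]
      have h1 : Tendsto (fun m : ℕ => (m : ℝ)⁻¹ * C) atTop (𝓝 0) := by
        simpa using tendsto_inv_atTop_nhds_zero_nat.mul_const C
      refine squeeze_zero' (Eventually.of_forall fun _ => norm_nonneg _) ?_ h1
      filter_upwards [eventually_gt_atTop 0] with m hm
      have hm' : (0 : ℝ) < m := by exact_mod_cast hm
      have h2 : (m : ℝ)⁻¹ • y m - v = -((m : ℝ)⁻¹ • ((m : ℝ) • v - y m)) := by
        rw [smul_sub, smul_smul, inv_mul_cancel₀ hm'.ne', one_smul, neg_sub]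
      rw [h2, norm_neg, norm_smul, Real.norm_of_nonneg (inv_pos.2 hm').le]
      exact mul_le_mul_of_nonneg_left (hvy m) (inv_pos.2 hm').le
    refine hcl.mem_of_tendsto hlim (Eventually.of_forall fun m => ?_)
    rcases hy m with h | h
    · exact Or.inl (V₁.smul_mem _ h)
    · exact Or.inr (V₂.smul_mem _ h)
  by_contra hcon
  rw [not_or, SetLike.not_le_iff_exists, SetLike.not_le_iff_exists] at hcon
  obtain ⟨⟨v, hv, hv1⟩, w, hw, hw2⟩ := hcon
  have hv2 := (hsub v hv).resolve_left hv1
  have hw1 := (hsub w hw).resolve_right hw2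
  rcases hsub (v + w) (V.add_mem hv hw) with h | h
  · exact hv1 ((V₁.add_mem_iff_left hw1).1 h)
  · exact hw2 ((V₂.add_mem_iff_right hv2).1 h)

theorem exists_norm_le_of_tendsto_atTop {f : ℝ → ℂ} (hf : Continuous f)
    (h : Tendsto f atTop (𝓝 0)) : ∃ C, ∀ r, 0 ≤ r → ‖f r‖ ≤ C := by
  have h1 := (tendsto_zero_iff_norm_tendsto_zero.1 h).eventually (gt_mem_nhds one_pos)
  obtain ⟨R, hR⟩ := eventually_atTop.1 h1
  obtain ⟨C, hC⟩ := isCompact_Icc.exists_bound_of_continuousOn (s := Set.Icc 0 R) hf.continuousOn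
  refine ⟨max C 1, fun r hr => ?_⟩
  rcases le_total R r with h2 | h2
  · exact (hR r h2).le.trans (le_max_right _ _)
  · exact (hC r ⟨hr, h2⟩).trans (le_max_left _ _)

/-- Compactness of the remaining annulus requires continuity on its inner boundary; this is where
smoothness of an end up to the boundary enters. -/
theorem exists_norm_le_of_tendsto_cobounded {n : ℕ} {F : Type*} [NormedAddCommGroup F]
    {f : EuclideanSpace ℝ (Fin n) → F} {R : ℝ} (hf : ∀ x, R ≤ ‖x‖ → ContinuousAt f x)
    (h : Tendsto f (Bornology.cobounded _) (𝓝 0)) : ∃ C, ∀ x, R ≤ ‖x‖ → ‖f x‖ ≤ C := by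
  have h1 := (tendsto_zero_iff_norm_tendsto_zero.1 h).eventually (gt_mem_nhds one_pos)
  rw [← comap_norm_atTop, eventually_comap, eventually_atTop] at h1
  obtain ⟨R', hR'⟩ := h1
  have hK : IsCompact (Metric.closedBall (0 : EuclideanSpace ℝ (Fin n)) R' ∩ {x | R ≤ ‖x‖}) :=
    (isCompact_closedBall _ _).inter_right (isClosed_le continuous_const continuous_norm)
  obtain ⟨C, hC⟩ := hK.exists_bound_of_continuousOn (f := f) fun x hx =>
    (hf x hx.2).continuousWithinAt
  refine ⟨max C 1, fun x hx => ?_⟩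
  rcases le_total R' ‖x‖ with h2 | h2
  · exact (hR' ‖x‖ h2 x rfl).le.trans (le_max_right _ _)
  · exact (hC x ⟨by simpa using h2, hx⟩).trans (le_max_left _ _)

/-! ### The planes at infinity of an asymptotic submanifold -/

theorem mem_span_range_iff_frameMap {n : ℕ} {e : Fin n → Cn n} {p : Cn n} :
    p ∈ Submodule.span ℝ (Set.range e) ↔ ∃ x, frameMap e x = p := by
  rw [Submodule.mem_span_range_iff_exists_fun]
  constructor
  · rintro ⟨c, hc⟩
    exact ⟨WithLp.toLp 2 c, by rw [frameMap_apply]; exact hc⟩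
  · rintro ⟨x, hx⟩
    exact ⟨x.ofLp, by rw [← hx, frameMap_apply]⟩

theorem IsOrientedEnd.exists_norm_sub_le {n : ℕ} {N : Set (Cn n)} {η : OrientedPlane n} {R : ℝ}
    {Φ : EuclideanSpace ℝ (Fin n) → Cn n} (h : IsOrientedEnd N η R Φ) :
    ∃ (e : Frame n) (C : ℝ), η.toSubmodule = Submodule.span ℝ (Set.range e.1) ∧
      ∀ x ∈ exterior n R, ‖Φ x - frameMap e.1 x‖ ≤ C := by
  obtain ⟨hsm, -, -, -, e, rfl, h0, -⟩ := h
  obtain ⟨C, hC⟩ := exists_norm_le_of_tendsto_cobounded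
    (fun x hx => (hsm x hx).continuousAt.sub (frameMap e.1).continuous.continuousAt) h0
  exact ⟨e, C, rfl, fun x hx => hC x (le_of_lt hx)⟩

theorem IsOrientedEnd.coarselyIn_plane {n : ℕ} {N : Set (Cn n)} {η : OrientedPlane n} {R : ℝ}
    {Φ : EuclideanSpace ℝ (Fin n) → Cn n} (h : IsOrientedEnd N η R Φ) :
    CoarselyIn (Φ '' exterior n R) η.toSubmodule := by
  obtain ⟨e, C, he, hC⟩ := h.exists_norm_sub_le
  refine ⟨C, ?_⟩
  rintro _ ⟨x, hx, rfl⟩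
  exact ⟨frameMap e.1 x, by
    rw [he]; exact mem_span_range_iff_frameMap.2 ⟨x, rfl⟩, hC x hx⟩

theorem IsOrientedEnd.plane_coarselyIn {n : ℕ} {N : Set (Cn n)} {η : OrientedPlane n} {R : ℝ}
    {Φ : EuclideanSpace ℝ (Fin n) → Cn n} (h : IsOrientedEnd N η R Φ) (hN : N.Nonempty) :
    CoarselyIn (η.toSubmodule : Set (Cn n)) N := by
  obtain ⟨e, C, he, hC⟩ := h.exists_norm_sub_le
  obtain ⟨-, -, hmaps, -⟩ := h
  obtain ⟨q, hq⟩ := hN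
  refine ⟨max C (‖frameMap e.1‖ * R + ‖q‖), fun v hv => ?_⟩
  rw [he] at hv
  obtain ⟨x, rfl⟩ := mem_span_range_iff_frameMap.1 hv
  by_cases hx : R < ‖x‖
  · exact ⟨Φ x, hmaps hx, by rw [norm_sub_rev]; exact (hC x hx).trans (le_max_left _ _)⟩
  · refine ⟨q, hq, le_trans ((norm_sub_le _ _).trans ?_) (le_max_right _ _)⟩
    exact add_le_add (((frameMap e.1).le_opNorm x).trans
      (mul_le_mul_of_nonneg_left (not_lt.1 hx) (norm_nonneg _))) le_rfl

theorem IsAsymptoticTo.coarselyIn {n : ℕ} {N : Set (Cn n)} {η ξ : OrientedPlane n}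
    (h : IsAsymptoticTo N η ξ) :
    CoarselyIn N ((η.toSubmodule : Set (Cn n)) ∪ ξ.toSubmodule) := by
  obtain ⟨R, -, Φ, Ψ, hΦ, hΨ, -, hc⟩ := h
  obtain ⟨C, hC⟩ := hc.isBounded.exists_norm_le
  have h1 : CoarselyIn (N \ (Φ '' exterior n R ∪ Ψ '' exterior n R))
      ((η.toSubmodule : Set (Cn n)) ∪ ξ.toSubmodule) :=
    ⟨C, fun x hx => ⟨0, Or.inl (Submodule.zero_mem _), by rw [sub_zero]; exact hC x hx⟩⟩
  refine (h1.union ((hΦ.coarselyIn_plane.mono_right Set.subset_union_left).union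
    (hΨ.coarselyIn_plane.mono_right Set.subset_union_right))).mono_left fun x hx => ?_
  by_cases hx' : x ∈ Φ '' exterior n R ∪ Ψ '' exterior n R
  · exact Or.inr hx'
  · exact Or.inl ⟨hx, hx'⟩

theorem IsAsymptoticTo.coarselyIn' {n : ℕ} {N : Set (Cn n)} {η ξ : OrientedPlane n}
    (h : IsAsymptoticTo N η ξ) (hN : N.Nonempty) :
    CoarselyIn ((η.toSubmodule : Set (Cn n)) ∪ ξ.toSubmodule) N := by
  obtain ⟨R, -, Φ, Ψ, hΦ, hΨ, -, -⟩ := h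
  exact (hΦ.plane_coarselyIn hN).union (hΨ.plane_coarselyIn hN)

/-! ### The planes at infinity of a Lawlor neck -/

/-- The sign `σ = ±1` treats both ends at once; the coordinates of a unit vector are at most `1` in
modulus, so errors in the profile curve control the error in space. -/
theorem exists_norm_neckMap_sub_le {n : ℕ} {a : Fin n → ℝ} {c : Fin n → ℂ} {σ : ℝ}
    (e : Fin n → Cn n) (t : ℝ)
    (h : ∀ k, ∃ C, ∀ r, 0 ≤ r → ‖lawlorCurve a k (σ * r) - c k * r‖ ≤ C) :
    ∃ C, ∀ (r : ℝ) (x : EuclideanSpace ℝ (Fin n)), 0 ≤ r → ‖x‖ = 1 →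
      ‖t • neckMap a e (σ * r) x - frameMap (fun k => c k • e k) ((t * r) • x)‖ ≤ C := by
  choose C hC using h
  refine ⟨|t| * ∑ k, C k * ‖e k‖, fun r x hr hx => ?_⟩
  have h1 : t • neckMap a e (σ * r) x - frameMap (fun k => c k • e k) ((t * r) • x)
      = t • ∑ k, ((lawlorCurve a k (σ * r) - c k * r) * (x k : ℂ)) • e k := by
    rw [frameMap_apply, neckMap, Finset.smul_sum, Finset.smul_sum, ← Finset.sum_sub_distrib]
    refine Finset.sum_congr rfl fun k _ => ?_
    ext i
    simp only [PiLp.sub_apply, PiLp.smul_apply, smul_eq_mul, Complex.real_smul]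
    push_cast
    ring
  rw [h1, norm_smul, Real.norm_eq_abs]
  refine mul_le_mul_of_nonneg_left (norm_sum_le_of_le _ fun k _ => ?_) (abs_nonneg t)
  rw [norm_smul, norm_mul]
  refine mul_le_mul_of_nonneg_right ?_ (norm_nonneg _)
  refine (mul_le_of_le_one_right (norm_nonneg _) ?_).trans (hC k r hr)
  rw [Complex.norm_real, ← hx]
  exact PiLp.norm_apply_le x k

theorem exists_smul_unit {n : ℕ} (hn : 1 ≤ n) (v : EuclideanSpace ℝ (Fin n)) {t : ℝ} (ht : 0 < t) :
    ∃ (r : ℝ) (x : EuclideanSpace ℝ (Fin n)), 0 ≤ r ∧ ‖x‖ = 1 ∧ (t * r) • x = v := by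
  by_cases hv : v = 0
  · exact ⟨0, EuclideanSpace.single ⟨0, hn⟩ 1, le_rfl, by simp, by simp [hv]⟩
  · have hv' := norm_pos_iff.2 hv
    refine ⟨‖v‖ / t, ‖v‖⁻¹ • v, by positivity, norm_inv_smul_eq_one hv', ?_⟩
    rw [smul_smul, mul_div_cancel₀ _ ht.ne', mul_inv_cancel₀ hv'.ne', one_smul]

theorem unitaryFrame_phase_eq {n : ℕ} {A : Matrix (Fin n) (Fin n) ℂ}
    (hA : A ∈ Matrix.unitaryGroup (Fin n) ℂ) (φ : Fin n → ℝ) :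
    (unitaryFrame (A * phaseMatrix φ) (mul_mem hA (phaseMatrix_mem_unitaryGroup φ))).1
      = fun k => Complex.exp (-(φ k : ℂ) * Complex.I) • (unitaryFrame A hA).1 k := by
  funext k
  ext i
  simp only [unitaryFrame, phaseMatrix, Matrix.mul_diagonal, PiLp.smul_apply, smul_eq_mul]
  ring

theorem coarselyIn_lawlorNeck {n : ℕ} [Nontrivial (Fin n)] (hn : 1 ≤ n) {a : Fin n → ℝ}
    (ha : ∀ k, 0 < a k) {A : Matrix (Fin n) (Fin n) ℂ}
    (hA : A ∈ Matrix.unitaryGroup (Fin n) ℂ) {t : ℝ} (ht : 0 < t) :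
    let N := (fun w : Cn n => t • Matrix.toEuclideanLin A w) '' lawlorModel a
    let V₁ := Submodule.span ℝ (Set.range (unitaryFrame A hA).1)
    let V₂ := Submodule.span ℝ (Set.range (unitaryFrame (A * phaseMatrix (lawlorAngle a))
      (mul_mem hA (phaseMatrix_mem_unitaryGroup _))).1)
    CoarselyIn N ((V₁ : Set (Cn n)) ∪ V₂) ∧ CoarselyIn ((V₁ : Set (Cn n)) ∪ V₂) N := by
  intro N V₁ V₂
  have hNe : N = {p | ∃ (y : ℝ) (x : EuclideanSpace ℝ (Fin n)),
      ‖x‖ = 1 ∧ p = t • neckMap a (unitaryFrame A hA).1 y x} := image_lawlorModel a hA t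
  set e := (unitaryFrame A hA).1 with he
  have hz : ∀ k, Continuous (lawlorCurve a k) := fun k => (contDiff_lawlorCurve ha k).continuous
  have hb1 : ∀ k, ∃ C, ∀ r : ℝ, 0 ≤ r → ‖lawlorCurve a k (-1 * r) - 1 * r‖ ≤ C := fun k => by
    refine exists_norm_le_of_tendsto_atTop (f := fun r : ℝ => lawlorCurve a k (-1 * r) - 1 * r)
      (((hz k).comp (by fun_prop)).sub (by fun_prop)) ?_
    simpa using tendsto_lawlorCurve_neg_sub ha k
  have hb2 : ∀ k, ∃ C, ∀ r : ℝ, 0 ≤ r →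
      ‖lawlorCurve a k (1 * r) - Complex.exp (-(lawlorAngle a k : ℂ) * Complex.I) * r‖ ≤ C :=
    fun k => by
      simp only [one_mul]
      exact exists_norm_le_of_tendsto_atTop
        ((hz k).sub (continuous_const.mul Complex.continuous_ofReal)) (tendsto_lawlorCurve_sub ha k)
  obtain ⟨C₁, hC₁⟩ := exists_norm_neckMap_sub_le e t (c := fun _ => 1) hb1
  obtain ⟨C₂, hC₂⟩ := exists_norm_neckMap_sub_le e t hb2
  have hfr1 : (fun k => (1 : ℂ) • e k) = e := by simp
  rw [hfr1] at hC₁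
  rw [← unitaryFrame_phase_eq hA] at hC₂
  constructor
  · refine ⟨max C₁ C₂, fun p hp => ?_⟩
    rw [hNe] at hp
    obtain ⟨y, x, hx, rfl⟩ := hp
    rcases le_total y 0 with hy | hy
    · have := hC₁ (-y) x (by linarith) hx
      rw [neg_one_mul, neg_neg] at this
      exact ⟨_, Or.inl (mem_span_range_iff_frameMap.2 ⟨_, rfl⟩), this.trans (le_max_left _ _)⟩
    · have := hC₂ y x hy hx
      rw [one_mul] at this
      exact ⟨_, Or.inr (mem_span_range_iff_frameMap.2 ⟨_, rfl⟩), this.trans (le_max_right _ _)⟩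
  · refine CoarselyIn.union ⟨C₁, fun v hv => ?_⟩ ⟨C₂, fun v hv => ?_⟩ <;>
      obtain ⟨v, rfl⟩ := mem_span_range_iff_frameMap.1 hv <;>
      obtain ⟨r, x, hr, hx, rfl⟩ := exists_smul_unit hn v ht <;>
      rw [hNe]
    · exact ⟨_, ⟨_, x, hx, rfl⟩, by rw [norm_sub_rev]; exact hC₁ r x hr hx⟩
    · exact ⟨_, ⟨_, x, hx, rfl⟩, by rw [norm_sub_rev]; exact hC₂ r x hr hx⟩

theorem finrank_span_frame {n : ℕ} (e : Frame n) :
    Module.finrank ℝ (Submodule.span ℝ (Set.range e.1)) = n := by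
  rw [finrank_span_eq_card e.2.linearIndependent, Fintype.card_fin]

theorem span_unitaryFrame_ne {n : ℕ} {A : Matrix (Fin n) (Fin n) ℂ}
    (hA : A ∈ Matrix.unitaryGroup (Fin n) ℂ) {φ : Fin n → ℝ} {k : Fin n}
    (hk : Real.sin (φ k) ≠ 0) :
    Submodule.span ℝ (Set.range (unitaryFrame A hA).1)
      ≠ Submodule.span ℝ (Set.range (unitaryFrame (A * phaseMatrix φ)
        (mul_mem hA (phaseMatrix_mem_unitaryGroup φ))).1) := by
  intro h
  obtain ⟨-, hff, hef⟩ := orthonormal_sumElim_iff.1 (orthonormal_unitaryFrame_sumElim hA)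
  have h1 : (unitaryFrame (A * phaseMatrix φ) (mul_mem hA (phaseMatrix_mem_unitaryGroup φ))).1 k
      ∈ Submodule.span ℝ (Set.range (unitaryFrame A hA).1) := by
    rw [h]
    exact Submodule.subset_span ⟨k, rfl⟩
  rw [unitaryFrame_mul_phaseMatrix hA, Submodule.add_mem_iff_right _
    (Submodule.smul_mem _ _ (Submodule.subset_span (Set.mem_range_self k))), Submodule.smul_mem_iff _ hk] at h1
  have h2 : Submodule.span ℝ (Set.range (unitaryFrame A hA).1)
      ≤ (Submodule.span ℝ {(-Complex.I) • (unitaryFrame A hA).1 k})ᗮ := by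
    rw [Submodule.span_le]
    rintro _ ⟨j, rfl⟩
    rw [SetLike.mem_coe, Submodule.mem_orthogonal_singleton_iff_inner_left]
    exact hef j k
  have h3 := Submodule.mem_orthogonal_singleton_iff_inner_left.1 (h2 h1)
  have h4 := orthonormal_iff_ite.1 hff k k
  rw [if_pos rfl, h3] at h4
  exact zero_ne_one h4

/-- Through `N`, the unions `η ∪ ξ` and `V₁ ∪ V₂` are at bounded distance from each other. All four
planes have dimension `n`, so each equals one of the other pair; as `V₁ ≠ V₂`, the pairs match up to
order. Subspaces suffice, because `LawlorPair` involves only the symmetric matrices. -/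
theorem lawlorPair_of_isAsymptoticTo {n : ℕ} (hn : 1 ≤ n) {η ξ : SLagPlane n} {N : Set (Cn n)}
    (hN : IsLawlorNeck N) (h : IsAsymptoticTo N η.1 ξ.1) : LawlorPair η ξ ∨ LawlorPair ξ η := by
  obtain ⟨a, ha, hθ, A, hA, t, ht, rfl⟩ := hN
  have hs := sum_lawlorAngle hn ha
  have hn2 : 2 ≤ n := by
    by_contra hlt
    obtain rfl : n = 1 := by omega
    rw [Fin.sum_univ_one] at hs
    linarith [(hθ 0).2]
  have : Nontrivial (Fin n) := Fin.nontrivial_iff_two_le.2 hn2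
  have hAU := (Matrix.mem_specialUnitaryGroup_iff.1 hA).1
  have hcoarse := coarselyIn_lawlorNeck hn ha hAU ht
  set v₁ := unitaryFrame A hAU with hv₁
  set v₂ := unitaryFrame (A * phaseMatrix (lawlorAngle a))
    (mul_mem hAU (phaseMatrix_mem_unitaryGroup _)) with hv₂
  obtain ⟨h1, h2⟩ := hcoarse
  have hNne : ((fun w : Cn n => t • Matrix.toEuclideanLin A w) '' lawlorModel a).Nonempty :=
    ⟨_, WithLp.toLp 2 _, ⟨0, EuclideanSpace.single ⟨0, hn⟩ 1, by simp, fun k => rfl⟩, rfl⟩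
  have h3 := h.coarselyIn
  have h4 := h.coarselyIn' hNne
  have hne := span_unitaryFrame_ne hAU (φ := lawlorAngle a) (k := ⟨0, hn⟩)
    (Real.sin_pos_of_pos_of_lt_pi (hθ _).1 (hθ _).2).ne'
  have hfr : ∀ ζ : SLagPlane n, Module.finrank ℝ ζ.1.toSubmodule = n := fun ζ => by
    obtain ⟨e, he, -⟩ := ζ.exists_frame
    rw [he]
    exact finrank_span_frame e
  have heq : ∀ {V W : Submodule ℝ (Cn n)}, Module.finrank ℝ V = n → Module.finrank ℝ W = n →
      V ≤ W → V = W := fun hV hW hle =>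
    Submodule.eq_of_le_of_finrank_eq hle (hV.trans hW.symm)
  have hη := (submodule_le_or_le_of_coarselyIn
    ((h4.mono_left Set.subset_union_left).trans h1)).imp
      (heq (hfr η) (finrank_span_frame v₁)) (heq (hfr η) (finrank_span_frame v₂))
  have hξ := (submodule_le_or_le_of_coarselyIn
    ((h4.mono_left Set.subset_union_right).trans h1)).imp
      (heq (hfr ξ) (finrank_span_frame v₁)) (heq (hfr ξ) (finrank_span_frame v₂))
  have hV₁ := (submodule_le_or_le_of_coarselyIn
    ((h2.mono_left Set.subset_union_left).trans h3)).imp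
      (heq (finrank_span_frame v₁) (hfr η)) (heq (finrank_span_frame v₁) (hfr ξ))
  have hV₂ := (submodule_le_or_le_of_coarselyIn
    ((h2.mono_left Set.subset_union_right).trans h3)).imp
      (heq (finrank_span_frame v₂) (hfr η)) (heq (finrank_span_frame v₂) (hfr ξ))
  have key : ∀ {ζ ζ' : SLagPlane n},
      ζ.1.toSubmodule = Submodule.span ℝ (Set.range v₁.1) →
      ζ'.1.toSubmodule = Submodule.span ℝ (Set.range v₂.1) → LawlorPair ζ ζ' := fun hζ hζ' =>
    ⟨A, lawlorAngle a, ⟨hA, SLagPlane.symMatrix_eq_of_toSubmodule _ (v := v₁) hAU hζ,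
      SLagPlane.symMatrix_eq_of_toSubmodule _ (v := v₂)
        (mul_mem hAU (phaseMatrix_mem_unitaryGroup _)) hζ'⟩, fun k => hθ k, hs⟩
  rcases hη with hη | hη <;> rcases hξ with hξ | hξ
  · rw [hη, hξ, or_self] at hV₂
    exact absurd hV₂.symm hne
  · exact Or.inl (key hη hξ)
  · exact Or.inr (key hξ hη)
  · rw [hη, hξ, or_self] at hV₁
    exact absurd hV₁ hne

theorem exists_isLawlorNeck_iff {n : ℕ} (hn : 1 ≤ n) (η ξ : SLagPlane n) :
    (∃ N : Set (Cn n), IsLawlorNeck N ∧ IsAsymptoticTo N η.1 ξ.1) ↔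
      (η.1.Transverse ξ.1 ∧ AngleCriterion η.1 ξ.1) := by
  rw [transverse_and_angleCriterion_iff hn]
  constructor
  · rintro ⟨N, hN, h⟩
    exact lawlorPair_of_isAsymptoticTo hn hN h
  · rintro (h | h)
    · exact h.exists_isLawlorNeck hn
    · obtain ⟨N, hN, h'⟩ := h.exists_isLawlorNeck hn
      exact ⟨N, hN, h'.symm⟩

end

end

end SLag

theorem mainTheorem7 (n : ℕ) (hn : 1 ≤ n) :
    (∀ η ξ : SLag.SLagPlane n,
      (∃ N : Set (SLag.Cn n), SLag.IsLawlorNeck N ∧ SLag.IsAsymptoticTo N η.1 ξ.1) ↔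
        (η.1.Transverse ξ.1 ∧ SLag.AngleCriterion η.1 ξ.1)) ∧
    IsOpen {q : SLag.SLagPlane n × SLag.SLagPlane n |
      ∃ N : Set (SLag.Cn n), SLag.IsLawlorNeck N ∧ SLag.IsAsymptoticTo N q.1.1 q.2.1} ∧
    IsOpen {q : SLag.SLagPlane n × SLag.SLagPlane n |
      q.1.1.Transverse q.2.1 ∧ SLag.AngleCriterion q.1.1 q.2.1} ∧
    (n ≤ 3 → ∀ η ξ : SLag.SLagPlane n, SLag.AngleCriterion η.1 ξ.1) := by
  have hopen := SLag.isOpen_transverse_and_angleCriterion hn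
  refine ⟨SLag.exists_isLawlorNeck_iff hn, ?_, hopen, SLag.angleCriterion_of_le_three hn⟩
  simpa only [SLag.exists_isLawlorNeck_iff hn] using hopen
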